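/- Let $R$ be a commutative noetherian domain of Krull dimension $1$, and let $M$ be a finitely generated torsion-free $R$-module with endomorphism ring $S=\mathrm{End}_R(M)$. Assume that $S$ is semilocal, with a ring isomorphism $S/J(S)\cong M_{n_1}(D_1)\times\cdots\times M_{n_s}(D_s)$, where the $D_i$ are division rings and $n_i\ge 1$. Notation. Let $\mathbb N_0^*=\mathbb N_0\cup\{\infty\}$, with $0\cdot\infty=0$ and $x\cdot\infty=\infty$ for $x\neq 0$. Let $V_i$ be the simple right $S$-module of row vectors of length $n_i$ over $D_i$ belonging to the $i$-th factor. For a right $S$-module $P$ let $\mathbf{dim}_S(P)\in(\mathbb N_0^*)^s$ have entries $\dim_{D_i}\mathrm{Hom}_S(V_i,P/PJ(S))$, infinite dimensions being written $\infty$, and for an $R$-module $X$ put $\mathbf D_M(X)=\mathbf{dim}_S(\mathrm{Hom}_R(M,X))$. Let $\mathrm{Add}(M)$ (respectively $\mathrm{add}(M)$) be the class of modules isomorphic to direct summands of arbitrary (respectively finite) direct sums of copies of $M$; $V^*(M)$ is the set of isomorphism classes of countably generated modules in $\mathrm{Add}(M)$, and $V(M)$ that of modules in $\mathrm{add}(M)$.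 A system of supports $\mathcal S(n_1,\dots,n_s)$ is a collection $\mathcal S$ of subsets of $\{1,\dots,s\}$ with a submonoid $A_H\subseteq\mathbb N_0^{\{1,\dots,s\}\setminus H}$ for each $H\in\mathcal S$, such that: $\emptyset\in\mathcal S$ and $(n_1,\dots,n_s)\in A_\emptyset$; $\mathcal S$ is closed under unions, and $H\cup\mathrm{supp}(x)\in\mathcal S$ whenever $x\in A_H$; and if $H\subseteq K$ are in $\mathcal S$, the canonical projection maps $A_H$ into $A_K$. The monoid given by the system is $\bigcup_{H\in\mathcal S}\varepsilon_H(A_H)\subseteq(\mathbb N_0^*)^s$, where $\varepsilon_H$ extends a vector by $\infty$ on $H$. The system is almost-free if each $A_H$ is a full submonoid (that is, $a,b\in A_H$ and $a+c=b$ with $c\in\mathbb N_0^{\{1,\dots,s\}\setminus H}$ imply $c\in A_H$) and $A_H=\mathbb N_0^{\{1,\dots,s\}\setminus H}$ for every nonempty $H\in\mathcal S$. Then $B=\mathbf D_M(V^*(M))$ is a submonoid of $(\mathbb N_0^*)^s$ given by an almost-free system of supports $\mathcal S(n_1,\dots,n_s)$. Put $A=B\cap\mathbb N_0^s$; then $A=\mathbf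 D_M(V(M))$. Moreover $\mathbf D_M(M)=(n_1,\dots,n_s)$, and this element is an order-unit of $A$, and an order-unit of $B$ when infinite multiples are allowed: for every $b\in A$ there are $k\in\mathbb N_0$ and $c\in A$ with $b+c=k\cdot(n_1,\dots,n_s)$, and for every $b\in B$ there are $k\in\mathbb N_0^*$ and $c\in B$ with $b+c=k\cdot(n_1,\dots,n_s)$. Finally, the following are equivalent: every object of $\mathrm{Add}(M)$ is a direct sum of modules in $\mathrm{add}(M)$; every object of $\mathrm{Add}(M)$ is a direct sum of finitely generated modules; $B=A+\infty\cdot A:=\{a_1+\infty\cdot a_2 : a_1,a_2\in A\}$. -/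

import Mathlib

universe u v w

noncomputable section

/-! ## Right modules and the dimension vector over a semilocal ring

Right modules over a (noncommutative) ring `S` are modules over the opposite ring `Sᵐᵒᵖ`. -/

section RightModules

variable {S : Type u} [Ring S]

/-- The submodule `P J(S)` of a right `S`-module `P`. -/
def mulJacobson (S : Type u) [Ring S] (P : Type v) [AddCommGroup P] [Module Sᵐᵒᵖ P] :
    Submodule Sᵐᵒᵖ P :=
  Submodule.span Sᵐᵒᵖ {y | ∃ f ∈ Ring.jacobson S, ∃ x : P, y = MulOpposite.op f • x}

variable {s : ℕ} {n : Fin s → ℕ} {D : Fin s → Type w} [∀ i, DivisionRing (D i)]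

/-- The simple right `S`-module `V_i` of row vectors of length `n_i` over `D_i` that belongs to the
`i`-th factor of a decomposition `S / J(S) ≅ M_{n_1}(D_1) × ⋯ × M_{n_s}(D_s)`. -/
def SimpleRow (_e : S ⧸ Ring.jacobson S ≃+* ∀ i, Matrix (Fin (n i)) (Fin (n i)) (D i))
    (i : Fin s) : Type w :=
  Fin (n i) → D i

namespace SimpleRow

variable (e : S ⧸ Ring.jacobson S ≃+* ∀ i, Matrix (Fin (n i)) (Fin (n i)) (D i)) (i : Fin s)

instance : AddCommGroup (SimpleRow e i) := inferInstanceAs (AddCommGroup (Fin (n i) → D i))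

/-- Left multiplication by scalars in `D_i`. -/
instance : Module (D i) (SimpleRow e i) := inferInstanceAs (Module (D i) (Fin (n i) → D i))

/-- The row vector underlying an element of `V_i`. -/
def toRow : SimpleRow e i ≃ₗ[D i] (Fin (n i) → D i) := LinearEquiv.refl (D i) (Fin (n i) → D i)

/-- The `i`-th matrix of the class of `f` in `S / J(S)`. -/
def matrixOf : S →+* Matrix (Fin (n i)) (Fin (n i)) (D i) :=
  (Pi.evalRingHom (fun i => Matrix (Fin (n i)) (Fin (n i)) (D i)) i).comp
    (e.toRingHom.comp (Ideal.Quotient.mk (Ring.jacobson S)))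

/-- The right action of `S`: row vectors times the `i`-th matrix of the class of `f`. -/
instance : Module Sᵐᵒᵖ (SimpleRow e i) where
  smul f x := (toRow e i).symm (Matrix.vecMul (toRow e i x) (matrixOf e i f.unop))
  one_smul x := by
    change (toRow e i).symm (Matrix.vecMul (toRow e i x) (matrixOf e i 1)) = x
    rw [map_one, Matrix.vecMul_one, LinearEquiv.symm_apply_apply]
  mul_smul f g x := by
    change (toRow e i).symm (Matrix.vecMul (toRow e i x) (matrixOf e i (g.unop * f.unop)))
      = (toRow e i).symm (Matrix.vecMul (toRow e i ((toRow e i).symm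
        (Matrix.vecMul (toRow e i x) (matrixOf e i g.unop)))) (matrixOf e i f.unop))
    rw [map_mul, LinearEquiv.apply_symm_apply, Matrix.vecMul_vecMul]
  smul_zero f := by
    change (toRow e i).symm (Matrix.vecMul (toRow e i 0) (matrixOf e i f.unop)) = 0
    rw [map_zero, Matrix.zero_vecMul, map_zero]
  smul_add f x y := by
    change (toRow e i).symm (Matrix.vecMul (toRow e i (x + y)) (matrixOf e i f.unop)) =
      (toRow e i).symm (Matrix.vecMul (toRow e i x) (matrixOf e i f.unop)) +
      (toRow e i).symm (Matrix.vecMul (toRow e i y) (matrixOf e i f.unop))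
    rw [map_add, Matrix.add_vecMul, map_add]
  add_smul f g x := by
    change (toRow e i).symm (Matrix.vecMul (toRow e i x) (matrixOf e i (f.unop + g.unop))) =
      (toRow e i).symm (Matrix.vecMul (toRow e i x) (matrixOf e i f.unop)) +
      (toRow e i).symm (Matrix.vecMul (toRow e i x) (matrixOf e i g.unop))
    rw [map_add, Matrix.vecMul_add, map_add]
  zero_smul x := by
    change (toRow e i).symm (Matrix.vecMul (toRow e i x) (matrixOf e i 0)) = 0
    rw [map_zero, Matrix.vecMul_zero, map_zero]

instance : SMulCommClass Sᵐᵒᵖ (D i) (SimpleRow e i) where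
  smul_comm f d x := by
    change (toRow e i).symm (Matrix.vecMul (toRow e i (d • x)) (matrixOf e i f.unop)) =
      d • (toRow e i).symm (Matrix.vecMul (toRow e i x) (matrixOf e i f.unop))
    rw [map_smul, Matrix.smul_vecMul, map_smul]

end SimpleRow

/-- The right `D_i`-vector space `Hom_S(V_i, N)`, with `(h · d)(x) = h (d x)`. -/
abbrev homRightVectorSpace
    (e : S ⧸ Ring.jacobson S ≃+* ∀ i, Matrix (Fin (n i)) (Fin (n i)) (D i)) (i : Fin s)
    (N : Type v) [AddCommGroup N] [Module Sᵐᵒᵖ N] :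
    Module (D i)ᵐᵒᵖ (SimpleRow e i →ₗ[Sᵐᵒᵖ] N) :=
  inferInstanceAs (Module (D i)ᵈᵐᵃ (SimpleRow e i →ₗ[Sᵐᵒᵖ] N))

/-- The dimension vector of a right `S`-module `P`, with entries
`dim_{D_i} Hom_S(V_i, P / P J(S))`; an infinite dimension is recorded as `∞`. -/
def dimVec (e : S ⧸ Ring.jacobson S ≃+* ∀ i, Matrix (Fin (n i)) (Fin (n i)) (D i))
    (P : Type v) [AddCommGroup P] [Module Sᵐᵒᵖ P] : Fin s → ℕ∞ :=
  fun i =>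
    letI := homRightVectorSpace e i (P ⧸ mulJacobson S P)
    Cardinal.toENat (Module.rank (D i)ᵐᵒᵖ (SimpleRow e i →ₗ[Sᵐᵒᵖ] (P ⧸ mulJacobson S P)))

end RightModules

/-! ## The categories `add(M)` and `Add(M)` and the map `D_M` -/

section AddCategories

variable (R : Type u) [CommRing R] (M : Type v) [AddCommGroup M] [Module R M]

/-- The right `End_R(M)`-module `Hom_R(M, X)`, with `h · f = h ∘ f`. -/
abbrev homRightModule (X : Type v) [AddCommGroup X] [Module R X] :
    Module (Module.End R M)ᵐᵒᵖ (M →ₗ[R] X) where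
  smul f h := h ∘ₗ f.unop
  one_smul _ := LinearMap.comp_id _
  mul_smul _ _ _ := (LinearMap.comp_assoc _ _ _).symm
  smul_zero _ := LinearMap.zero_comp _
  smul_add _ _ _ := LinearMap.add_comp _ _ _
  add_smul _ _ _ := LinearMap.comp_add _ _ _
  zero_smul _ := LinearMap.comp_zero _

/-- `X` lies in `Add(M)`: it is isomorphic to a direct summand of a direct sum of copies of `M`. -/
def InAdd (X : Type v) [AddCommGroup X] [Module R X] : Prop :=
  ∃ (ι : Type v) (f : X →ₗ[R] (ι →₀ M)) (g : (ι →₀ M) →ₗ[R] X), g ∘ₗ f = LinearMap.id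

/-- `X` lies in `add(M)`: it is isomorphic to a direct summand of `M ^ k` for some `k`. -/
def InFinAdd (X : Type v) [AddCommGroup X] [Module R X] : Prop :=
  ∃ (k : ℕ) (f : X →ₗ[R] (Fin k → M)) (g : (Fin k → M) →ₗ[R] X), g ∘ₗ f = LinearMap.id

/-- `X` is generated by a countable set. -/
def IsCountablyGenerated (X : Type v) [AddCommGroup X] [Module R X] : Prop :=
  ∃ c : Set X, c.Countable ∧ Submodule.span R c = ⊤

open Classical in
/-- `X` is the direct sum of a family of submodules that all lie in `add(M)`. -/
def IsDirectSumInFinAdd (X : Type v) [AddCommGroup X] [Module R X] : Prop :=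
  ∃ (κ : Type v) (N : κ → Submodule R X), DirectSum.IsInternal N ∧ ∀ k, InFinAdd R M (N k)

open Classical in
/-- `X` is the direct sum of a family of finitely generated submodules. -/
def IsDirectSumOfFinite (X : Type v) [AddCommGroup X] [Module R X] : Prop :=
  ∃ (κ : Type v) (N : κ → Submodule R X), DirectSum.IsInternal N ∧ ∀ k, (N k).FG

variable {R M}
variable {s : ℕ} {n : Fin s → ℕ} {D : Fin s → Type w} [∀ i, DivisionRing (D i)]
variable (e : Module.End R M ⧸ Ring.jacobson (Module.End R M) ≃+*
  ∀ i, Matrix (Fin (n i)) (Fin (n i)) (D i))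

/-- `D_M(X) = dim_S (Hom_R(M, X))`, where `S = End_R(M)`. -/
def dimHom (X : Type v) [AddCommGroup X] [Module R X] : Fin s → ℕ∞ :=
  letI : Module (Module.End R M)ᵐᵒᵖ (M →ₗ[R] X) := homRightModule R M X
  dimVec e (M →ₗ[R] X)

/-- `D_M(V^*(M))`: the values of `D_M` on the countably generated modules in `Add(M)`. -/
def imageVStar : Set (Fin s → ℕ∞) :=
  {x | ∃ (X : Type v) (_ : AddCommGroup X) (_ : Module R X),
    InAdd R M X ∧ IsCountablyGenerated R X ∧ dimHom e X = x}

/-- `D_M(V(M))`: the values of `D_M` on the modules in `add(M)`. -/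
def imageV : Set (Fin s → ℕ∞) :=
  {x | ∃ (X : Type v) (_ : AddCommGroup X) (_ : Module R X), InFinAdd R M X ∧ dimHom e X = x}

end AddCategories

/-! ## Systems of supports -/

section Supports

/-- A submonoid `A` is full if the inclusion is a divisor homomorphism. -/
def IsFullSubmonoid {F : Type u} [AddCommMonoid F] (A : AddSubmonoid F) : Prop :=
  ∀ a ∈ A, ∀ b ∈ A, (∃ c, a + c = b) → ∃ c ∈ A, a + c = b

/-- `u` is an order-unit of the submonoid `A`, with multiples taken over the scalars `K`: every
element of `A` is a summand, within `A`, of a multiple of `u`. The usual notion is `K = ℕ`. -/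
def IsOrderUnit (K : Type v) {F : Type u} [AddCommMonoid F] [SMul K F]
    (A : AddSubmonoid F) (u : F) : Prop :=
  u ∈ A ∧ ∀ b ∈ A, ∃ k : K, ∃ c ∈ A, b + c = k • u

variable {s : ℕ}

/-- A system of supports `𝒮(n_1, …, n_s)` on `{1, …, s}`. -/
structure SystemOfSupports (n : Fin s → ℕ) where
  pos : ∀ i, 0 < n i
  supports : Set (Set (Fin s))
  A : ∀ H : supports, AddSubmonoid ({i : Fin s // i ∉ H.1} → ℕ)
  empty_mem : ∅ ∈ supports
  unit_mem : (fun i => n i.1) ∈ A ⟨∅, empty_mem⟩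
  union_mem : ∀ H ∈ supports, ∀ K ∈ supports, H ∪ K ∈ supports
  supp_mem : ∀ H : supports, ∀ x ∈ A H, H.1 ∪ Subtype.val '' {i | x i ≠ 0} ∈ supports
  proj_mem : ∀ (H K : supports) (h : H.1 ⊆ K.1), ∀ x ∈ A H,
    (fun i : {i : Fin s // i ∉ K.1} => x ⟨i.1, fun hi => i.2 (h hi)⟩) ∈ A K

namespace SystemOfSupports

open Classical in
/-- The map `ε_H`, extending a vector indexed by the complement of `H` by `∞` on `H`. -/
def extend (H : Set (Fin s)) (x : {i : Fin s // i ∉ H} → ℕ) : Fin s → ℕ∞ :=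
  fun i => if h : i ∈ H then ⊤ else (x ⟨i, h⟩ : ℕ∞)

variable {n : Fin s → ℕ} (𝒮 : SystemOfSupports n)

/-- The set `⋃_H ε_H(A_H)` given by the system of supports. -/
def carrier : Set (Fin s → ℕ∞) :=
  ⋃ H : 𝒮.supports, extend H.1 '' (𝒮.A H : Set ({i : Fin s // i ∉ H.1} → ℕ))

/-- Every `A_H` is a full submonoid. -/
def IsFull : Prop := ∀ H, IsFullSubmonoid (𝒮.A H)

/-- The system is full, and `A_H` is everything for all nonempty `H`. -/
def IsAlmostFree : Prop := 𝒮.IsFull ∧ ∀ H : 𝒮.supports, H.1 ≠ ∅ → 𝒮.A H = ⊤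

end SystemOfSupports

/-- The entrywise inclusion `ℕ^s → (ℕ ∪ {∞})^s`. -/
def castVec : (Fin s → ℕ) →+ (Fin s → ℕ∞) := (Nat.castAddMonoidHom ℕ∞).compLeft (Fin s)

/-- `B ∩ ℕ^s`. -/
def finitePart (B : AddSubmonoid (Fin s → ℕ∞)) : AddSubmonoid (Fin s → ℕ) := B.comap castVec

/-- `A + ∞ · A`. -/
def addInftyMul (A : AddSubmonoid (Fin s → ℕ)) : Set (Fin s → ℕ∞) :=
  {b | ∃ a₁ ∈ A, ∃ a₂ ∈ A, b = castVec a₁ + (⊤ : ℕ∞) • castVec a₂}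

end Supports

end

/-! Put `S = End_R(M)`. Since `M` is finitely generated, `Add(M)` behaves like the projective right
`S`-modules and, modulo the radical, like `s`-tuples of vector spaces: `X` goes to its multiplicity
spaces over the `D_i`. Tuples of linear maps lift to maps out of any object of `Add(M)`
(`exists_map_eq`), and by Nakayama a lift of the identity of an object of `add(M)` has a left
inverse. Hence an object of `add(M)` is a summand of every object of `Add(M)` whose dimensions
dominate its own (`exists_retract_of_dimHom_le`). Finite dimension vectors can therefore be
subtracted, which gives fullness.

Krull dimension one enters through ideals: a nonzero two-sided ideal of `S` contains a nonzero
scalar, so its quotient is artinian over `R`. For `X` in `Add(M)` take `φ`, factoring through a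
power of `M`, that is the identity on the finite-dimensional multiplicity spaces, and a second such
map `φ'` that fixes the range of `φ`. The trace ideal `L'` of `1 - φ'` lies in every power of the
trace ideal `L` of `1 - φ`. Either `L' = 0` and `X` is in `add(M)`, or the powers of `L` reach a
nonzero idempotent ideal whose support is the set of infinite coordinates
(`inFinAdd_or_exists_idempotent`). With no infinite coordinate that ideal would lie in `J(S)` and
vanish by Nakayama, so finite dimensions force `X` into `add(M)`.

Conversely, an idempotent ideal `I` with artinian quotient contains a power of `J(S)`. An
endomorphism of `M^(ℕ)` inducing idempotents of prescribed finite ranks can then be made idempotent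
modulo `I`, and `I = I * I` turns it into the transition map of a telescope lying in `Add(M)`
(`exists_inAdd_of_idempotent`). So once some coordinate is infinite, the finite ones are arbitrary:
the system is almost free.

For the criterion, a direct sum of finitely generated modules has a vector in `A + ∞ · A`, because
only finitely many summands meet the finite coordinates. In the other direction, Kaplansky's theorem
reduces to countably generated `X`. A summand with vector `a₁` splits off, and in the rest, of
vector `∞ · a₂`, every map from `M` lands in a summand from `add(M)` (`exists_idempotent_comp_eq`).
Exhausting the module by such summands decomposes it. -/

noncomputable section

/-! ### Multiplicity spaces as functors to vector spaces over the `D_i`. -/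

section MultiplicitySpaces

attribute [local instance] homRightModule homRightVectorSpace

variable {R : Type u} [CommRing R] {M : Type v} [AddCommGroup M] [Module R M]
variable {s : ℕ} {n : Fin s → ℕ} {D : Fin s → Type w} [∀ i, DivisionRing (D i)]

/-- Postcomposition with `f`, as a map of right `End_R(M)`-modules. -/
def postcomp (M : Type v) [AddCommGroup M] [Module R M] {X Y : Type v} [AddCommGroup X]
    [Module R X] [AddCommGroup Y] [Module R Y] (f : X →ₗ[R] Y) :
    (M →ₗ[R] X) →ₗ[(Module.End R M)ᵐᵒᵖ] (M →ₗ[R] Y) where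
  toFun p := f ∘ₗ p
  map_add' p q := LinearMap.comp_add p q f
  map_smul' _ _ := rfl

theorem mulJacobson_le_comap {S : Type*} [Ring S] {P Q : Type*} [AddCommGroup P]
    [Module Sᵐᵒᵖ P] [AddCommGroup Q] [Module Sᵐᵒᵖ Q] (f : P →ₗ[Sᵐᵒᵖ] Q) :
    mulJacobson S P ≤ (mulJacobson S Q).comap f := by
  refine Submodule.span_le.2 ?_
  rintro _ ⟨j, hj, x, rfl⟩
  exact Submodule.subset_span ⟨j, hj, f x, map_smul f _ _⟩

variable (e : Module.End R M ⧸ Ring.jacobson (Module.End R M) ≃+*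
  ∀ i, Matrix (Fin (n i)) (Fin (n i)) (D i))

/-- The right `D_i`-vector space `Hom_S(V_i, P / P J(S))` for `P = Hom_R(M, X)`. -/
def MultSpace (i : Fin s) (X : Type v) [AddCommGroup X] [Module R X] : Type _ :=
  SimpleRow e i →ₗ[(Module.End R M)ᵐᵒᵖ]
    ((M →ₗ[R] X) ⧸ mulJacobson (Module.End R M) (M →ₗ[R] X))

namespace MultSpace

section

variable (i : Fin s) (X : Type v) [AddCommGroup X] [Module R X]

instance : AddCommGroup (MultSpace e i X) :=
  inferInstanceAs (AddCommGroup (SimpleRow e i →ₗ[(Module.End R M)ᵐᵒᵖ]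
    ((M →ₗ[R] X) ⧸ mulJacobson (Module.End R M) (M →ₗ[R] X))))

instance : Module (D i)ᵐᵒᵖ (MultSpace e i X) :=
  homRightVectorSpace e i ((M →ₗ[R] X) ⧸ mulJacobson (Module.End R M) (M →ₗ[R] X))

theorem dimHom_apply :
    dimHom e X i = Cardinal.toENat (Module.rank (D i)ᵐᵒᵖ (MultSpace e i X)) := rfl

/-- The homomorphism underlying an element of the multiplicity space. -/
def hom {e : Module.End R M ⧸ Ring.jacobson (Module.End R M) ≃+*
    ∀ i, Matrix (Fin (n i)) (Fin (n i)) (D i)} {i : Fin s} {X : Type v} [AddCommGroup X]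
    [Module R X] : MultSpace e i X →+ (SimpleRow e i →ₗ[(Module.End R M)ᵐᵒᵖ]
      ((M →ₗ[R] X) ⧸ mulJacobson (Module.End R M) (M →ₗ[R] X))) :=
  AddMonoidHom.id (SimpleRow e i →ₗ[(Module.End R M)ᵐᵒᵖ]
    ((M →ₗ[R] X) ⧸ mulJacobson (Module.End R M) (M →ₗ[R] X)))

end

variable {X Y Z : Type v} [AddCommGroup X] [Module R X] [AddCommGroup Y] [Module R Y]
  [AddCommGroup Z] [Module R Z] (i : Fin s)

variable {e i} in
@[ext]
theorem ext {w w' : MultSpace e i X} (h : ∀ v, hom w v = hom w' v) : w = w' :=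
  LinearMap.ext (f := hom w) (g := hom w') h

/-- The class of `p : M → X` modulo `Hom_R(M, X) J(S)`. -/
abbrev cls (p : M →ₗ[R] X) : (M →ₗ[R] X) ⧸ mulJacobson (Module.End R M) (M →ₗ[R] X) :=
  Submodule.Quotient.mk p

/-- The functoriality of the multiplicity space. -/
def map (f : X →ₗ[R] Y) : MultSpace e i X →ₗ[(D i)ᵐᵒᵖ] MultSpace e i Y where
  toFun w := (Submodule.mapQ _ _ (postcomp M f) (mulJacobson_le_comap _)) ∘ₗ hom w
  map_add' w w' := LinearMap.comp_add (hom w) (hom w') _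
  map_smul' _ _ := rfl

variable {e i} in
theorem map_apply_of_eq {f : X →ₗ[R] Y} {w : MultSpace e i X} {v : SimpleRow e i} {p : M →ₗ[R] X}
    (h : hom w v = cls p) : hom (map e i f w) v = cls (f ∘ₗ p) := by
  change (Submodule.mapQ _ _ (postcomp M f) (mulJacobson_le_comap _)) (hom w v) = _
  rw [h]; rfl

theorem map_id : map e i (LinearMap.id : X →ₗ[R] X) = LinearMap.id := by
  ext w v
  obtain ⟨p, hp⟩ := Submodule.Quotient.mk_surjective _ (hom w v)
  rw [map_apply_of_eq hp.symm, LinearMap.id_comp, LinearMap.id_apply, ← hp]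

theorem map_comp (g : Y →ₗ[R] Z) (f : X →ₗ[R] Y) :
    map e i (g ∘ₗ f) = map e i g ∘ₗ map e i f := by
  ext w v
  obtain ⟨p, hp⟩ := Submodule.Quotient.mk_surjective _ (hom w v)
  rw [map_apply_of_eq hp.symm, LinearMap.comp_apply,
    map_apply_of_eq (map_apply_of_eq hp.symm), LinearMap.comp_assoc]

theorem map_comp_apply (g : Y →ₗ[R] Z) (f : X →ₗ[R] Y) (w : MultSpace e i X) :
    map e i (g ∘ₗ f) w = map e i g (map e i f w) := by
  rw [map_comp]; rfl

theorem map_add (f g : X →ₗ[R] Y) : map e i (f + g) = map e i f + map e i g := by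
  ext w v
  obtain ⟨p, hp⟩ := Submodule.Quotient.mk_surjective _ (hom w v)
  rw [map_apply_of_eq hp.symm, LinearMap.add_apply, _root_.map_add, LinearMap.add_apply,
    map_apply_of_eq hp.symm, map_apply_of_eq hp.symm, LinearMap.add_comp]
  rfl

theorem map_zero : map e i (0 : X →ₗ[R] Y) = 0 := by
  have h := map_add e i (0 : X →ₗ[R] Y) 0
  rwa [add_zero, left_eq_add] at h

/-- `map` as an additive homomorphism. -/
def mapAddHom (X Y : Type v) [AddCommGroup X] [Module R X] [AddCommGroup Y] [Module R Y] :
    (X →ₗ[R] Y) →+ (MultSpace e i X →ₗ[(D i)ᵐᵒᵖ] MultSpace e i Y) where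
  toFun := map e i
  map_zero' := map_zero e i
  map_add' := map_add e i

theorem map_sub (f g : X →ₗ[R] Y) : map e i (f - g) = map e i f - map e i g :=
  _root_.map_sub (mapAddHom e i X Y) f g

theorem map_sum {ι : Type*} (t : Finset ι) (f : ι → X →ₗ[R] Y) :
    map e i (∑ k ∈ t, f k) = ∑ k ∈ t, map e i (f k) :=
  _root_.map_sum (mapAddHom e i X Y) f t

/-- The quotient map from `S` to its `i`-th matrix ring is onto, in all components at once. -/
theorem exists_matrixOf_eq (A : ∀ i, Matrix (Fin (n i)) (Fin (n i)) (D i)) :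
    ∃ f : Module.End R M, ∀ i, SimpleRow.matrixOf e i f = A i := by
  obtain ⟨f, hf⟩ := Ideal.Quotient.mk_surjective (e.symm A)
  refine ⟨f, fun i => ?_⟩
  change e (Ideal.Quotient.mk _ f) i = A i
  rw [hf, RingEquiv.apply_symm_apply]

theorem mem_jacobson_iff {f : Module.End R M} :
    f ∈ Ring.jacobson (Module.End R M) ↔ ∀ i, SimpleRow.matrixOf e i f = 0 := by
  rw [← Ideal.Quotient.eq_zero_iff_mem, ← map_eq_zero_iff e e.injective, funext_iff]
  rfl

/-- The matrix of `(single i A)` lifted to `S`. -/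
def lift {i : Fin s} (A : Matrix (Fin (n i)) (Fin (n i)) (D i)) : Module.End R M :=
  (exists_matrixOf_eq e (Pi.single i A)).choose

theorem matrixOf_lift {i : Fin s} (A : Matrix (Fin (n i)) (Fin (n i)) (D i)) :
    SimpleRow.matrixOf e i (lift e A) = A := by
  rw [lift, (exists_matrixOf_eq e (Pi.single i A)).choose_spec, Pi.single_eq_same]

theorem matrixOf_lift_of_ne {i j : Fin s} (h : j ≠ i)
    (A : Matrix (Fin (n i)) (Fin (n i)) (D i)) :
    SimpleRow.matrixOf e j (lift e A) = 0 := by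
  rw [lift, (exists_matrixOf_eq e (Pi.single i A)).choose_spec, Pi.single_eq_of_ne h]

theorem cls_eq_of_matrixOf_eq {f g : Module.End R M}
    (h : ∀ i, SimpleRow.matrixOf e i f = SimpleRow.matrixOf e i g) : cls f = cls g := by
  rw [Submodule.Quotient.eq]
  refine Submodule.subset_span ⟨f - g, (mem_jacobson_iff e).2 fun i => ?_, 1, rfl⟩
  rw [_root_.map_sub, h, sub_self]

/-- For `P = S` the span defining `P J(S)` adds nothing to `J(S)`, because the radical is a
two-sided ideal. -/
theorem cls_mem_jacobson {f : Module.End R M} (h : cls f = 0) :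
    f ∈ Ring.jacobson (Module.End R M) := by
  rw [Submodule.Quotient.mk_eq_zero] at h
  refine Submodule.span_induction (p := fun f _ => f ∈ Ring.jacobson (Module.End R M))
    ?_ (Submodule.zero_mem _) (fun _ _ _ _ => Submodule.add_mem _) ?_ h
  · rintro _ ⟨j, hj, x, rfl⟩
    exact Ideal.mul_mem_left _ x hj
  · intro a x _ hx
    exact Ideal.mul_mem_right a.unop _ hx

variable {i}

/-- The matrix with `k`-th row `v`. -/
def rowMatrix (k : Fin (n i)) (v : Fin (n i) → D i) : Matrix (Fin (n i)) (Fin (n i)) (D i) :=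
  Matrix.updateRow 0 k v

theorem rowMatrix_add (k : Fin (n i)) (v v' : Fin (n i) → D i) :
    rowMatrix k (v + v') = rowMatrix k v + rowMatrix k v' := by
  ext a b
  by_cases h : a = k <;> simp [rowMatrix, Matrix.updateRow_apply, h]

theorem rowMatrix_mul (k : Fin (n i)) (v : Fin (n i) → D i)
    (A : Matrix (Fin (n i)) (Fin (n i)) (D i)) :
    rowMatrix k (Matrix.vecMul v A) = rowMatrix k v * A := by
  ext a b
  by_cases h : a = k <;>
  simp [rowMatrix, Matrix.updateRow_apply, h, Matrix.mul_apply, Matrix.vecMul, dotProduct]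

theorem mul_rowMatrix (k : Fin (n i)) (v : Fin (n i) → D i)
    (A : Matrix (Fin (n i)) (Fin (n i)) (D i)) :
    A * rowMatrix k v = ∑ j, rowMatrix j (A j k • v) := by
  ext a b
  simp [rowMatrix, Matrix.updateRow_apply, Matrix.mul_apply, Matrix.sum_apply]

/-- The embedding of `V_i` as the `k`-th row of the `i`-th matrix ring, as a homomorphism. -/
def colHom (k : Fin (n i)) : SimpleRow e i →ₗ[(Module.End R M)ᵐᵒᵖ]
    ((M →ₗ[R] M) ⧸ mulJacobson (Module.End R M) (M →ₗ[R] M)) where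
  toFun v := cls (lift e (rowMatrix k (SimpleRow.toRow e i v)))
  map_add' v v' := by
    rw [← Submodule.Quotient.mk_add]
    refine cls_eq_of_matrixOf_eq e fun j => ?_
    rw [_root_.map_add]
    by_cases h : j = i
    · subst h
      simp only [matrixOf_lift, _root_.map_add, rowMatrix_add]
    · rw [_root_.map_add]
      simp only [matrixOf_lift_of_ne e h, add_zero]
  map_smul' f v := by
    refine Eq.trans (b := cls (lift e (rowMatrix k (SimpleRow.toRow e i v)) * f.unop)) ?_ rfl
    refine cls_eq_of_matrixOf_eq e fun j => ?_
    rw [_root_.map_mul]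
    by_cases h : j = i
    · subst h
      rw [matrixOf_lift, matrixOf_lift, ← rowMatrix_mul]
      rfl
    · rw [matrixOf_lift_of_ne e h, matrixOf_lift_of_ne e h, zero_mul]

/-- The embedding of `V_i` as the `k`-th row of the `i`-th matrix ring. -/
def col (k : Fin (n i)) : MultSpace e i M := colHom e k

theorem hom_col (k : Fin (n i)) (v : SimpleRow e i) :
    hom (col e k) v = cls (lift e (rowMatrix k (SimpleRow.toRow e i v))) := rfl

theorem sum_op_smul_col {ι : Type*} (t : Finset ι) (d : ι → D i) (k : ι → Fin (n i))
    (v : SimpleRow e i) : hom (∑ j ∈ t, MulOpposite.op (d j) • col e (k j)) v =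
      cls (∑ j ∈ t, lift e (rowMatrix (k j) (SimpleRow.toRow e i (d j • v)))) := by
  rw [_root_.map_sum, LinearMap.sum_apply]
  exact (_root_.map_sum (Submodule.mkQ _) _ _).symm

/-- Left multiplication by a matrix `A` spreads the `k`-th row over all rows with the coefficients
of the `k`-th column of `A`. So the multiplicity space of `M` is the column space of the `i`-th
matrix ring. -/
theorem map_col (f : Module.End R M) (k : Fin (n i)) :
    map e i f (col e k) = ∑ j, MulOpposite.op (SimpleRow.matrixOf e i f j k) • col e j := by
  ext v
  rw [sum_op_smul_col, map_apply_of_eq (hom_col e k v)]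
  refine cls_eq_of_matrixOf_eq (f := f * lift e (rowMatrix k (SimpleRow.toRow e i v))) e
    fun j => ?_
  rw [_root_.map_mul, _root_.map_sum]
  by_cases h : j = i
  · subst h
    simp only [matrixOf_lift, mul_rowMatrix, _root_.map_smul]
  · simp only [matrixOf_lift_of_ne e h, mul_zero, Finset.sum_const_zero]

/-- The `k`-th standard basis row vector. -/
def stdRow (k : Fin (n i)) : SimpleRow e i := (SimpleRow.toRow e i).symm (Pi.single k 1)

theorem linearIndependent_col : LinearIndependent (D i)ᵐᵒᵖ (col e (i := i)) := by
  rw [Fintype.linearIndependent_iff]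
  intro c hc k
  -- At the `k`-th standard row the combination is the matrix with rows `c_j e_k`; its `(k, k)`
  -- entry is the coefficient sought.
  have h : hom (∑ j, MulOpposite.op (c j).unop • col e j) (stdRow e k) = 0 := by
    simp only [MulOpposite.op_unop, hc, _root_.map_zero, LinearMap.zero_apply]
  rw [sum_op_smul_col] at h
  have h2 := (mem_jacobson_iff e).1 (cls_mem_jacobson h) i
  rw [_root_.map_sum] at h2
  simp only [matrixOf_lift] at h2
  have h3 := congrFun (congrFun h2 k) k
  rw [Matrix.sum_apply, Finset.sum_eq_single k] at h3
  · simpa [rowMatrix, stdRow] using h3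
  · intro j _ hj
    simp [rowMatrix, Matrix.updateRow_apply, hj.symm]
  · simp

/-- Every element of a multiplicity space comes from a map `M → X`. -/
theorem exists_eq_map_col (k : Fin (n i)) (w : MultSpace e i X) :
    ∃ p : M →ₗ[R] X, w = map e i p (col e k) := by
  obtain ⟨p, hp⟩ := Submodule.Quotient.mk_surjective _ (hom w (stdRow e k))
  refine ⟨p, ?_⟩
  ext v
  rw [map_apply_of_eq (hom_col e k v)]
  set f := lift e (rowMatrix k (SimpleRow.toRow e i v)) with hf
  -- The standard row generates `V_i`, so `w` is determined by its value there, the class of `p`.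
  have hv : v = MulOpposite.op f • stdRow e k := by
    change v = (SimpleRow.toRow e i).symm (Matrix.vecMul (SimpleRow.toRow e i (stdRow e k))
      (SimpleRow.matrixOf e i f))
    rw [hf, matrixOf_lift, LinearEquiv.eq_symm_apply, stdRow, LinearEquiv.apply_symm_apply,
      Matrix.single_one_vecMul]
    ext b
    simp [rowMatrix]
  rw [hv, _root_.map_smul, ← hp]
  rfl

end MultSpace

end MultiplicitySpaces

/-! ### Maps factoring through finite powers of `M`, and the classes `add(M)` and `Add(M)`. -/

section FiniteMaps

variable (R : Type u) [CommRing R] (M : Type v) [AddCommGroup M] [Module R M]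
variable (X Y Z : Type v) [AddCommGroup X] [Module R X] [AddCommGroup Y] [Module R Y]
  [AddCommGroup Z] [Module R Z]

/-- The maps `X → Y` that factor through a finite power of `M`. -/
def finMaps : Submodule R (X →ₗ[R] Y) :=
  Submodule.span R {φ | ∃ (g : M →ₗ[R] Y) (f : X →ₗ[R] M), φ = g ∘ₗ f}

variable {R M X Y Z}

theorem comp_mem_finMaps (g : M →ₗ[R] Y) (f : X →ₗ[R] M) : g ∘ₗ f ∈ finMaps R M X Y :=
  Submodule.subset_span ⟨g, f, rfl⟩

theorem comp_left_mem_finMaps {φ : X →ₗ[R] Y} (hφ : φ ∈ finMaps R M X Y) (ψ : Y →ₗ[R] Z) :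
    ψ ∘ₗ φ ∈ finMaps R M X Z := by
  refine Submodule.span_le (p := (finMaps R M X Z).comap (LinearMap.llcomp R X Y Z ψ)).2 ?_ hφ
  rintro _ ⟨g, f, rfl⟩
  exact comp_mem_finMaps (ψ ∘ₗ g) f

theorem comp_right_mem_finMaps {φ : Y →ₗ[R] Z} (hφ : φ ∈ finMaps R M Y Z) (ψ : X →ₗ[R] Y) :
    φ ∘ₗ ψ ∈ finMaps R M X Z := by
  refine Submodule.span_le (p := (finMaps R M X Z).comap (LinearMap.lcomp R Z ψ)).2 ?_ hφ
  rintro _ ⟨g, f, rfl⟩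
  exact comp_mem_finMaps g (f ∘ₗ ψ)

theorem exists_sum_of_mem_finMaps {φ : X →ₗ[R] Y} (hφ : φ ∈ finMaps R M X Y) :
    ∃ (k : ℕ) (g : Fin k → M →ₗ[R] Y) (f : Fin k → X →ₗ[R] M), φ = ∑ j, g j ∘ₗ f j := by
  induction hφ using Submodule.span_induction with
  | mem x hx =>
    obtain ⟨g, f, rfl⟩ := hx
    exact ⟨1, fun _ => g, fun _ => f, by simp⟩
  | zero => exact ⟨0, 0, 0, by simp⟩
  | add x y _ _ hx hy =>
    obtain ⟨k, g, f, rfl⟩ := hx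
    obtain ⟨k', g', f', rfl⟩ := hy
    exact ⟨k + k', Fin.append g g', Fin.append f f', by simp [Fin.sum_univ_add]⟩
  | smul r x _ hx =>
    obtain ⟨k, g, f, rfl⟩ := hx
    exact ⟨k, fun j => r • g j, f, by simp [Finset.smul_sum, LinearMap.smul_comp]⟩

theorem sum_mem_finMaps {ι : Type*} (t : Finset ι) (g : ι → M →ₗ[R] Y) (f : ι → X →ₗ[R] M) :
    ∑ j ∈ t, g j ∘ₗ f j ∈ finMaps R M X Y :=
  Submodule.sum_mem _ fun _ _ => comp_mem_finMaps _ _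

theorem mem_finMaps_of_pi {ι : Type*} [Fintype ι] (β : (ι → M) →ₗ[R] Y)
    (α : X →ₗ[R] (ι → M)) : β ∘ₗ α ∈ finMaps R M X Y := by
  classical
  have : β ∘ₗ α = ∑ j, (β ∘ₗ LinearMap.single R (fun _ => M) j) ∘ₗ (LinearMap.proj j ∘ₗ α) := by
    ext x
    simp only [LinearMap.comp_apply, LinearMap.sum_apply, ← _root_.map_sum]
    congr 1
    exact (Finset.univ_sum_single _).symm
  rw [this]
  exact sum_mem_finMaps _ _ _

/-- This turns membership in `add(M)` into a statement about one morphism, so that the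
composition-closed family `finMaps` can be used for retracts and idempotents. -/
theorem inFinAdd_iff_id_mem : InFinAdd R M X ↔ LinearMap.id ∈ finMaps R M X X := by
  constructor
  · rintro ⟨k, f, g, h⟩
    rw [← h]
    exact mem_finMaps_of_pi g f
  · intro h
    obtain ⟨k, g, f, hk⟩ := exists_sum_of_mem_finMaps h
    refine ⟨k, LinearMap.pi f, ∑ j, g j ∘ₗ LinearMap.proj j, ?_⟩
    rw [hk]
    ext x
    simp

theorem InFinAdd.mem_finMaps (h : InFinAdd R M X) (φ : X →ₗ[R] Y) : φ ∈ finMaps R M X Y :=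
  comp_left_mem_finMaps (inFinAdd_iff_id_mem.1 h) φ

/-- A retract of an object through a finite map lies in `add(M)`. -/
theorem inFinAdd_of_retract {α : X →ₗ[R] Y} {β : Y →ₗ[R] X} (hβα : β ∘ₗ α = LinearMap.id)
    (h : α ∘ₗ β ∈ finMaps R M Y Y) : InFinAdd R M X := by
  rw [inFinAdd_iff_id_mem]
  have : (LinearMap.id : X →ₗ[R] X) = β ∘ₗ (α ∘ₗ β) ∘ₗ α := by
    rw [← LinearMap.comp_assoc, ← LinearMap.comp_assoc, hβα, LinearMap.comp_assoc, hβα,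
      LinearMap.id_comp]
  rw [this]
  exact comp_left_mem_finMaps (comp_right_mem_finMaps h α) β

theorem InFinAdd.of_retract {α : X →ₗ[R] Y} {β : Y →ₗ[R] X} (h : InFinAdd R M Y)
    (hβα : β ∘ₗ α = LinearMap.id) : InFinAdd R M X :=
  inFinAdd_of_retract hβα (h.mem_finMaps _)

theorem inFinAdd_self : InFinAdd R M M :=
  inFinAdd_iff_id_mem.2 (comp_mem_finMaps LinearMap.id LinearMap.id)

theorem InFinAdd.finite [Module.Finite R M] (h : InFinAdd R M X) : Module.Finite R X := by
  obtain ⟨k, f, g, h⟩ := h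
  exact Module.Finite.of_surjective g fun x => ⟨f x, LinearMap.congr_fun h x⟩

/-- The range is the image of a submodule of some `M^k`, which is noetherian. -/
theorem range_fg_of_mem_finMaps [Module.Finite R M] [IsNoetherianRing R] {φ : X →ₗ[R] Y}
    (hφ : φ ∈ finMaps R M X Y) : (LinearMap.range φ).FG := by
  obtain ⟨k, g, f, rfl⟩ := exists_sum_of_mem_finMaps hφ
  have : (∑ j, g j ∘ₗ f j) = (∑ j, g j ∘ₗ LinearMap.proj j : (Fin k → M) →ₗ[R] Y) ∘ₗ
      LinearMap.pi f := by
    ext x; simp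
  rw [this, LinearMap.range_comp]
  exact (IsNoetherian.noetherian (LinearMap.range (LinearMap.pi f))).map _

theorem InAdd.of_retract {α : X →ₗ[R] Y} {β : Y →ₗ[R] X} (h : InAdd R M Y)
    (hβα : β ∘ₗ α = LinearMap.id) : InAdd R M X := by
  obtain ⟨ι, f, g, h⟩ := h
  refine ⟨ι, f ∘ₗ α, β ∘ₗ g, ?_⟩
  rw [LinearMap.comp_assoc, ← LinearMap.comp_assoc _ f, h, LinearMap.id_comp, hβα]

theorem inAdd_finsupp (ι : Type v) : InAdd R M (ι →₀ M) :=
  ⟨ι, LinearMap.id, LinearMap.id, rfl⟩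

theorem InFinAdd.inAdd (h : InFinAdd R M X) : InAdd R M X := by
  obtain ⟨k, f, g, h⟩ := h
  let E : (ULift.{v} (Fin k) →₀ M) ≃ₗ[R] (Fin k → M) :=
    Finsupp.linearEquivFunOnFinite R M _ ≪≫ₗ LinearEquiv.funCongrLeft R M Equiv.ulift.symm
  refine InAdd.of_retract (inAdd_finsupp (ULift.{v} (Fin k))) (α := E.symm.toLinearMap ∘ₗ f)
    (β := g ∘ₗ E.toLinearMap) ?_
  rw [← h]
  ext x
  simp

/-- A family of objects of `Add(M)` has its direct sum in `Add(M)`. -/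
theorem inAdd_finsupp_of_inAdd (h : InAdd R M X) (ι : Type v) : InAdd R M (ι →₀ X) := by
  obtain ⟨κ, f, g, h⟩ := h
  refine InAdd.of_retract (Y := ι × κ →₀ M) (inAdd_finsupp (ι × κ))
    (α := (Finsupp.curryLinearEquiv R).symm.toLinearMap ∘ₗ Finsupp.mapRange.linearMap f)
    (β := Finsupp.mapRange.linearMap g ∘ₗ (Finsupp.curryLinearEquiv R).toLinearMap) ?_
  ext x y
  simp [← LinearMap.comp_apply, h]

theorem InAdd.finsupp_nat (h : InAdd R M X) : InAdd R M (ℕ →₀ X) :=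
  let E : (ULift.{v} ℕ →₀ X) ≃ₗ[R] (ℕ →₀ X) := Finsupp.domLCongr Equiv.ulift
  InAdd.of_retract (inAdd_finsupp_of_inAdd h (ULift.{v} ℕ)) (α := E.symm.toLinearMap)
    (β := E.toLinearMap) (by ext; simp)

theorem inAdd_self : InAdd R M M := inFinAdd_self.inAdd

theorem InAdd.prod (hX : InAdd R M X) (hY : InAdd R M Y) : InAdd R M (X × Y) := by
  obtain ⟨κ, f, g, h⟩ := hX
  obtain ⟨κ', f', g', h'⟩ := hY
  refine InAdd.of_retract (Y := κ ⊕ κ' →₀ M) (inAdd_finsupp (κ ⊕ κ'))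
    (α := (Finsupp.sumFinsuppLEquivProdFinsupp R).symm.toLinearMap ∘ₗ LinearMap.prodMap f f')
    (β := LinearMap.prodMap g g' ∘ₗ (Finsupp.sumFinsuppLEquivProdFinsupp R).toLinearMap) ?_
  ext x <;> simp [← LinearMap.comp_apply, h, h']

/-- Generators of `N` involve finitely many coordinates of the ambient sum of copies of `M`;
truncating to those coordinates gives `φ`. -/
theorem InAdd.exists_finMaps_eqOn (h : InAdd R M X) {N : Submodule R X} (hN : N.FG) :
    ∃ φ ∈ finMaps R M X X, ∀ x ∈ N, φ x = x := by
  classical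
  obtain ⟨ι, f, g, h⟩ := h
  obtain ⟨t, rfl⟩ := hN
  refine ⟨∑ k ∈ t.biUnion fun x => (f x).support, (g ∘ₗ Finsupp.lsingle k) ∘ₗ
    (Finsupp.lapply k ∘ₗ f), sum_mem_finMaps _ _ _, fun x hx => ?_⟩
  refine LinearMap.eqOn_span (g := LinearMap.id) (fun x hx => ?_) hx
  simp only [LinearMap.sum_apply, LinearMap.comp_apply, ← map_sum, Finsupp.lsingle_apply,
    Finsupp.lapply_apply, LinearMap.id_apply]
  conv_rhs => rw [← LinearMap.id_apply (R := R) x, ← h, LinearMap.comp_apply]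
  congr 1
  conv_rhs => rw [← Finsupp.sum_single (f x), Finsupp.sum]
  refine (Finset.sum_subset (Finset.subset_biUnion_of_mem (fun x => (f x).support) hx)
    fun k _ hk => ?_).symm
  rw [Finsupp.notMem_support_iff.1 hk, Finsupp.single_zero]

theorem InAdd.exists_finMaps_comp_eq (h : InAdd R M X) [Module.Finite R Y] (p : Y →ₗ[R] X) :
    ∃ φ ∈ finMaps R M X X, φ ∘ₗ p = p := by
  obtain ⟨φ, hφ, h⟩ := h.exists_finMaps_eqOn (N := LinearMap.range p)
    (by rw [LinearMap.range_eq_map]; exact Module.Finite.fg_top.map p)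
  exact ⟨φ, hφ, LinearMap.ext fun y => h _ ⟨y, rfl⟩⟩

theorem InAdd.inFinAdd [Module.Finite R X] (h : InAdd R M X) : InFinAdd R M X := by
  obtain ⟨φ, hφ, h⟩ := h.exists_finMaps_comp_eq (LinearMap.id (R := R) (M := X))
  rw [LinearMap.comp_id] at h
  exact inFinAdd_iff_id_mem.2 (h ▸ hφ)

/-- Maps into an object of `Add(M)` are separated by maps to `M`. -/
theorem InAdd.eq_zero_of_comp_eq_zero (h : InAdd R M X) {p : Y →ₗ[R] X}
    (hp : ∀ k : X →ₗ[R] M, k ∘ₗ p = 0) : p = 0 := by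
  obtain ⟨ι, f, g, h⟩ := h
  have : f ∘ₗ p = 0 := by
    ext y k
    exact LinearMap.congr_fun (hp (Finsupp.lapply k ∘ₗ f)) y
  rw [← LinearMap.id_comp p, ← h, LinearMap.comp_assoc, this, LinearMap.comp_zero]

/-- Maps out of an object of `Add(M)` are separated by maps from `M`. -/
theorem InAdd.eq_zero_of_eq_zero_comp (h : InAdd R M X) {p : X →ₗ[R] Y}
    (hp : ∀ k : M →ₗ[R] X, p ∘ₗ k = 0) : p = 0 := by
  obtain ⟨ι, f, g, h⟩ := h
  have : p ∘ₗ g = 0 := by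
    ext k y
    exact LinearMap.congr_fun (hp (g ∘ₗ Finsupp.lsingle k)) y
  rw [← LinearMap.comp_id p, ← h, ← LinearMap.comp_assoc, this, LinearMap.zero_comp]

end FiniteMaps

/-! ### Nakayama relative to a submodule, and coordinates of maps into direct sums. -/

section Nakayama

theorem Submodule.FG.le_of_le_sup_jacobson_smul {S : Type*} [Ring S] {P : Type*} [AddCommGroup P]
    [Module S P] {N N' : Submodule S P} (hN : N.FG) (h : N ≤ N' ⊔ Ring.jacobson S • N) :
    N ≤ N' := by
  have := (hN.map N'.mkQ).eq_bot_of_le_jacobson_smul (by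
    calc N.map N'.mkQ ≤ (N' ⊔ Ring.jacobson S • N).map N'.mkQ := Submodule.map_mono h
      _ = Ring.jacobson S • N.map N'.mkQ := by
        rw [Submodule.map_sup, Submodule.mkQ_map_self, bot_sup_eq, Submodule.map_smul''])
  rwa [← le_bot_iff, Submodule.map_le_iff_le_comap, Submodule.comap_bot, Submodule.ker_mkQ] at this

end Nakayama

section FinsuppDecomposition

variable {R : Type*} [CommRing R] {M X : Type*} [AddCommGroup M] [Module R M] [AddCommGroup X]
  [Module R X]

theorem exists_eq_sum_lsingle_comp [Module.Finite R M] {ι : Type*} (p : M →ₗ[R] (ι →₀ X)) :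
    ∃ t : Finset ι, p = ∑ k ∈ t, Finsupp.lsingle k ∘ₗ (Finsupp.lapply k ∘ₗ p) := by
  classical
  obtain ⟨c, hc⟩ := Module.Finite.fg_top (R := R) (M := M)
  refine ⟨c.biUnion fun m => (p m).support, ?_⟩
  refine LinearMap.ext_on (s := c) hc fun m hm => ?_
  simp only [LinearMap.sum_apply, LinearMap.comp_apply, Finsupp.lsingle_apply,
    Finsupp.lapply_apply]
  conv_lhs => rw [← Finsupp.sum_single (p m), Finsupp.sum]
  refine (Finset.sum_subset (Finset.subset_biUnion_of_mem (fun x => (p x).support) hm)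
    fun k _ hk => ?_)
  rw [Finsupp.notMem_support_iff.1 hk, Finsupp.single_zero]

end FinsuppDecomposition

/-! ### Lifting linear maps between multiplicity spaces. -/

section Lifting

variable {R : Type u} [CommRing R] {M : Type v} [AddCommGroup M] [Module R M]
variable {s : ℕ} {n : Fin s → ℕ} {D : Fin s → Type w} [∀ i, DivisionRing (D i)]
variable (e : Module.End R M ⧸ Ring.jacobson (Module.End R M) ≃+*
  ∀ i, Matrix (Fin (n i)) (Fin (n i)) (D i))
variable {X Y Z : Type v} [AddCommGroup X] [Module R X] [AddCommGroup Y] [Module R Y]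
  [AddCommGroup Z] [Module R Z]

namespace MultSpace

theorem span_col {i : Fin s} (k : Fin (n i)) :
    ⊤ ≤ Submodule.span (D i)ᵐᵒᵖ (Set.range (col e (i := i))) := by
  intro w _
  obtain ⟨p, rfl⟩ := exists_eq_map_col e k w
  rw [map_col]
  exact Submodule.sum_mem _ fun j _ => Submodule.smul_mem _ _ (Submodule.subset_span ⟨j, rfl⟩)

/-- The standard basis of the multiplicity space of `M`. -/
def colBasis {i : Fin s} (k : Fin (n i)) :
    Module.Basis (Fin (n i)) (D i)ᵐᵒᵖ (MultSpace e i M) :=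
  Module.Basis.mk (linearIndependent_col e) (span_col e k)

theorem rank_self {i : Fin s} (k : Fin (n i)) :
    Module.rank (D i)ᵐᵒᵖ (MultSpace e i M) = n i := by
  rw [rank_eq_card_basis (colBasis e k), Fintype.card_fin]

theorem map_eq_zero_iff {i : Fin s} (k : Fin (n i)) (f : Module.End R M) :
    map e i f = 0 ↔ SimpleRow.matrixOf e i f = 0 := by
  constructor
  · intro h
    ext a b
    have h1 := map_col e f b
    rw [h, LinearMap.zero_apply] at h1
    exact congrArg MulOpposite.unop
      (Fintype.linearIndependent_iff.1 (linearIndependent_col e) _ h1.symm a)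
  · intro h
    refine (colBasis e k).ext fun j => ?_
    simp [colBasis, map_col, h]

theorem map_comp_eq_zero {i : Fin s} (f : X →ₗ[R] Y) (k : Fin (n i)) 
    (h : ∀ p : M →ₗ[R] X, map e i (f ∘ₗ p) = 0) : map e i f = 0 := by
  ext1 w
  obtain ⟨p, rfl⟩ := exists_eq_map_col e k w
  rw [← map_comp_apply, h, LinearMap.zero_apply, LinearMap.zero_apply]

/-- A vector is represented by some `p : M → X`, and `p` equals a finite sum of maps `g j ∘ f j ∘
p`, each of which passes through a map `X → M`. -/
theorem eq_zero_of_map_eq_zero [Module.Finite R M] (hX : InAdd R M X) {i : Fin s}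
    (k : Fin (n i)) {w : MultSpace e i X} (h : ∀ q : X →ₗ[R] M, map e i q w = 0) : w = 0 := by
  obtain ⟨p, rfl⟩ := exists_eq_map_col e k w
  obtain ⟨φ, hφ, h'⟩ := hX.exists_finMaps_comp_eq p
  obtain ⟨m, g, f, rfl⟩ := exists_sum_of_mem_finMaps hφ
  rw [← h', map_comp_apply, map_sum, LinearMap.sum_apply]
  exact Finset.sum_eq_zero fun j _ => by rw [map_comp_apply, h, _root_.map_zero]

/-- A map out of an object of `Add(M)` vanishes on the `i`-th multiplicity space as soon as
all maps `M → M` through it do. -/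
theorem map_eq_zero_of_matrixOf [Module.Finite R M] (hY : InAdd R M Y) {i : Fin s}
    (k : Fin (n i)) {f : X →ₗ[R] Y}
    (h : ∀ (p : M →ₗ[R] X) (q : Y →ₗ[R] M), SimpleRow.matrixOf e i (q ∘ₗ f ∘ₗ p) = 0) :
    map e i f = 0 := by
  refine map_comp_eq_zero e f k fun p => ?_
  ext1 w
  refine eq_zero_of_map_eq_zero e hY k fun q => ?_
  rw [← map_comp_apply, (map_eq_zero_iff e k _).2 (h p q), LinearMap.zero_apply]

theorem matrixOf_eq_zero_of_map {i : Fin s} (k : Fin (n i)) {f : X →ₗ[R] Y} (h : map e i f = 0)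
    (p : M →ₗ[R] X) (q : Y →ₗ[R] M) : SimpleRow.matrixOf e i (q ∘ₗ f ∘ₗ p) = 0 := by
  rw [← map_eq_zero_iff e k, map_comp, map_comp, h, LinearMap.zero_comp, LinearMap.comp_zero]

variable (hn : ∀ i, 0 < n i)
include hn

theorem exists_map_eq_of_self (a : ∀ i, MultSpace e i M →ₗ[(D i)ᵐᵒᵖ] MultSpace e i Y) :
    ∃ f : M →ₗ[R] Y, ∀ i, map e i f = a i := by
  classical
  choose p hp using fun (i : Fin s) (k : Fin (n i)) =>
    exists_eq_map_col e (⟨0, hn i⟩ : Fin (n i)) (a i (col e k))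
  -- The matrix unit in position `(0, k)` sends the `k`-th basis column to the zeroth, where `p i k`
  -- takes the required value. It kills the other columns and all components other than `i`.
  refine ⟨∑ i, ∑ k, p i k ∘ₗ lift e (Matrix.single (⟨0, hn i⟩ : Fin (n i)) k 1), fun j => ?_⟩
  refine (colBasis e ⟨0, hn j⟩).ext fun l => ?_
  simp only [colBasis, Module.Basis.mk_apply]
  rw [map_sum, LinearMap.sum_apply, Finset.sum_eq_single j, map_sum, LinearMap.sum_apply,
    Finset.sum_eq_single l, map_comp_apply, map_col, matrixOf_lift, hp, Finset.sum_eq_single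
    (⟨0, hn j⟩ : Fin (n j))]
  · simp
  · intro b _ hb
    simp [hb.symm]
  · simp
  · intro b _ hb
    rw [map_comp_apply, map_col, matrixOf_lift]
    simp [hb]
  · simp
  · intro b _ hb
    rw [map_sum, LinearMap.sum_apply]
    refine Finset.sum_eq_zero fun k _ => ?_
    rw [map_comp_apply, map_col, matrixOf_lift_of_ne e hb.symm]
    simp
  · simp

/-- This is the projectivity of `Hom_R(M, X)`: lift on each copy of `M` in the ambient direct sum,
then restrict along the splitting of `X`. -/
theorem exists_map_eq [Module.Finite R M] (hX : InAdd R M X)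
    (a : ∀ i, MultSpace e i X →ₗ[(D i)ᵐᵒᵖ] MultSpace e i Y) :
    ∃ f : X →ₗ[R] Y, ∀ i, map e i f = a i := by
  classical
  obtain ⟨ι, f, g, h⟩ := hX
  choose q hq using fun k : ι => exists_map_eq_of_self e hn (Y := Y)
    fun i => a i ∘ₗ map e i (g ∘ₗ Finsupp.lsingle k)
  refine ⟨Finsupp.lsum R q ∘ₗ f, fun i => ?_⟩
  ext1 w
  obtain ⟨p, rfl⟩ := exists_eq_map_col e ⟨0, hn i⟩ w
  have key : ∀ x : MultSpace e i (ι →₀ M), map e i (Finsupp.lsum R q) x = a i (map e i g x) := by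
    intro x
    obtain ⟨p, rfl⟩ := exists_eq_map_col e ⟨0, hn i⟩ x
    obtain ⟨t, ht⟩ := exists_eq_sum_lsingle_comp p
    rw [ht, map_sum, LinearMap.sum_apply, _root_.map_sum, _root_.map_sum, _root_.map_sum]
    refine Finset.sum_congr rfl fun k _ => ?_
    have h1 : Finsupp.lsum R q ∘ₗ Finsupp.lsingle k = q k := by ext; simp
    rw [map_comp_apply, ← map_comp_apply, h1, hq, LinearMap.comp_apply, map_comp_apply]
  rw [map_comp_apply, key, ← map_comp_apply, h, map_id, LinearMap.id_apply]

end MultSpace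

end Lifting

/-! ### Dimension vectors, direct sums and retracts. -/

section Dimensions

open MultSpace

variable {R : Type u} [CommRing R] {M : Type v} [AddCommGroup M] [Module R M]
variable {s : ℕ} {n : Fin s → ℕ} {D : Fin s → Type w} [∀ i, DivisionRing (D i)]
variable (e : Module.End R M ⧸ Ring.jacobson (Module.End R M) ≃+*
  ∀ i, Matrix (Fin (n i)) (Fin (n i)) (D i))
variable {X Y Z : Type v} [AddCommGroup X] [Module R X] [AddCommGroup Y] [Module R Y]
  [AddCommGroup Z] [Module R Z]

theorem dimHom_self (hn : ∀ i, 0 < n i) : dimHom e M = castVec n := by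
  ext1 i
  rw [dimHom_apply, rank_self e ⟨0, hn i⟩]
  simp [castVec]

theorem dimHom_ne_top_iff (i : Fin s) :
    dimHom e X i ≠ ⊤ ↔ Module.Finite (D i)ᵐᵒᵖ (MultSpace e i X) := by
  rw [dimHom_apply, Cardinal.toENat_ne_top, Module.rank_lt_aleph0_iff]

theorem dimHom_eq_zero_iff (i : Fin s) : dimHom e X i = 0 ↔ ∀ w : MultSpace e i X, w = 0 := by
  rw [dimHom_apply, Cardinal.toENat_eq_zero, rank_zero_iff_forall_zero]

theorem dimHom_eq_zero_iff_map_id (i : Fin s) :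
    dimHom e X i = 0 ↔ map e i (LinearMap.id : X →ₗ[R] X) = 0 := by
  rw [dimHom_eq_zero_iff, map_id]
  exact ⟨fun h => LinearMap.ext h, fun h w => LinearMap.congr_fun h w⟩

/-- The dimension vector of a module decomposed into two summands. -/
theorem dimHom_eq_add {a : Y →ₗ[R] X} {b : X →ₗ[R] Y} {c : Z →ₗ[R] X} {d : X →ₗ[R] Z}
    (hba : b ∘ₗ a = LinearMap.id) (hdc : d ∘ₗ c = LinearMap.id)
    (h : a ∘ₗ b + c ∘ₗ d = LinearMap.id) : dimHom e X = dimHom e Y + dimHom e Z := by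
  -- Composing `h` with `b` and `c` gives `b c + b c = b c`, so orthogonality is automatic.
  have h1 : (b ∘ₗ c) = 0 := by
    have : b ∘ₗ c ∘ₗ d ∘ₗ c = 0 := by
      have h2 := congrArg (fun φ => b ∘ₗ φ ∘ₗ c) h
      simp only [LinearMap.add_comp, LinearMap.comp_add, LinearMap.id_comp,
        ← LinearMap.comp_assoc, hba] at h2
      rw [← LinearMap.comp_assoc, ← LinearMap.comp_assoc]
      simpa using h2
    rwa [hdc, LinearMap.comp_id] at this
  have h2 : (d ∘ₗ a) = 0 := by
    have : d ∘ₗ a ∘ₗ b ∘ₗ a = 0 := by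
      have h2 := congrArg (fun φ => d ∘ₗ φ ∘ₗ a) h
      simp only [LinearMap.add_comp, LinearMap.comp_add, LinearMap.id_comp,
        ← LinearMap.comp_assoc, hdc] at h2
      rw [← LinearMap.comp_assoc, ← LinearMap.comp_assoc]
      simpa using h2
    rwa [hba, LinearMap.comp_id] at this
  ext1 i
  have E : MultSpace e i X ≃ₗ[(D i)ᵐᵒᵖ] MultSpace e i Y × MultSpace e i Z :=
    LinearEquiv.ofLinearMap ((map e i b).prod (map e i d)) ((map e i a).coprod (map e i c))
      (by
        ext x <;> simp [← map_comp_apply, hba, hdc, h1, h2, map_id, MultSpace.map_zero])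
      (by
        ext1 x
        change map e i a (map e i b x) + map e i c (map e i d x) = x
        simp only [← map_comp_apply, ← LinearMap.add_apply, ← MultSpace.map_add, h, map_id,
          LinearMap.id_apply])
  rw [Pi.add_apply, dimHom_apply, dimHom_apply, dimHom_apply, E.rank_eq, rank_prod', _root_.map_add]

theorem dimHom_prod : dimHom e (X × Y) = dimHom e X + dimHom e Y :=
  dimHom_eq_add e (a := LinearMap.inl R X Y) (b := LinearMap.fst R X Y)
    (c := LinearMap.inr R X Y) (d := LinearMap.snd R X Y) (by ext; simp) (by ext; simp)
    (by ext <;> simp)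

theorem dimHom_zero [Subsingleton X] : dimHom e X = 0 := by
  ext1 i
  rw [Pi.zero_apply, dimHom_eq_zero_iff_map_id, Subsingleton.elim (LinearMap.id : X →ₗ[R] X) 0,
    MultSpace.map_zero]

theorem dimHom_le_of_retract {a : Y →ₗ[R] X} {b : X →ₗ[R] Y} (hba : b ∘ₗ a = LinearMap.id) :
    dimHom e Y ≤ dimHom e X := by
  intro i
  rw [dimHom_apply, dimHom_apply]
  refine Cardinal.enat_gc.monotone_u ?_
  refine LinearMap.rank_le_of_injective (map e i a) ?_
  refine Function.LeftInverse.injective (g := map e i b) fun w => ?_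
  rw [← map_comp_apply, hba, map_id, LinearMap.id_apply]

theorem dimHom_eq_of_equiv (E : X ≃ₗ[R] Y) : dimHom e X = dimHom e Y :=
  le_antisymm (dimHom_le_of_retract e (a := E.toLinearMap) (b := E.symm.toLinearMap)
    (by ext; simp)) (dimHom_le_of_retract e (a := E.symm.toLinearMap) (b := E.toLinearMap)
    (by ext; simp))

theorem dimHom_eq_finrank {i : Fin s} (h : dimHom e X i ≠ ⊤) :
    dimHom e X i = Module.finrank (D i)ᵐᵒᵖ (MultSpace e i X) := by
  have := (dimHom_ne_top_iff e i).1 h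
  rw [dimHom_apply, ← Module.finrank_eq_rank, Cardinal.toENat_nat]

section Families

variable {κ : Type*} {N : κ → Type v} [∀ k, AddCommGroup (N k)] [∀ k, Module R (N k)]
  (a : ∀ k, N k →ₗ[R] X) (b : ∀ k, X →ₗ[R] N k) {i : Fin s}

theorem finrank_pi_multSpace (T : Finset κ) (hfin : ∀ k, dimHom e (N k) i ≠ ⊤) :
    Cardinal.toENat (Module.rank (D i)ᵐᵒᵖ (∀ k : T, MultSpace e i (N k))) =
      ∑ k ∈ T, dimHom e (N k) i := by
  have := fun k => (dimHom_ne_top_iff e i).1 (hfin k)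
  rw [← Module.finrank_eq_rank, Cardinal.toENat_nat, Module.finrank_pi_fintype, Nat.cast_sum,
    ← Finset.sum_coe_sort T]
  exact Finset.sum_congr rfl fun k _ => (dimHom_eq_finrank e (hfin k)).symm

theorem sum_dimHom_le (hba : ∀ k, b k ∘ₗ a k = LinearMap.id)
    (hba' : ∀ k l, k ≠ l → b k ∘ₗ a l = 0) (hfin : ∀ k, dimHom e (N k) i ≠ ⊤) (T : Finset κ) :
    ∑ k ∈ T, dimHom e (N k) i ≤ dimHom e X i := by
  rw [← finrank_pi_multSpace e T hfin, dimHom_apply]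
  have : Function.LeftInverse (LinearMap.pi fun k : T => map e i (b k))
      (∑ k : T, map e i (a k) ∘ₗ LinearMap.proj k :
        (∀ k : T, MultSpace e i (N k)) →ₗ[(D i)ᵐᵒᵖ] MultSpace e i X) := by
    intro f
    ext1 k
    simp only [LinearMap.pi_apply, LinearMap.sum_apply, LinearMap.comp_apply, LinearMap.proj_apply,
      _root_.map_sum, ← map_comp_apply]
    rw [Finset.sum_eq_single k]
    · rw [hba, map_id, LinearMap.id_apply]
    · intro l _ hl
      rw [hba' _ _ fun h => hl (Subtype.ext h.symm), MultSpace.map_zero, LinearMap.zero_apply]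
    · simp
  simpa using Cardinal.enat_gc.monotone_u (LinearMap.lift_rank_le_of_injective _ this.injective)

/-- A vector with zero components comes from a map `p` that is a finite sum of its own components,
hence it is zero. Together with `sum_dimHom_le` this computes the finite coordinates of an infinite
direct sum. -/
theorem dimHom_le_sum (hn : ∀ i, 0 < n i)
    (h : ∀ p : M →ₗ[R] X, ∃ t : Finset κ, p = ∑ k ∈ t, a k ∘ₗ b k ∘ₗ p)
    (hfin : ∀ k, dimHom e (N k) i ≠ ⊤) (T : Finset κ) (hT : ∀ k ∉ T, dimHom e (N k) i = 0) :
    dimHom e X i ≤ ∑ k ∈ T, dimHom e (N k) i := by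
  rw [← finrank_pi_multSpace e T hfin, dimHom_apply]
  have : Function.Injective (LinearMap.pi fun k : T => map e i (b k)) := by
    rw [← LinearMap.ker_eq_bot, LinearMap.ker_eq_bot']
    intro x hx
    have hx' : ∀ k, map e i (b k) x = 0 := by
      intro k
      by_cases hk : k ∈ T
      · exact congrFun hx ⟨k, hk⟩
      · exact (dimHom_eq_zero_iff e i).1 (hT k hk) _
    obtain ⟨p, rfl⟩ := exists_eq_map_col e ⟨0, hn i⟩ x
    obtain ⟨t, ht⟩ := h p
    rw [ht, MultSpace.map_sum, LinearMap.sum_apply]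
    refine Finset.sum_eq_zero fun k _ => ?_
    rw [map_comp_apply, map_comp_apply, hx', _root_.map_zero]
  simpa using Cardinal.enat_gc.monotone_u (LinearMap.lift_rank_le_of_injective _ this)

end Families

/-- Splitting off one copy of `X` shows that the dimension absorbs `dimHom e X i`, which a finite
number can do only if that entry is zero. -/
theorem dimHom_finsupp_nat (hn : ∀ i, 0 < n i) [Module.Finite R M] :
    dimHom e (ℕ →₀ X) = (⊤ : ℕ∞) • dimHom e X := by
  ext1 i
  rw [Pi.smul_apply, smul_eq_mul]
  by_cases h : dimHom e X i = 0
  · rw [h, mul_zero, dimHom_eq_zero_iff]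
    intro w
    obtain ⟨p, rfl⟩ := exists_eq_map_col e ⟨0, hn i⟩ w
    obtain ⟨t, ht⟩ := exists_eq_sum_lsingle_comp p
    rw [ht, MultSpace.map_sum, LinearMap.sum_apply]
    refine Finset.sum_eq_zero fun k _ => ?_
    rw [map_comp_apply, map_comp_apply, (dimHom_eq_zero_iff e i).1 h (map e i _ _), _root_.map_zero]
  · rw [ENat.top_mul h]
    have E : (ℕ →₀ X) ≃ₗ[R] (ℕ →₀ X) × (PUnit.{1} →₀ X) :=
      Finsupp.domLCongr Equiv.natSumPUnitEquivNat.symm ≪≫ₗ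
        Finsupp.sumFinsuppLEquivProdFinsupp R
    have h1 := congrFun (dimHom_eq_of_equiv e E) i
    rw [dimHom_prod, Pi.add_apply,
      dimHom_eq_of_equiv e (Finsupp.uniqueLinearEquiv R X PUnit.unit)] at h1
    by_contra h2
    exact h (ENat.add_right_injective_of_ne_top h2 (h1.symm.trans (add_zero _).symm))

/-- An endomorphism of an object of `add(M)` that is the identity modulo the radical is
invertible. -/
theorem exists_comp_eq_id_of_map_eq_id (hn : ∀ i, 0 < n i) (hX : InFinAdd R M X)
    {ψ : X →ₗ[R] X} (hψ : ∀ i, map e i ψ = LinearMap.id) : ∃ θ, θ ∘ₗ ψ = LinearMap.id := by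
  obtain ⟨m, g, f, h⟩ := exists_sum_of_mem_finMaps (inFinAdd_iff_id_mem.1 hX)
  let N' : Submodule (Module.End R M) (X →ₗ[R] M) := Submodule.span _ (Set.range fun j => f j ∘ₗ ψ)
  let N : Submodule (Module.End R M) (X →ₗ[R] M) := Submodule.span _ (Set.range f)
  have hN : ∀ k : X →ₗ[R] M, k = ∑ j, (k ∘ₗ g j) • f j := by
    intro k
    conv_lhs => rw [← LinearMap.comp_id k, h]
    ext x
    simp
  have hmem : ∀ k : X →ₗ[R] M, k ∈ N := by
    intro k
    rw [hN k]
    exact Submodule.sum_mem _ fun j _ => Submodule.smul_mem _ _ (Submodule.subset_span ⟨j, rfl⟩)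
  -- Nakayama for the left `S`-module `Hom_R(X, M)`: its generators satisfy `f j - f j ∘ ψ ∈ J(S) •
  -- N`, because the coefficients `(f j - f j ∘ ψ) ∘ g l` act as zero on every multiplicity space of
  -- `M`.
  have hNN : N ≤ N' := by
    refine Submodule.FG.le_of_le_sup_jacobson_smul
      (Submodule.fg_span (Set.finite_range f)) (Submodule.span_le.2 ?_)
    rintro _ ⟨j, rfl⟩
    have h1 : f j = f j ∘ₗ ψ + (f j - f j ∘ₗ ψ) := by abel
    rw [h1]
    refine Submodule.add_mem_sup (Submodule.subset_span ⟨j, rfl⟩) ?_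
    rw [hN (f j - f j ∘ₗ ψ)]
    refine Submodule.sum_mem _ fun l _ => Submodule.smul_mem_smul ?_ (hmem _)
    rw [mem_jacobson_iff e]
    intro i
    rw [← map_eq_zero_iff e ⟨0, hn i⟩, LinearMap.sub_comp, MultSpace.map_sub, map_comp,
      map_comp, map_comp, hψ, LinearMap.comp_id, sub_self]
  have h2 : ∀ j, ∃ k : X →ₗ[R] M, f j = k ∘ₗ ψ := by
    intro j
    have h3 : N' ≤ LinearMap.range ({ toFun := fun k => k ∘ₗ ψ, map_add' := fun _ _ => rfl, map_smul' := fun _ _ => rfl } : (X →ₗ[R] M) →ₗ[Module.End R M] (X →ₗ[R] M)) := by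
      refine Submodule.span_le.2 ?_
      rintro _ ⟨j, rfl⟩
      exact ⟨f j, rfl⟩
    obtain ⟨k, hk⟩ := h3 (hNN (hmem (f j)))
    exact ⟨k, hk.symm⟩
  choose k hk using h2
  refine ⟨∑ j, g j ∘ₗ k j, ?_⟩
  rw [h]
  ext x
  simp [hk]

/-- An object of `add(M)` is a retract of any object of `Add(M)` of larger dimension. -/
theorem exists_retract_of_dimHom_le (hn : ∀ i, 0 < n i) [Module.Finite R M]
    (hX : InFinAdd R M X) (hY : InAdd R M Y) (h : dimHom e X ≤ dimHom e Y)
    (hfin : ∀ i, dimHom e X i ≠ ⊤) :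
    ∃ (α : X →ₗ[R] Y) (β : Y →ₗ[R] X), β ∘ₗ α = LinearMap.id := by
  have h1 : ∀ i, ∃ (a : MultSpace e i X →ₗ[(D i)ᵐᵒᵖ] MultSpace e i Y)
      (b : MultSpace e i Y →ₗ[(D i)ᵐᵒᵖ] MultSpace e i X), b ∘ₗ a = LinearMap.id := by
    intro i
    have h2 : Module.rank (D i)ᵐᵒᵖ (MultSpace e i X) ≤ Module.rank (D i)ᵐᵒᵖ (MultSpace e i Y) := by
      rw [← Cardinal.toENat_le_iff_of_le_aleph0]
      · exact h i
      · exact (Cardinal.toENat_ne_top.1 (hfin i)).le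
    obtain ⟨a, ha⟩ := rank_le_iff_exists_linearMap.1 h2
    obtain ⟨b, hb⟩ := a.exists_leftInverse_of_injective (LinearMap.ker_eq_bot.2 ha)
    exact ⟨a, b, hb⟩
  choose a b hba using h1
  obtain ⟨α, hα⟩ := exists_map_eq e hn hX.inAdd a
  obtain ⟨β, hβ⟩ := exists_map_eq e hn hY b
  -- `β ∘ α` is the identity only modulo the radical; the left inverse `θ` corrects `β`.
  obtain ⟨θ, hθ⟩ := exists_comp_eq_id_of_map_eq_id e hn hX (ψ := β ∘ₗ α) fun i => by
    rw [map_comp, hα, hβ, hba]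
  exact ⟨α, θ ∘ₗ β, hθ⟩

end Dimensions

/-! ### Ideals of the endomorphism ring over a one-dimensional domain. -/

section TorsionFree

variable {R : Type*} [CommRing R] [IsDomain R] [IsNoetherianRing R] {M : Type*} [AddCommGroup M]
  [Module R M] [Module.Finite R M] [Module.IsTorsionFree R M]

omit [Module.IsTorsionFree R M] in
/-- A finitely generated module over a noetherian domain has a system of coordinates, up to a
nonzero denominator. -/
theorem exists_coordinates : ∃ (d : ℕ) (x : Fin d → M) (c : Fin d → M →ₗ[R] R) (r : R), r ≠ 0 ∧
    ∀ m, r • m = ∑ i, c i m • x i := by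
  classical
  obtain ⟨I, hI, hmax⟩ := exists_maximal_linearIndepOn R (id : M → M)
  have hfin : Finite I := hI.finite_of_isNoetherian
  obtain ⟨d, ⟨E⟩⟩ := Finite.exists_equiv_fin I
  have hx : LinearIndependent R fun i : Fin d => ((E.symm i : I) : M) :=
    hI.linearIndependent.comp E.symm E.symm.injective
  set x : Fin d → M := fun i => ((E.symm i : I) : M) with hxd
  have hspan : Submodule.span R (id '' I) = Submodule.span R (Set.range x) := by
    congr 1
    ext m
    simp only [Set.image_id, Set.mem_range, hxd]
    exact ⟨fun hm => ⟨E ⟨m, hm⟩, by simp⟩, by rintro ⟨i, rfl⟩; exact (E.symm i).2⟩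
  have h1 : ∀ m : M, ∃ a : R, a ≠ 0 ∧ a • m ∈ Submodule.span R (Set.range x) := by
    intro m
    rw [← hspan]
    by_cases hm : m ∈ I
    · exact ⟨1, one_ne_zero, by rw [one_smul]; exact Submodule.subset_span ⟨m, hm, rfl⟩⟩
    · exact hmax m hm
  choose a ha ham using h1
  obtain ⟨t, ht⟩ := Module.Finite.fg_top (R := R) (M := M)
  -- A common denominator for a finite generating set works for all of `M`.
  set r := ∏ m ∈ t, a m with hr
  have hr0 : r ≠ 0 := Finset.prod_ne_zero_iff.2 fun m _ => ha m
  have hrm : ∀ m : M, r • m ∈ Submodule.span R (Set.range x) := by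
    intro m
    have hm : m ∈ Submodule.span R (t : Set M) := by rw [ht]; trivial
    refine Submodule.span_le (p := (Submodule.span R (Set.range x)).comap
      (LinearMap.lsmul R M r)).2 (fun m hm => ?_) hm
    change r • m ∈ Submodule.span R (Set.range x)
    rw [hr, ← Finset.prod_erase_mul t a hm, mul_smul]
    exact Submodule.smul_mem _ _ (ham m)
  let ρ : M →ₗ[R] Submodule.span R (Set.range x) := (LinearMap.lsmul R M r).codRestrict _ hrm
  refine ⟨d, x, fun i => Finsupp.lapply i ∘ₗ hx.repr ∘ₗ ρ, r, hr0, fun m => ?_⟩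
  have := hx.linearCombination_repr (ρ m)
  rw [Finsupp.linearCombination_apply, Finsupp.sum_fintype _ _ (by simp)] at this
  exact this.symm

/-- A nonzero two-sided ideal of the endomorphism ring of a finitely generated torsion-free module
contains a nonzero scalar. -/
theorem exists_algebraMap_mem_of_ne_bot {L : Submodule R (Module.End R M)}
    (hl : ∀ (a : Module.End R M), ∀ x ∈ L, a * x ∈ L)
    (hr : ∀ (a : Module.End R M), ∀ x ∈ L, x * a ∈ L) (hL : L ≠ ⊥) :
    ∃ r : R, r ≠ 0 ∧ algebraMap R (Module.End R M) r ∈ L := by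
  obtain ⟨f, hf, hf0⟩ := Submodule.exists_mem_ne_zero_of_ne_bot hL
  obtain ⟨d, x, c, r, hr0, hc⟩ := exists_coordinates (R := R) (M := M)
  obtain ⟨m, hm⟩ : ∃ m, f m ≠ 0 := by
    by_contra! h
    exact hf0 (LinearMap.ext h)
  obtain ⟨j, hj⟩ : ∃ j, c j (f m) ≠ 0 := by
    by_contra! h
    have := hc (f m)
    simp only [h, zero_smul, Finset.sum_const_zero] at this
    exact hm ((smul_eq_zero.1 this).resolve_left hr0)
  refine ⟨r * c j (f m), mul_ne_zero hr0 hj, ?_⟩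
  -- As in a matrix ring, a scalar is recovered from `f` by rank-one maps on both sides: at `y` the
  -- `i`-th term is `c_i(y) c_j(f m) x_i`, and these add up to `c_j(f m) r y`.
  have : algebraMap R (Module.End R M) (r * c j (f m)) =
      ∑ i, (c j).smulRight (x i) * (f * (c i).smulRight m) := by
    ext y
    simp only [Module.algebraMap_end_apply, LinearMap.sum_apply, Module.End.mul_apply,
      LinearMap.smulRight_apply, map_smul, mul_smul]
    rw [smul_comm, hc, Finset.smul_sum]
    exact Finset.sum_congr rfl fun i _ => by rw [smul_smul, smul_smul, mul_comm]
  rw [this]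
  exact Submodule.sum_mem _ fun i _ => hl _ _ (hr _ _ hf)

-- `S / L` is a quotient of a finite power of `R / (r)`, which has finite length because `R` has
-- dimension one.
omit [IsDomain R] [Module.IsTorsionFree R M] in
theorem isArtinian_quotient_of_algebraMap_mem [IsDomain R] (hR : ringKrullDim R = 1)
    {S : Type*} [Ring S] [Algebra R S] [Module.Finite R S]
    {L : Submodule R S} (hl : ∀ a : S, ∀ x ∈ L, a * x ∈ L) {r : R} (hr : r ≠ 0)
    (hrL : algebraMap R S r ∈ L) : IsArtinian R (S ⧸ L) := by
  have : Ring.KrullDimLE 1 R := Ring.krullDimLE_iff.2 hR.le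
  have hfl := isFiniteLength_quotient_span_singleton (R := R) (mem_nonZeroDivisors_of_ne_zero hr)
  have : IsArtinian R (R ⧸ Ideal.span {r}) := (isFiniteLength_iff_isNoetherian_isArtinian.1 hfl).2
  obtain ⟨d, g, hg⟩ := Module.Finite.exists_fin' R S
  let G : (Fin d → R ⧸ Ideal.span {r}) →ₗ[R] S ⧸ L :=
    ∑ i, (Submodule.liftQ _ (LinearMap.toSpanSingleton R (S ⧸ L) (L.mkQ (g (Pi.single i 1))))
      (by
        change Ideal.span {r} ≤ _
        rw [Ideal.span_le, Set.singleton_subset_iff]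
        change r • L.mkQ _ = 0
        rw [← map_smul, Submodule.mkQ_apply, Submodule.Quotient.mk_eq_zero, Algebra.smul_def,
          Algebra.commutes]
        exact hl _ _ hrL)) ∘ₗ LinearMap.proj i
  refine isArtinian_of_surjective (Fin d → R ⧸ Ideal.span {r}) G fun y => ?_
  obtain ⟨y, rfl⟩ := L.mkQ_surjective y
  obtain ⟨z, rfl⟩ := hg y
  refine ⟨fun i => Ideal.Quotient.mk _ (z i), ?_⟩
  simp only [G, LinearMap.sum_apply, LinearMap.comp_apply, LinearMap.proj_apply]
  conv_rhs => rw [← Finset.univ_sum_single z, map_sum, map_sum]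
  refine Finset.sum_congr rfl fun i _ => ?_
  change z i • L.mkQ (g (Pi.single i 1)) = _
  rw [← map_smul, ← map_smul, ← Pi.single_smul, smul_eq_mul, mul_one]

end TorsionFree

/-! ### Two-sided ideals: powers, idempotents and Nakayama. -/

section TwoSided

variable {R : Type*} [CommRing R] {S : Type*} [Ring S] [Algebra R S]

/-- An `R`-submodule of an `R`-algebra that is a two-sided ideal. -/
structure IsTwoSidedSubmodule (L : Submodule R S) : Prop where
  mul_left : ∀ a : S, ∀ x ∈ L, a * x ∈ L
  mul_right : ∀ a : S, ∀ x ∈ L, x * a ∈ L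

variable (R S) in
/-- The Jacobson radical as an `R`-submodule. -/
def jacobsonSubmodule : Submodule R S := (Ring.jacobson S).restrictScalars R

theorem isTwoSidedSubmodule_jacobson : IsTwoSidedSubmodule (jacobsonSubmodule R S) where
  mul_left a _ hx := Ideal.mul_mem_left _ a hx
  mul_right a _ hx := Ideal.mul_mem_right a _ hx

namespace IsTwoSidedSubmodule

variable {L K : Submodule R S}

theorem mul (hL : IsTwoSidedSubmodule L) (hK : IsTwoSidedSubmodule K) :
    IsTwoSidedSubmodule (L * K) where
  mul_left a x hx := by
    induction hx using Submodule.mul_induction_on' with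
    | mem_mul_mem m hm k hk =>
      rw [← mul_assoc]
      exact Submodule.mul_mem_mul (hL.mul_left a m hm) hk
    | add x _ y _ hx hy => rw [mul_add]; exact add_mem hx hy
  mul_right a x hx := by
    induction hx using Submodule.mul_induction_on' with
    | mem_mul_mem m hm k hk =>
      rw [mul_assoc]
      exact Submodule.mul_mem_mul hm (hK.mul_right a k hk)
    | add x _ y _ hx hy => rw [add_mul]; exact add_mem hx hy

theorem pow_succ (hL : IsTwoSidedSubmodule L) (k : ℕ) : IsTwoSidedSubmodule (L ^ (k + 1)) := by
  induction k with
  | zero => simpa using hL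
  | succ k ih => rw [_root_.pow_succ]; exact ih.mul hL

theorem mul_le_left (hL : IsTwoSidedSubmodule L) : L * K ≤ L :=
  Submodule.mul_le.2 fun _ hm k _ => hL.mul_right k _ hm

theorem mul_le_right (hK : IsTwoSidedSubmodule K) : L * K ≤ K :=
  Submodule.mul_le.2 fun m _ _ hk => hK.mul_left m _ hk

/-- The left ideal underlying a two-sided submodule. -/
def toIdeal (hL : IsTwoSidedSubmodule L) : Ideal S where
  carrier := L
  add_mem' := L.add_mem
  zero_mem' := L.zero_mem
  smul_mem' a _ hx := hL.mul_left a _ hx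

variable [IsNoetherian R S]

theorem le_of_le_sup_jacobson_mul (hL : IsTwoSidedSubmodule L) (hK : IsTwoSidedSubmodule K)
    (h : K ≤ L ⊔ jacobsonSubmodule R S * K) : K ≤ L := by
  have : IsNoetherian S S := isNoetherian_of_tower R inferInstance
  have h1 : hK.toIdeal ≤ hL.toIdeal := by
    refine (IsNoetherian.noetherian hK.toIdeal).le_of_le_sup_jacobson_smul fun x hx => ?_
    obtain ⟨y, hy, z, hz, rfl⟩ := Submodule.mem_sup.1 (h hx)
    refine Submodule.add_mem_sup hy ?_
    exact Submodule.mul_induction_on hz (fun m hm k hk => Submodule.smul_mem_smul hm hk)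
      fun x y hx hy => add_mem hx hy
  exact h1

/-- An idempotent ideal contained in `L + J` is contained in `L`. -/
theorem le_of_le_sup_jacobson (hL : IsTwoSidedSubmodule L) (hK : IsTwoSidedSubmodule K)
    (hKK : K * K = K) (h : K ≤ L ⊔ jacobsonSubmodule R S) : K ≤ L := by
  refine le_of_le_sup_jacobson_mul hL hK ?_
  calc K = K * K := hKK.symm
    _ ≤ (L ⊔ jacobsonSubmodule R S) * K := mul_le_mul_left h K
    _ = L * K ⊔ jacobsonSubmodule R S * K := Submodule.sup_mul _ _ _
    _ ≤ _ := sup_le_sup_right hL.mul_le_left _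

/-- Modulo `L` the powers of `J` stabilise, so `J^(N+1) ≤ L + J * J^(N+1)`, and Nakayama removes the
second term. -/
theorem exists_jacobson_pow_le (hL : IsTwoSidedSubmodule L) [IsArtinian R (S ⧸ L)] :
    ∃ N, jacobsonSubmodule R S ^ (N + 1) ≤ L := by
  have hJ := isTwoSidedSubmodule_jacobson (R := R) (S := S)
  have hanti : Antitone fun k => jacobsonSubmodule R S ^ (k + 1) :=
    antitone_nat_of_succ_le fun k => by
      rw [_root_.pow_succ _ (k + 1)]; exact (hJ.pow_succ k).mul_le_left
  obtain ⟨N, hN⟩ := IsArtinian.monotone_stabilizes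
    ⟨fun k => OrderDual.toDual ((jacobsonSubmodule R S ^ (k + 1)).map L.mkQ),
      fun a b hab => Submodule.map_mono (hanti hab)⟩
  refine ⟨N, le_of_le_sup_jacobson_mul hL (hJ.pow_succ N) ?_⟩
  have h1 : (jacobsonSubmodule R S ^ (N + 1)).map L.mkQ =
    (jacobsonSubmodule R S ^ (N + 1 + 1)).map L.mkQ := hN (N + 1) (Nat.le_succ N)
  rw [← _root_.pow_succ']
  refine (Submodule.le_comap_map L.mkQ _).trans ?_
  rw [h1, Submodule.comap_map_mkQ]

omit [IsNoetherian R S] in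
/-- The powers of an ideal that all contain an ideal of finite colength become idempotent. -/
theorem exists_idempotent_pow (hL : IsTwoSidedSubmodule L) [IsArtinian R (S ⧸ K)]
    (h : ∀ k, K ≤ L ^ (k + 1)) : ∃ k, L ^ (k + 1) * L ^ (k + 1) = L ^ (k + 1) := by
  have hanti : Antitone fun k => L ^ (k + 1) :=
    antitone_nat_of_succ_le fun k => by
      rw [_root_.pow_succ _ (k + 1)]; exact (hL.pow_succ k).mul_le_left
  obtain ⟨N, hN⟩ := IsArtinian.monotone_stabilizes
    ⟨fun k => OrderDual.toDual ((L ^ (k + 1)).map K.mkQ),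
      fun a b hab => Submodule.map_mono (hanti hab)⟩
  refine ⟨N, ?_⟩
  -- The exponent on the right is `2 (N + 1)`. Both powers contain `K`, so equality modulo `K` is
  -- equality.
  have h1 : (L ^ (N + 1)).map K.mkQ = (L ^ (N + 1 + N + 1)).map K.mkQ :=
    hN (N + 1 + N) (by omega)
  rw [← pow_add, ← add_assoc]
  have h2 := congrArg (Submodule.comap K.mkQ) h1
  rw [Submodule.comap_map_mkQ, Submodule.comap_map_mkQ, sup_eq_right.2 (h _),
    sup_eq_right.2 (h _)] at h2
  exact h2.symm

end IsTwoSidedSubmodule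

end TwoSided

/-! ### Supports of ideals, trace ideals and infinite dimensions. -/

section Supports

open MultSpace

variable {R : Type u} [CommRing R] {M : Type v} [AddCommGroup M] [Module R M]
variable {s : ℕ} {n : Fin s → ℕ} {D : Fin s → Type w} [∀ i, DivisionRing (D i)]
variable (e : Module.End R M ⧸ Ring.jacobson (Module.End R M) ≃+*
  ∀ i, Matrix (Fin (n i)) (Fin (n i)) (D i))
variable {X Y Z : Type v} [AddCommGroup X] [Module R X] [AddCommGroup Y] [Module R Y]
  [AddCommGroup Z] [Module R Z]

/-- The index `i` lies in the support of an ideal of `S`: the ideal does not vanish in the `i`-th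
matrix ring. -/
def InSupport (I : Submodule R (Module.End R M)) (i : Fin s) : Prop :=
  ∃ x ∈ I, SimpleRow.matrixOf e i x ≠ 0

/-- Simplicity of the matrix ring: matrix units move a nonzero entry along the diagonal. Their lifts
vanish in the other components. -/
theorem exists_matrixOf_eq_one {I : Submodule R (Module.End R M)} (hI : IsTwoSidedSubmodule I)
    {i : Fin s} (h : InSupport e I i) :
    ∃ u ∈ I, SimpleRow.matrixOf e i u = 1 ∧ ∀ j, j ≠ i → SimpleRow.matrixOf e j u = 0 := by
  obtain ⟨x, hx, hx0⟩ := h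
  obtain ⟨a, b, hab⟩ : ∃ a b, SimpleRow.matrixOf e i x a b ≠ 0 := by
    by_contra! h
    exact hx0 (by ext a b; exact h a b)
  refine ⟨∑ k, lift e (Matrix.single k a (SimpleRow.matrixOf e i x a b)⁻¹) * (x *
    lift e (Matrix.single b k 1)), Submodule.sum_mem _ fun k _ =>
      hI.mul_left _ _ (hI.mul_right _ _ hx), ?_, fun j hj => ?_⟩
  · simp only [_root_.map_sum, _root_.map_mul, matrixOf_lift]
    rw [← Matrix.sum_single_one]
    refine Finset.sum_congr rfl fun k _ => ?_
    rw [← mul_assoc, Matrix.single_mul_mul_single, mul_one, inv_mul_cancel₀ hab]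
  · simp only [_root_.map_sum, _root_.map_mul, matrixOf_lift_of_ne e hj, zero_mul,
      Finset.sum_const_zero]

/-- Modulo the radical, `S` is a product of simple rings, whose two-sided ideals are determined by
their supports. -/
theorem le_sup_jacobson_of_inSupport {I T : Submodule R (Module.End R M)}
    (hT : IsTwoSidedSubmodule T) (h : ∀ i, InSupport e I i → InSupport e T i) :
    I ≤ T ⊔ jacobsonSubmodule R (Module.End R M) := by
  intro x hx
  have h1 : ∀ i, ∃ t ∈ T, ∀ j, SimpleRow.matrixOf e j t =
      if j = i then SimpleRow.matrixOf e j x else 0 := by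
    intro i
    by_cases hi : SimpleRow.matrixOf e i x = 0
    · refine ⟨0, T.zero_mem, fun j => ?_⟩
      rw [_root_.map_zero]
      split_ifs with hj
      · rw [hj, hi]
      · rfl
    · obtain ⟨t, ht, ht1, ht2⟩ := exists_matrixOf_eq_one e hT (h i ⟨x, hx, hi⟩)
      refine ⟨t * x, hT.mul_right _ _ ht, fun j => ?_⟩
      rw [_root_.map_mul]
      split_ifs with hj
      · subst hj; rw [ht1, one_mul]
      · rw [ht2 j hj, zero_mul]
  choose t ht htm using h1
  rw [← add_sub_cancel (∑ i, t i) x]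
  refine Submodule.add_mem_sup (Submodule.sum_mem _ fun i _ => ht i) ?_
  change _ ∈ Ring.jacobson _
  rw [mem_jacobson_iff e]
  intro j
  rw [_root_.map_sub, _root_.map_sum]
  simp [htm]

theorem InSupport.pow {I : Submodule R (Module.End R M)} (hI : IsTwoSidedSubmodule I)
    {i : Fin s} (hn : 0 < n i) (h : InSupport e I i) (k : ℕ) : InSupport e (I ^ k) i := by
  obtain ⟨u, hu, h1, -⟩ := exists_matrixOf_eq_one e hI h
  refine ⟨u ^ k, Submodule.pow_mem_pow I hu k, ?_⟩
  have : Nonempty (Fin (n i)) := ⟨⟨0, hn⟩⟩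
  rw [_root_.map_pow, h1, one_pow]
  exact one_ne_zero

theorem InSupport.mono {I T : Submodule R (Module.End R M)} (h : I ≤ T) {i : Fin s}
    (hi : InSupport e I i) : InSupport e T i := by
  obtain ⟨x, hx, h'⟩ := hi
  exact ⟨x, h hx, h'⟩

variable (M) in
/-- The ideal of `S` generated by the compositions `M → X → M` through a given endomorphism. -/
def traceIdeal (f : X →ₗ[R] X) : Submodule R (Module.End R M) :=
  Submodule.span R {x | ∃ (p : M →ₗ[R] X) (q : X →ₗ[R] M), x = q ∘ₗ f ∘ₗ p}

theorem mem_traceIdeal (f : X →ₗ[R] X) (p : M →ₗ[R] X) (q : X →ₗ[R] M) :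
    (q ∘ₗ f ∘ₗ p : Module.End R M) ∈ traceIdeal M f := Submodule.subset_span ⟨p, q, rfl⟩

theorem isTwoSidedSubmodule_traceIdeal (f : X →ₗ[R] X) :
    IsTwoSidedSubmodule (traceIdeal M f) where
  mul_left a x hx := by
    induction hx using Submodule.span_induction with
    | mem x h =>
      obtain ⟨p, q, rfl⟩ := h
      exact mem_traceIdeal f p (a ∘ₗ q)
    | zero => rw [mul_zero]; exact zero_mem _
    | add x y _ _ hx hy => rw [mul_add]; exact add_mem hx hy
    | smul r x _ hx => rw [mul_smul_comm]; exact Submodule.smul_mem _ _ hx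
  mul_right a x hx := by
    induction hx using Submodule.span_induction with
    | mem x h =>
      obtain ⟨p, q, rfl⟩ := h
      exact mem_traceIdeal f (p ∘ₗ a) q
    | zero => rw [zero_mul]; exact zero_mem _
    | add x y _ _ hx hy => rw [add_mul]; exact add_mem hx hy
    | smul r x _ hx => rw [smul_mul_assoc]; exact Submodule.smul_mem _ _ hx

variable [Module.Finite R M]

/-- Vectors of the multiplicity space of `X` come from maps `M → X` and are separated by maps `X →
M`, so `f` is detected by the compositions generating its trace ideal. -/
theorem inSupport_traceIdeal (hX : InAdd R M X) {i : Fin s} (hn : 0 < n i) (f : X →ₗ[R] X) :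
    InSupport e (traceIdeal M f) i ↔ map e i f ≠ 0 := by
  constructor
  · rintro ⟨x, hx, h⟩ h0
    refine h ?_
    clear h
    induction hx using Submodule.span_induction with
    | mem x h =>
      obtain ⟨p, q, rfl⟩ := h
      exact matrixOf_eq_zero_of_map e ⟨0, hn⟩ h0 p q
    | zero => exact _root_.map_zero _
    | add x y _ _ hx hy => rw [_root_.map_add, hx, hy, add_zero]
    | smul r x _ hx => rw [Algebra.smul_def, _root_.map_mul, hx, mul_zero]
  · contrapose
    intro h
    refine map_eq_zero_of_matrixOf e hX ⟨0, hn⟩ fun p q => ?_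
    by_contra h'
    exact h ⟨_, mem_traceIdeal f p q, h'⟩

-- The identity of the multiplicity space factors through a finite power of that of `M`.
omit [Module.Finite R M] in
theorem finite_multSpace_of_map_eq_id {φ : X →ₗ[R] X} (hφ : φ ∈ finMaps R M X X) {i : Fin s}
    (hn : 0 < n i) (h : map e i φ = LinearMap.id) :
    Module.Finite (D i)ᵐᵒᵖ (MultSpace e i X) := by
  obtain ⟨k, g, f, rfl⟩ := exists_sum_of_mem_finMaps hφ
  have := Module.Finite.of_basis (colBasis e (⟨0, hn⟩ : Fin (n i)))
  refine Module.Finite.of_surjective (∑ j, map e i (g j) ∘ₗ LinearMap.proj j :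
    (Fin k → MultSpace e i M) →ₗ[(D i)ᵐᵒᵖ] MultSpace e i X) fun w =>
      ⟨fun j => map e i (f j) w, ?_⟩
  conv_rhs => rw [← LinearMap.id_apply (R := (D i)ᵐᵒᵖ) w, ← h]
  simp [MultSpace.map_sum, map_comp]

/-- Finite spanning sets of the finite-dimensional spaces are represented by maps from `M`, and a
single finite map fixes the ranges of all of them. -/
theorem exists_finMaps_map_eq_id (hn : ∀ i, 0 < n i) (hX : InAdd R M X) :
    ∃ φ ∈ finMaps R M X X, ∀ i, dimHom e X i ≠ ⊤ → map e i φ = LinearMap.id := by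
  have h1 : ∀ i, ∃ N : Submodule R X, N.FG ∧ (dimHom e X i ≠ ⊤ → ∀ φ : X →ₗ[R] X,
      (∀ x ∈ N, φ x = x) → map e i φ = LinearMap.id) := by
    intro i
    by_cases h : dimHom e X i = ⊤
    · exact ⟨⊥, Submodule.fg_bot, fun h' => (h' h).elim⟩
    · obtain ⟨t, ht⟩ := ((dimHom_ne_top_iff e i).1 h).fg_top
      choose p hp using exists_eq_map_col e (⟨0, hn i⟩ : Fin (n i)) (X := X)
      refine ⟨⨆ w ∈ t, LinearMap.range (p w), Submodule.fg_biSup _ _ fun w _ => ?_,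
        fun _ φ hφ => ?_⟩
      · rw [LinearMap.range_eq_map]; exact Module.Finite.fg_top.map _
      · refine LinearMap.ext_on ht fun w hw => ?_
        have : φ ∘ₗ p w = p w := LinearMap.ext fun m =>
          hφ _ (Submodule.mem_iSup_of_mem w (Submodule.mem_iSup_of_mem hw ⟨m, rfl⟩))
        rw [LinearMap.id_apply, hp w, ← map_comp_apply, this]
  choose N hN h2 using h1
  obtain ⟨φ, hφ, h3⟩ := hX.exists_finMaps_eqOn (N := ⨆ i, N i) (Submodule.fg_iSup _ hN)
  exact ⟨φ, hφ, fun i hi => h2 i hi φ fun x hx => h3 x (Submodule.mem_iSup_of_mem i hx)⟩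

/-- An object of `Add(M)` is finitely generated, or the set of its infinite dimensions is the
support of a nonzero idempotent ideal. -/
theorem inFinAdd_or_exists_idempotent [IsDomain R] [IsNoetherianRing R]
    [Module.IsTorsionFree R M] (hR : ringKrullDim R = 1) (hn : ∀ i, 0 < n i)
    (hX : InAdd R M X) : InFinAdd R M X ∨ ∃ I : Submodule R (Module.End R M),
      IsTwoSidedSubmodule I ∧ I * I = I ∧ I ≠ ⊥ ∧ ∀ i, InSupport e I i ↔ dimHom e X i = ⊤ := by
  obtain ⟨φ, hφ, hφi⟩ := exists_finMaps_map_eq_id e hn hX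
  -- The second map serves to bound the powers of `L` from below by a single ideal.
  obtain ⟨φ', hφ', hφφ⟩ := hX.exists_finMaps_eqOn (range_fg_of_mem_finMaps hφ)
  set L := traceIdeal M (LinearMap.id - φ) with hL
  set L' := traceIdeal M (LinearMap.id - φ') with hL'
  have hLt : IsTwoSidedSubmodule L := isTwoSidedSubmodule_traceIdeal _
  have hLt' : IsTwoSidedSubmodule L' := isTwoSidedSubmodule_traceIdeal _
  by_cases h0 : L' = ⊥
  · left
    have h1 : LinearMap.id - φ' = 0 := by
      refine hX.eq_zero_of_comp_eq_zero fun q => hX.eq_zero_of_eq_zero_comp fun p => ?_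
      have := mem_traceIdeal (LinearMap.id - φ') p q
      rw [← hL', h0, Submodule.mem_bot] at this
      exact this
    rw [inFinAdd_iff_id_mem, sub_eq_zero.1 h1]
    exact hφ'
  right
  have hle : L' ≤ L' * L := by
    refine Submodule.span_le.2 ?_
    rintro _ ⟨p, q, rfl⟩
    -- Since `φ' φ = φ`, the product `(1 - φ') (1 - φ)` is `1 - φ'`. Inserting a finite map between
    -- the factors gives `L' ≤ L' * L`.
    have h2 : (LinearMap.id - φ') = (LinearMap.id - φ') ∘ₗ (LinearMap.id - φ) := by
      ext x
      have := hφφ (φ x) ⟨x, rfl⟩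
      simp [this]
    obtain ⟨ψ, hψ, hψp⟩ := hX.exists_finMaps_comp_eq ((LinearMap.id - φ) ∘ₗ p)
    obtain ⟨k, g, f, rfl⟩ := exists_sum_of_mem_finMaps hψ
    have h3 : (q ∘ₗ (LinearMap.id - φ') ∘ₗ p : Module.End R M) =
        ∑ j, (q ∘ₗ (LinearMap.id - φ') ∘ₗ g j : Module.End R M) *
          (f j ∘ₗ (LinearMap.id - φ) ∘ₗ p : Module.End R M) := by
      have h4 : (LinearMap.id - φ') ∘ₗ p = (LinearMap.id - φ') ∘ₗ
          (∑ j, g j ∘ₗ f j) ∘ₗ (LinearMap.id - φ) ∘ₗ p := by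
        rw [hψp, ← LinearMap.comp_assoc, ← h2]
      rw [h4]
      ext x
      simp only [LinearMap.comp_apply, LinearMap.sum_apply, _root_.map_sum, Module.End.mul_apply]
    rw [h3]
    exact Submodule.sum_mem _ fun j _ =>
      Submodule.mul_mem_mul (mem_traceIdeal _ _ _) (mem_traceIdeal _ _ _)
  have hle' : ∀ k, L' ≤ L' * L ^ k := by
    intro k
    induction k with
    | zero => rw [pow_zero, mul_one]
    | succ k ih =>
      calc L' ≤ L' * L := hle
        _ ≤ L' * L ^ k * L := mul_le_mul_left ih L
        _ = _ := by rw [mul_assoc, pow_succ]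
  obtain ⟨r, hr0, hr⟩ := exists_algebraMap_mem_of_ne_bot hLt'.mul_left hLt'.mul_right h0
  have := isArtinian_quotient_of_algebraMap_mem hR hLt'.mul_left hr0 hr
  have hle2 : ∀ k, L' ≤ L ^ (k + 1) := fun k => (hle' _).trans (hLt.pow_succ k).mul_le_right
  obtain ⟨k, hk⟩ := hLt.exists_idempotent_pow hle2
  refine ⟨L ^ (k + 1), hLt.pow_succ k, hk, fun h => h0 (le_bot_iff.1 (h ▸ hle2 k)), fun i => ?_⟩
  constructor
  · intro hi
    by_contra hne
    have h1 : InSupport e L i := hi.mono e (by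
      rw [pow_succ]; exact hLt.mul_le_right)
    rw [hL, inSupport_traceIdeal e hX (hn i), MultSpace.map_sub, map_id, hφi i hne, sub_self] at h1
    exact h1 rfl
  · intro hi
    refine InSupport.pow e hLt (hn i) ?_ _
    rw [hL, inSupport_traceIdeal e hX (hn i), MultSpace.map_sub, map_id]
    -- If `1 - φ` vanished here, the finite map `φ` would be the identity on an infinite-dimensional
    -- space.
    intro h
    exact (dimHom_ne_top_iff e i).2
      (finite_multSpace_of_map_eq_id e hφ (hn i) (sub_eq_zero.1 h).symm) hi

/-- An object of `Add(M)` with finite dimensions lies in `add(M)`. -/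
theorem inFinAdd_of_dimHom_ne_top [IsDomain R] [IsNoetherianRing R]
    [Module.IsTorsionFree R M] (hR : ringKrullDim R = 1) (hn : ∀ i, 0 < n i)
    (hX : InAdd R M X) (h : ∀ i, dimHom e X i ≠ ⊤) : InFinAdd R M X := by
  refine (inFinAdd_or_exists_idempotent e hR hn hX).resolve_right ?_
  rintro ⟨I, hI, hII, hI0, hs⟩
  -- With empty support `I` lies in `⊥ + J(S)`, and an idempotent ideal there is zero.
  refine hI0 (le_bot_iff.1 (IsTwoSidedSubmodule.le_of_le_sup_jacobson (L := ⊥) ⟨?_, ?_⟩ hI hII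
    (le_sup_jacobson_of_inSupport e ⟨?_, ?_⟩ fun i hi => (h i ((hs i).1 hi)).elim)))
  all_goals
    intro a x hx
    rw [Submodule.mem_bot] at hx
    simp [hx]

end Supports

/-! ### Countably generated modules. -/

section CountablyGenerated

variable {R : Type*} [CommRing R] {X Y : Type*} [AddCommGroup X] [Module R X] [AddCommGroup Y]
  [Module R Y]

theorem IsCountablyGenerated.of_surjective (h : IsCountablyGenerated R X) (f : X →ₗ[R] Y)
    (hf : Function.Surjective f) : IsCountablyGenerated R Y := by
  obtain ⟨c, hc, hs⟩ := h
  refine ⟨f '' c, hc.image f, ?_⟩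
  rw [Submodule.span_image, hs, Submodule.map_top, LinearMap.range_eq_top.2 hf]

theorem isCountablyGenerated_of_finite [Module.Finite R X] : IsCountablyGenerated R X := by
  obtain ⟨t, ht⟩ := Module.Finite.fg_top (R := R) (M := X)
  exact ⟨t, t.countable_toSet, ht⟩

theorem isCountablyGenerated_of_iUnion {ι : Type*} [Countable ι] {F : ι → Type*}
    [∀ k, AddCommGroup (F k)] [∀ k, Module R (F k)] (hF : ∀ k, IsCountablyGenerated R (F k))
    (u : ∀ k, F k →ₗ[R] X) (h : ⨆ k, LinearMap.range (u k) = ⊤) :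
    IsCountablyGenerated R X := by
  choose c hc hs using hF
  refine ⟨⋃ k, u k '' c k, Set.countable_iUnion fun k => (hc k).image _, ?_⟩
  rw [Submodule.span_iUnion, ← h]
  congr 1
  ext1 k
  rw [Submodule.span_image, hs, Submodule.map_top]

theorem IsCountablyGenerated.prod (hX : IsCountablyGenerated R X)
    (hY : IsCountablyGenerated R Y) : IsCountablyGenerated R (X × Y) := by
  obtain ⟨c, hc, hs⟩ := hX
  obtain ⟨d, hd, ht⟩ := hY
  refine ⟨LinearMap.inl R X Y '' c ∪ LinearMap.inr R X Y '' d,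
    (hc.image _).union (hd.image _), ?_⟩
  rw [Submodule.span_union, Submodule.span_image, Submodule.span_image, hs, ht,
    Submodule.map_top, Submodule.map_top, LinearMap.sup_range_inl_inr]

theorem IsCountablyGenerated.finsupp (hX : IsCountablyGenerated R X) {ι : Type*} [Countable ι] :
    IsCountablyGenerated R (ι →₀ X) := by
  refine isCountablyGenerated_of_iUnion (fun _ : ι => hX) (fun k => Finsupp.lsingle k) ?_
  exact Finsupp.iSup_lsingle_range

end CountablyGenerated

/-! ### Telescopes of a map `A` with `B * A * A = A`. -/

section Telescope

/-- Each `x` cancels one `a` provided another `a` remains, hence the exponent `l + 1`. -/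
theorem pow_mul_pow_add_of_mul_mul_eq {T : Type*} [Monoid T] {x a : T} (h : x * a * a = a)
    (k l : ℕ) : x ^ k * a ^ (l + 1 + k) = a ^ (l + 1) := by
  induction k with
  | zero => rw [pow_zero, one_mul, add_zero]
  | succ k ih =>
    rw [pow_succ, mul_assoc]
    have : x * a ^ (l + 1 + (k + 1)) = a ^ (l + 1 + k) := by
      rw [show l + 1 + (k + 1) = (l + k) + 1 + 1 by ring, pow_succ' a (l + k + 1),
        pow_succ' a (l + k), ← mul_assoc, ← mul_assoc, h, ← pow_succ', show l + 1 + k = l + k + 1 by ring]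
    rw [this, ih]

variable {R : Type u} [CommRing R] {F : Type v} [AddCommGroup F] [Module R F]
  (A : Module.End R F)

/-- The colimit of the sequence `F → F → F → ⋯` with all maps equal to `A`. -/
abbrev Telescope : Type v :=
  Module.DirectLimit (R := R) (ι := ℕ) (fun _ => F) (fun i j _ => A ^ (j - i))

namespace Telescope

/-- The canonical map from the `k`-th term. -/
def of (k : ℕ) : F →ₗ[R] Telescope A :=
  Module.DirectLimit.of R ℕ (fun _ => F) (fun i j _ => A ^ (j - i)) k

theorem of_comp_pow (k l : ℕ) : of A (k + l) ∘ₗ A ^ l = of A k := by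
  ext x
  have := Module.DirectLimit.of_f (R := R) (ι := ℕ) (G := fun _ => F)
    (f := fun i j _ => A ^ (j - i)) (hij := Nat.le_add_right k l) (x := x)
  rw [Nat.add_sub_cancel_left] at this
  exact this

theorem of_succ_comp (k : ℕ) : of A (k + 1) ∘ₗ A = of A k := by
  have := of_comp_pow A k 1
  rwa [pow_one] at this

theorem range_of_le {k l : ℕ} (h : k ≤ l) :
    LinearMap.range (of A k) ≤ LinearMap.range (of A l) := by
  obtain ⟨d, rfl⟩ := Nat.exists_eq_add_of_le h
  rw [← of_comp_pow A k d]
  exact LinearMap.range_comp_le_range _ _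

theorem exists_of (z : Telescope A) : ∃ k x, of A k x = z := Module.DirectLimit.exists_of z

variable {A} {B : Module.End R F} (hB : B * A * A = A)

/-- The partial inverses of the canonical maps. -/
def inv (k : ℕ) : Telescope A →ₗ[R] F :=
  -- The exponent is `k + 1` because cancelling powers of `B` must leave a factor `A`. Consequently
  -- this map followed by `of A (k + 1)`, not by `of A k`, fixes the image of stage `k`.
  Module.DirectLimit.lift R ℕ _ _ (fun l => B ^ l * A ^ (k + 1)) (by
    intro i j hij x
    rw [← Module.End.mul_apply, mul_assoc, ← pow_add]
    obtain ⟨d, rfl⟩ := Nat.exists_eq_add_of_le hij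
    rw [Nat.add_sub_cancel_left, pow_add, mul_assoc, pow_mul_pow_add_of_mul_mul_eq hB])

theorem inv_of (k l : ℕ) (x : F) : inv hB k (of A l x) = (B ^ l * A ^ (k + 1)) x :=
  Module.DirectLimit.lift_of _ _ _

theorem inv_comp_of_self (k : ℕ) : inv hB k ∘ₗ of A k = A := by
  ext x
  rw [LinearMap.comp_apply, inv_of, add_comm k 1]
  have := pow_mul_pow_add_of_mul_mul_eq hB k 0
  rw [zero_add, pow_one] at this
  rw [this]

/-- The endomorphism of the telescope that is the identity on the image of the `k`-th term. -/
def proj (k : ℕ) : Module.End R (Telescope A) := of A (k + 1) ∘ₗ inv hB k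

theorem proj_of {k l : ℕ} (h : k ≤ l) (x : F) : proj hB l (of A k x) = of A k x := by
  obtain ⟨d, rfl⟩ := Nat.exists_eq_add_of_le h
  rw [proj, LinearMap.comp_apply, inv_of]
  have := pow_mul_pow_add_of_mul_mul_eq hB k d
  rw [show k + d + 1 = d + 1 + k by ring, this, show d + 1 + k = k + (d + 1) by ring,
    ← LinearMap.comp_apply, of_comp_pow]

/-- The part of the telescope left after subtracting the first projections. -/
def rem : ℕ → Module.End R (Telescope A)
  | 0 => 1
  | k + 1 => (1 - proj hB k) * rem k

theorem rem_of_mem (k : ℕ) (x : F) {l : ℕ} (hl : l ≤ k) :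
    rem hB l (of A k x) ∈ LinearMap.range (of A k) := by
  induction l with
  | zero => exact ⟨x, rfl⟩
  | succ l ih =>
    have := ih (by omega)
    rw [rem, Module.End.mul_apply, LinearMap.sub_apply, Module.End.one_apply]
    exact sub_mem this (range_of_le A hl ⟨_, rfl⟩)

theorem rem_of_eq_zero (k : ℕ) (x : F) {l : ℕ} (hl : k < l) : rem hB l (of A k x) = 0 := by
  induction l, hl using Nat.le_induction with
  | base =>
    obtain ⟨y, hy⟩ := rem_of_mem hB k x le_rfl
    rw [rem, Module.End.mul_apply, ← hy, LinearMap.sub_apply, proj_of hB le_rfl,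
      Module.End.one_apply, sub_self]
  | succ l _ ih => rw [rem, Module.End.mul_apply, ih, map_zero]

theorem exists_rem_eq_zero (z : Telescope A) : ∃ k, ∀ l, k ≤ l → rem hB l z = 0 := by
  obtain ⟨k, x, rfl⟩ := exists_of A z
  exact ⟨k + 1, fun l hl => rem_of_eq_zero hB k x hl⟩

/-- The embedding of the telescope into a countable direct sum. -/
def embed : Telescope A →ₗ[R] (ℕ →₀ F) where
  toFun z := Finsupp.ofSupportFinite (fun k => inv hB k (rem hB k z)) (by
    obtain ⟨k, hk⟩ := exists_rem_eq_zero hB z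
    refine (Set.finite_lt_nat k).subset fun l hl => ?_
    by_contra h
    exact hl (by simp only [hk l (not_lt.1 h), map_zero]))
  map_add' z z' := by
    ext k
    simp [Finsupp.ofSupportFinite_coe]
  map_smul' r z := by
    ext k
    simp [Finsupp.ofSupportFinite_coe]

theorem embed_apply (z : Telescope A) (k : ℕ) : embed hB z k = inv hB k (rem hB k z) := rfl

theorem lsum_comp_embed :
    (Finsupp.lsum R fun k => of A (k + 1)) ∘ₗ embed hB = LinearMap.id := by
  refine LinearMap.ext fun z => ?_
  obtain ⟨k, hk⟩ := exists_rem_eq_zero hB z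
  rw [LinearMap.comp_apply, Finsupp.lsum_apply, Finsupp.sum_of_support_subset (s := Finset.range k)]
  · have h1 : ∀ l, of A (l + 1) (embed hB z l) = rem hB l z - rem hB (l + 1) z := by
      intro l
      rw [embed_apply, rem, Module.End.mul_apply, LinearMap.sub_apply, Module.End.one_apply,
        sub_sub_cancel]
      rfl
    rw [Finset.sum_congr rfl fun l _ => h1 l, Finset.sum_range_sub', hk k le_rfl, sub_zero]
    rfl
  · intro l hl
    rw [Finset.mem_range]
    by_contra h
    refine (Finsupp.mem_support_iff.1 hl) ?_
    rw [embed_apply, hk l (not_lt.1 h), map_zero]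
  · simp

include hB in
theorem inAdd {M : Type v} [AddCommGroup M] [Module R M] (hF : InAdd R M F) :
    InAdd R M (Telescope A) :=
  InAdd.of_retract hF.finsupp_nat (lsum_comp_embed hB)

theorem isCountablyGenerated (hF : IsCountablyGenerated R F) :
    IsCountablyGenerated R (Telescope A) := by
  refine isCountablyGenerated_of_iUnion (fun _ : ℕ => hF) (of A) ?_
  rw [eq_top_iff]
  intro z _
  obtain ⟨k, x, rfl⟩ := exists_of A z
  exact Submodule.mem_iSup_of_mem k ⟨x, rfl⟩

theorem exists_eq_of_comp {M : Type*} [AddCommGroup M] [Module R M] [Module.Finite R M]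
    (p : M →ₗ[R] Telescope A) : ∃ k, p = of A (k + 1) ∘ₗ (inv hB k ∘ₗ p) := by
  obtain ⟨t, ht⟩ := Module.Finite.fg_top (R := R) (M := M)
  choose k x hx using fun m => exists_of A (p m)
  refine ⟨t.sup k, LinearMap.ext_on (s := t) ht fun m hm => ?_⟩
  have := proj_of hB (Finset.le_sup (f := k) hm) (x m)
  rw [hx] at this
  exact this.symm

variable {M : Type v} [AddCommGroup M] [Module R M] [Module.Finite R M]
  {s : ℕ} {n : Fin s → ℕ} {D : Fin s → Type w} [∀ i, DivisionRing (D i)]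
  (e : Module.End R M ⧸ Ring.jacobson (Module.End R M) ≃+*
    ∀ i, Matrix (Fin (n i)) (Fin (n i)) (D i))

open MultSpace

include hB in
/-- If the transition map acts on a multiplicity space as an idempotent, then the multiplicity
space of the telescope is the image of that idempotent. -/
theorem dimHom_of_map_eq {i : Fin s} (hn : 0 < n i) {V : Type*} [AddCommGroup V]
    [Module (D i)ᵐᵒᵖ V] (α : V →ₗ[(D i)ᵐᵒᵖ] MultSpace e i F)
    (β : MultSpace e i F →ₗ[(D i)ᵐᵒᵖ] V) (hβα : β ∘ₗ α = LinearMap.id)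
    (hA : map e i A = α ∘ₗ β) :
    dimHom e (Telescope A) i = Cardinal.toENat (Module.rank (D i)ᵐᵒᵖ V) := by
  have hβα' : ∀ v, β (α v) = v := fun v => LinearMap.congr_fun hβα v
  have hA' : ∀ w, map e i A w = α (β w) := fun w => LinearMap.congr_fun hA w
  have h1 : ∀ k w, map e i (of A k) w = map e i (of A (k + 1)) (α (β w)) := by
    intro k w
    rw [← of_succ_comp A k, map_comp_apply, hA']
  have h2 : ∀ k w, map e i (of A k) (α (β w)) = map e i (of A k) w := by
    intro k w
    rw [h1, h1 k w, hβα']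
  -- As `A` acts idempotently, all stages act alike on the multiplicity space, so stage zero already
  -- reaches every vector.
  have h3 : ∀ k w, map e i (of A k) w = map e i (of A 0) w := by
    intro k
    induction k with
    | zero => intro w; rfl
    | succ k ih => intro w; rw [← h2, ← h1, ih]
  have hsurj : ∀ w, ∃ y, w = map e i (of A 0) y := by
    intro w
    obtain ⟨p, rfl⟩ := exists_eq_map_col e ⟨0, hn⟩ w
    obtain ⟨k, hk⟩ := exists_eq_of_comp hB p
    rw [hk, map_comp_apply, h3]
    exact ⟨_, rfl⟩
  have h4 : ∀ w, map e i (inv hB 0) (map e i (of A 0) w) = α (β w) := by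
    intro w
    rw [← map_comp_apply, inv_comp_of_self, hA']
  have E : MultSpace e i (Telescope A) ≃ₗ[(D i)ᵐᵒᵖ] V :=
    LinearEquiv.ofLinearMap (β ∘ₗ map e i (inv hB 0)) (map e i (of A 0) ∘ₗ α)
      (by ext1 v; simp only [LinearMap.comp_apply, h4, hβα', LinearMap.id_apply])
      (by
        ext1 w
        obtain ⟨y, rfl⟩ := hsurj w
        simp only [LinearMap.comp_apply, h4, hβα', LinearMap.id_apply, h2])
  rw [dimHom_apply, ← Cardinal.toENat_lift, E.lift_rank_eq, Cardinal.toENat_lift]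

-- `A` itself factors through the telescope, as `inv hB 0 ∘ of A 0`.
include hB in
omit [Module.Finite R M] in
theorem dimHom_ne_zero_of_map_ne_zero {i : Fin s} (h : map e i A ≠ 0) :
    dimHom e (Telescope A) i ≠ 0 := by
  rw [Ne, dimHom_eq_zero_iff]
  intro h0
  refine h (LinearMap.ext fun w => ?_)
  rw [← inv_comp_of_self hB 0, map_comp_apply, h0 (map e i (of A 0) w), _root_.map_zero,
    LinearMap.zero_apply]

end Telescope

end Telescope

/-! ### Maps with coefficients in an ideal of `S`. -/

section IdealMaps

open MultSpace

variable {R : Type u} [CommRing R] {M : Type v} [AddCommGroup M] [Module R M]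
variable {X Y : Type v} [AddCommGroup X] [Module R X] [AddCommGroup Y] [Module R Y]

/-- The submodule `Hom_R(M, X) I` of `Hom_R(M, X)`. -/
def homMul (X : Type v) [AddCommGroup X] [Module R X] (I : Submodule R (Module.End R M)) :
    Submodule R (M →ₗ[R] X) :=
  Submodule.span R {p | ∃ (q : M →ₗ[R] X), ∃ x ∈ I, p = q ∘ₗ x}

theorem comp_mem_homMul {I : Submodule R (Module.End R M)} (q : M →ₗ[R] X) {x : Module.End R M}
    (hx : x ∈ I) : q ∘ₗ x ∈ homMul X I := Submodule.subset_span ⟨q, x, hx, rfl⟩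

theorem homMul_mono {I K : Submodule R (Module.End R M)} (h : I ≤ K) :
    homMul X I ≤ homMul X K :=
  Submodule.span_mono fun _ ⟨q, x, hx, hp⟩ => ⟨q, x, h hx, hp⟩

theorem comp_homMul_mem {I K : Submodule R (Module.End R M)} {C : X →ₗ[R] Y}
    (hC : ∀ p : M →ₗ[R] X, C ∘ₗ p ∈ homMul Y K) {p : M →ₗ[R] X} (hp : p ∈ homMul X I) :
    C ∘ₗ p ∈ homMul Y (K * I) := by
  induction hp using Submodule.span_induction with
  | mem p h =>
    obtain ⟨q, x, hx, rfl⟩ := h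
    rw [← LinearMap.comp_assoc]
    generalize hr : C ∘ₗ q = r
    have hr' := hC q
    rw [hr] at hr'
    clear hr
    induction hr' using Submodule.span_induction with
    | mem r h =>
      obtain ⟨t, y, hy, rfl⟩ := h
      rw [LinearMap.comp_assoc]
      exact comp_mem_homMul t (Submodule.mul_mem_mul hy hx)
    | zero => rw [LinearMap.zero_comp]; exact zero_mem _
    | add a b _ _ ha hb => rw [LinearMap.add_comp]; exact add_mem ha hb
    | smul r a _ ha => rw [LinearMap.smul_comp]; exact Submodule.smul_mem _ _ ha
  | zero => rw [LinearMap.comp_zero]; exact zero_mem _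
  | add a b _ _ ha hb => rw [LinearMap.comp_add]; exact add_mem ha hb
  | smul r a _ ha => rw [LinearMap.comp_smul]; exact Submodule.smul_mem _ _ ha

/-- This moves an error term in the radical into `J^(N+1)`, hence into any ideal containing that
power. -/
theorem pow_comp_mem_homMul {I : Submodule R (Module.End R M)} {C : Module.End R X}
    (hC : ∀ p : M →ₗ[R] X, C ∘ₗ p ∈ homMul X I) (N : ℕ) (p : M →ₗ[R] X) :
    (C ^ (N + 1)) ∘ₗ p ∈ homMul X (I ^ (N + 1)) := by
  induction N generalizing p with
  | zero => simpa using hC p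
  | succ N ih =>
    rw [pow_succ C, pow_succ I, Module.End.mul_eq_comp, LinearMap.comp_assoc]
    exact comp_homMul_mem ih (hC p)

/-- The diagonal action of an endomorphism of `M` on a direct sum of copies of `M`. -/
def diag (ι : Type*) (a : Module.End R M) : Module.End R (ι →₀ M) := Finsupp.mapRange.linearMap a

theorem diag_single {ι : Type*} (a : Module.End R M) (k : ι) (x : M) :
    diag ι a (Finsupp.single k x) = Finsupp.single k (a x) := by
  simp [diag]

theorem mem_homMul_span {κ : Type*} [Fintype κ] {a : κ → Module.End R M} {p : M →ₗ[R] X}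
    (hp : p ∈ homMul X (Submodule.span R (Set.range a))) :
    ∃ y : κ → M →ₗ[R] X, p = ∑ j, y j ∘ₗ a j := by
  induction hp using Submodule.span_induction with
  | mem p h =>
    obtain ⟨q, x, hx, rfl⟩ := h
    obtain ⟨c, rfl⟩ := (Submodule.mem_span_range_iff_exists_fun R).1 hx
    refine ⟨fun j => c j • q, ?_⟩
    ext m
    simp
  | zero => exact ⟨0, by simp⟩
  | add p q _ _ hp hq =>
    obtain ⟨y, rfl⟩ := hp
    obtain ⟨z, rfl⟩ := hq
    exact ⟨y + z, by simp [LinearMap.add_comp, Finset.sum_add_distrib]⟩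
  | smul r p _ hp =>
    obtain ⟨y, rfl⟩ := hp
    exact ⟨r • y, by simp [LinearMap.smul_comp, Finset.smul_sum]⟩

/-- The finite list of generators is the same for every coordinate `k`, so the coefficients assemble
into finitely many maps on the whole direct sum. -/
theorem exists_eq_sum_comp_diag {ι κ : Type*} [Fintype κ] {a : κ → Module.End R M} 
    {C : (ι →₀ M) →ₗ[R] X}
    (hC : ∀ k, C ∘ₗ Finsupp.lsingle k ∈ homMul X (Submodule.span R (Set.range a))) :
    ∃ y : κ → (ι →₀ M) →ₗ[R] X, C = ∑ j, y j ∘ₗ diag ι (a j) := by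
  choose y hy using fun k => mem_homMul_span (hC k)
  refine ⟨fun j => Finsupp.lsum R fun k => y k j, ?_⟩
  ext k x
  rw [hy]
  simp [LinearMap.sum_apply, diag_single]

theorem diag_comp_mem_homMul [Module.Finite R M] {ι : Type}
    {I : Submodule R (Module.End R M)} (hI : IsTwoSidedSubmodule I) {a : Module.End R M}
    (ha : a ∈ I) (p : M →ₗ[R] (ι →₀ M)) : diag ι a ∘ₗ p ∈ homMul (ι →₀ M) I := by
  obtain ⟨t, ht⟩ := exists_eq_sum_lsingle_comp p
  have : diag ι a ∘ₗ p = ∑ k ∈ t, Finsupp.lsingle k ∘ₗ (a * (Finsupp.lapply k ∘ₗ p)) := by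
    conv_lhs => rw [ht]
    ext x : 1
    simp [diag_single]
  rw [this]
  exact Submodule.sum_mem _ fun k _ => comp_mem_homMul _ (hI.mul_right _ _ ha)

variable {s : ℕ} {n : Fin s → ℕ} {D : Fin s → Type w} [∀ i, DivisionRing (D i)]
variable (e : Module.End R M ⧸ Ring.jacobson (Module.End R M) ≃+*
  ∀ i, Matrix (Fin (n i)) (Fin (n i)) (D i))

theorem map_eq_zero_of_homMul {I : Submodule R (Module.End R M)} {i : Fin s} (hn : 0 < n i)
    (hi : ¬ InSupport e I i) {C : X →ₗ[R] Y} (hC : ∀ p : M →ₗ[R] X, C ∘ₗ p ∈ homMul Y I) :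
    map e i C = 0 := by
  refine map_comp_eq_zero e C ⟨0, hn⟩ fun p => ?_
  generalize hr : C ∘ₗ p = r
  have hr' := hC p
  rw [hr] at hr'
  clear hr
  induction hr' using Submodule.span_induction with
  | mem r h =>
    obtain ⟨q, x, hx, rfl⟩ := h
    have h0 : SimpleRow.matrixOf e i x = 0 := by
      by_contra h
      exact hi ⟨x, hx, h⟩
    rw [map_comp, (map_eq_zero_iff e ⟨0, hn⟩ x).2 h0, LinearMap.comp_zero]
  | zero => exact MultSpace.map_zero e i
  | add a b _ _ ha hb => rw [MultSpace.map_add, ha, hb, add_zero]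
  | smul r a _ ha =>
    have : r • a = (r • LinearMap.id) ∘ₗ a := by ext; simp
    rw [this, map_comp, ha, LinearMap.comp_zero]

/-- `C ∘ p` is a finite sum of maps `g j ∘ (f j ∘ C ∘ p)`, whose inner factors act as zero on all
multiplicity spaces of `M`. -/
theorem comp_mem_homMul_jacobson [Module.Finite R M] (hn : ∀ i, 0 < n i) (hX : InAdd R M X)
    {C : X →ₗ[R] X} (hC : ∀ i, map e i C = 0) (p : M →ₗ[R] X) :
    C ∘ₗ p ∈ homMul X (jacobsonSubmodule R (Module.End R M)) := by
  obtain ⟨ψ, hψ, hψp⟩ := hX.exists_finMaps_comp_eq (C ∘ₗ p)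
  obtain ⟨k, g, f, rfl⟩ := exists_sum_of_mem_finMaps hψ
  have h : (∑ j, g j ∘ₗ f j) ∘ₗ C ∘ₗ p = ∑ j, g j ∘ₗ (f j ∘ₗ C ∘ₗ p) := by
    ext x; simp
  rw [← hψp, h]
  refine Submodule.sum_mem _ fun j _ => ?_
  refine comp_mem_homMul _ ((mem_jacobson_iff e).2 fun i => ?_)
  exact matrixOf_eq_zero_of_map e ⟨0, hn i⟩ (hC i) p (f j)

/-- `map` as a ring homomorphism. -/
def mapRingHom (i : Fin s) (X : Type v) [AddCommGroup X] [Module R X] :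
    Module.End R X →+* Module.End (D i)ᵐᵒᵖ (MultSpace e i X) where
  toFun := map e i
  map_one' := map_id e i
  map_mul' f g := map_comp e i f g
  map_zero' := MultSpace.map_zero e i
  map_add' := MultSpace.map_add e i

end IdealMaps

/-! ### Self-similarity of `M^(ℕ)`. -/

section IndexMaps

variable (R : Type*) [CommRing R] (M : Type*) [AddCommGroup M] [Module R M]

/-- The `j`-th embedding of `M^(ℕ)` into itself along a partition of `ℕ` into copies of `ℕ`. -/
def indexIncl (j : ℕ) : Module.End R (ℕ →₀ M) := Finsupp.lmapDomain M R (Nat.pair j)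

/-- The retraction of `indexIncl`. -/
def indexProj (j : ℕ) : Module.End R (ℕ →₀ M) :=
  Finsupp.lsum R fun k =>
    if (Nat.unpair k).1 = j then Finsupp.lsingle (Nat.unpair k).2 else 0

theorem indexProj_mul_incl (j k : ℕ) :
    indexProj R M j * indexIncl R M k = if k = j then 1 else 0 := by
  ext l x : 2
  by_cases h : k = j <;> simp [indexProj, indexIncl, h]

theorem diag_mul_indexProj (a : Module.End R M) (j : ℕ) :
    diag ℕ a * indexProj R M j = indexProj R M j * diag ℕ a := by
  ext l x : 2
  by_cases h : (Nat.unpair l).1 = j <;> simp [indexProj, diag_single, h]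

end IndexMaps

/-! ### Lifting idempotents by a polynomial. -/

section Idempotents

/-- A polynomial that lifts idempotents. -/
theorem exists_polynomial_lift (N : ℕ) : ∃ P Q : Polynomial ℤ,
    P - P * P = (Polynomial.X - Polynomial.X * Polynomial.X) ^ (N + 1) * Q ∧
    ∀ {T : Type w} [Ring T] (a : T), a * a = a → Polynomial.aeval a P = a := by
  set x : Polynomial ℤ := Polynomial.X
  -- The polynomial is `P = 1 - (1 - x^(N+1))^(N+1)`: it is divisible by `x^(N+1)`, while `1 - P` is
  -- divisible by `(1 - x)^(N+1)`.
  have h1 : x ^ (N + 1) ∣ 1 - (1 - x ^ (N + 1)) ^ (N + 1) := by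
    have := sub_dvd_pow_sub_pow 1 (1 - x ^ (N + 1)) (N + 1)
    rwa [one_pow, sub_sub_cancel] at this
  have h2 : (1 - x) ^ (N + 1) ∣ 1 - (1 - (1 - x ^ (N + 1)) ^ (N + 1)) := by
    rw [sub_sub_cancel]
    refine pow_dvd_pow_of_dvd ?_ _
    have := sub_dvd_pow_sub_pow 1 x (N + 1)
    rwa [one_pow] at this
  obtain ⟨Q, hQ⟩ := mul_dvd_mul h1 h2
  refine ⟨1 - (1 - x ^ (N + 1)) ^ (N + 1), Q, ?_, fun {T} _ a ha => ?_⟩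
  · rw [show x - x * x = x * (1 - x) by ring, mul_pow, ← hQ]
    ring
  · have ha' : IsIdempotentElem a := ha
    simp only [x, map_sub, map_one, map_pow, Polynomial.aeval_X]
    rw [ha'.pow_succ_eq, ha'.one_sub.pow_succ_eq, sub_sub_cancel]

end Idempotents

/-! ### Realizing idempotent ideals by objects of `Add(M)`. -/

section Construction

open MultSpace

variable {R : Type u} [CommRing R] {M : Type v} [AddCommGroup M] [Module R M] [Module.Finite R M]
variable {s : ℕ} {n : Fin s → ℕ} {D : Fin s → Type w} [∀ i, DivisionRing (D i)]
variable (e : Module.End R M ⧸ Ring.jacobson (Module.End R M) ≃+*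
  ∀ i, Matrix (Fin (n i)) (Fin (n i)) (D i))

open Pointwise in
/-- An endomorphism of `M^(ℕ)` that is idempotent modulo an idempotent ideal `I` is, up to maps in
`I`, the transition map of a telescope in `Add(M)`. -/
theorem exists_telescope {κ : Type*} [Fintype κ] (a : κ → Module.End R M) (ν : κ → ℕ)
    (hν : Function.Injective ν) (hν0 : ∀ j, ν j ≠ 0)
    (hI : IsTwoSidedSubmodule (Submodule.span R (Set.range a)))
    (hII : Submodule.span R (Set.range a) * Submodule.span R (Set.range a) =
      Submodule.span R (Set.range a))
    (E : Module.End R (ℕ →₀ M))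
    (hE : ∀ p : M →ₗ[R] (ℕ →₀ M),
      (E - E * E) ∘ₗ p ∈ homMul (ℕ →₀ M) (Submodule.span R (Set.range a))) :
    ∃ B, B * (indexIncl R M 0 * (E * indexProj R M 0) + ∑ j, indexIncl R M (ν j) * diag ℕ (a j)) *
      (indexIncl R M 0 * (E * indexProj R M 0) + ∑ j, indexIncl R M (ν j) * diag ℕ (a j)) =
      indexIncl R M 0 * (E * indexProj R M 0) + ∑ j, indexIncl R M (ν j) * diag ℕ (a j) := by
  classical
  set E' := E * indexProj R M 0 with hE'
  set A := indexIncl R M 0 * E' + ∑ j, indexIncl R M (ν j) * diag ℕ (a j) with hA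
  have hA0 : indexProj R M 0 * A = E' := by
    rw [hA, mul_add, ← mul_assoc, indexProj_mul_incl, if_pos rfl, one_mul, Finset.mul_sum,
      Finset.sum_eq_zero, add_zero]
    intro j _
    rw [← mul_assoc, indexProj_mul_incl, if_neg (hν0 j), zero_mul]
  have hAj : ∀ j, indexProj R M (ν j) * A = diag ℕ (a j) := by
    intro j
    rw [hA, mul_add, ← mul_assoc, indexProj_mul_incl, if_neg (hν0 j).symm, zero_mul, zero_add,
      Finset.mul_sum, Finset.sum_eq_single j]
    · rw [← mul_assoc, indexProj_mul_incl, if_pos rfl, one_mul]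
    · intro k _ hk
      rw [← mul_assoc, indexProj_mul_incl, if_neg fun h => hk (hν h), zero_mul]
    · simp
  -- The claim is that `A` lies in the left ideal generated by `A * A`. The block projections
  -- recover `E'` and each `diag ℕ (a j)` from `A` by left multiplication.
  let J : Ideal (Module.End R (ℕ →₀ M)) := Ideal.span {A * A}
  have hJI : ∀ C : Module.End R (ℕ →₀ M), (∀ p : M →ₗ[R] (ℕ →₀ M),
      C ∘ₗ p ∈ homMul (ℕ →₀ M) (Submodule.span R (Set.range a))) → C ∈ J := by
    intro C hC
    have hrange : Set.range a * Set.range a = Set.range fun j : κ × κ => a j.1 * a j.2 := by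
      ext x
      simp [Set.mem_mul]
    -- Idempotency provides products of two generators. A diagonal map commutes with block
    -- projections, so both factors can be exchanged for copies of `A`.
    rw [← hII, Submodule.span_mul_span, hrange] at hC
    obtain ⟨y, rfl⟩ := exists_eq_sum_comp_diag fun k => hC _
    refine Submodule.sum_mem _ fun j _ => ?_
    have h1 : diag ℕ (a j.1 * a j.2) = diag ℕ (a j.1) * diag ℕ (a j.2) := by
      ext k x : 2
      simp [diag_single]
    have h2 : y j ∘ₗ diag ℕ (a j.1 * a j.2) =
        (y j * (indexProj R M (ν j.2) * indexProj R M (ν j.1))) * (A * A) := by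
      change y j * diag ℕ (a j.1 * a j.2) = _
      rw [h1, ← hAj j.2, ← mul_assoc (diag ℕ (a j.1)), diag_mul_indexProj, ← hAj j.1]
      simp only [mul_assoc]
    rw [h2]
    exact Ideal.mul_mem_left _ _ (Ideal.subset_span rfl)
  have hE2 : E' ∈ J := by
    -- Here `indexProj R M 0 * A * A` is `E * E * indexProj R M 0`; the defect `E - E * E` is
    -- covered by `hJI`.
    have h1 : E' = indexProj R M 0 * (A * A) + (E - E * E) * indexProj R M 0 := by
      rw [← mul_assoc, hA0]
      nth_rewrite 2 [hE']
      rw [mul_assoc, hA0, hE', sub_mul, mul_assoc]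
      abel
    rw [h1]
    exact add_mem (Ideal.mul_mem_left _ _ (Ideal.subset_span rfl))
      (hJI _ fun p => hE (indexProj R M 0 ∘ₗ p))
  have hAJ : A ∈ J := by
    rw [hA]
    refine add_mem (Ideal.mul_mem_left _ _ hE2) (Submodule.sum_mem _ fun j _ =>
      Ideal.mul_mem_left _ _ (hJI _ fun p => ?_))
    exact diag_comp_mem_homMul hI (Submodule.subset_span ⟨j, rfl⟩) p
  obtain ⟨B, hB⟩ := Ideal.mem_span_singleton'.1 hAJ
  exact ⟨B, by rw [mul_assoc, hB]⟩

/-- An idempotent ideal `I` of finite colength is realized by a countably generated object of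
`Add(M)` with arbitrary finite dimensions outside the support of `I`. -/
theorem exists_inAdd_of_idempotent_aux [IsNoetherianRing R] (hn : ∀ i, 0 < n i)
    {I : Submodule R (Module.End R M)} (hI : IsTwoSidedSubmodule I) (hII : I * I = I)
    [IsArtinian R (Module.End R M ⧸ I)] (c : Fin s → ℕ) :
    ∃ (X : Type v) (_ : AddCommGroup X) (_ : Module R X), InAdd R M X ∧
      IsCountablyGenerated R X ∧ (∀ i, ¬ InSupport e I i → dimHom e X i = c i) ∧
      ∀ i, InSupport e I i → dimHom e X i ≠ 0 := by
  obtain ⟨N, hN⟩ := hI.exists_jacobson_pow_le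
  obtain ⟨m, a, rfl⟩ := Submodule.fg_iff_exists_fin_generating_family.1 (IsNoetherian.noetherian I)
  have h1 : ∀ i, ∃ (α : (Fin (c i) → (D i)ᵐᵒᵖ) →ₗ[(D i)ᵐᵒᵖ] MultSpace e i (ℕ →₀ M))
      (β : MultSpace e i (ℕ →₀ M) →ₗ[(D i)ᵐᵒᵖ] (Fin (c i) → (D i)ᵐᵒᵖ)),
      β ∘ₗ α = LinearMap.id := by
    intro i
    -- An infinite-dimensional multiplicity space has a direct summand of any finite dimension `c
    -- i`.
    have htop : dimHom e (ℕ →₀ M) i = ⊤ := by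
      rw [dimHom_finsupp_nat e hn, dimHom_self e hn]
      refine ENat.top_mul ?_
      simpa [castVec] using (hn i).ne'
    have hle : Cardinal.lift.{max v w} (Module.rank (D i)ᵐᵒᵖ (Fin (c i) → (D i)ᵐᵒᵖ)) ≤
        Cardinal.lift.{w} (Module.rank (D i)ᵐᵒᵖ (MultSpace e i (ℕ →₀ M))) := by
      rw [rank_fun', Fintype.card_fin, Cardinal.lift_natCast]
      rw [dimHom_apply, Cardinal.toENat_eq_top] at htop
      exact Cardinal.natCast_lt_aleph0.le.trans (by simpa using htop)
    obtain ⟨α, hα⟩ := lift_rank_le_iff_exists_linearMap.1 hle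
    obtain ⟨β, hβ⟩ := α.exists_leftInverse_of_injective (LinearMap.ker_eq_bot.2 hα)
    exact ⟨α, β, hβ⟩
  choose α β hβα using h1
  obtain ⟨E₀, hE₀⟩ := exists_map_eq e hn inAdd_self.finsupp_nat fun i => α i ∘ₗ β i
  have hidem : ∀ i, map e i E₀ ∘ₗ map e i E₀ = map e i E₀ := by
    intro i
    rw [hE₀, LinearMap.comp_assoc, ← LinearMap.comp_assoc (β i), hβα, LinearMap.id_comp]
  obtain ⟨P, Q, hPQ, hP⟩ := exists_polynomial_lift.{max v w} N
  set E : Module.End R (ℕ →₀ M) := Polynomial.aeval E₀ P with hE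
  have hEmap : ∀ i, map e i E = α i ∘ₗ β i := by
    intro i
    rw [← hE₀]
    have := Polynomial.aeval_algHom_apply (mapRingHom e i (ℕ →₀ M)).toIntAlgHom E₀ P
    refine this.symm.trans (hP _ (hidem i))
  have hEI : ∀ p : M →ₗ[R] (ℕ →₀ M), (E - E * E) ∘ₗ p ∈
      homMul (ℕ →₀ M) (Submodule.span R (Set.range a)) := by
    intro p
    -- `E₀` is idempotent modulo the radical only. The polynomial raises its defect to the power `N
    -- + 1`, which falls into `I`, without changing the action on multiplicity spaces.
    have h2 : E - E * E = (E₀ - E₀ * E₀) ^ (N + 1) * Polynomial.aeval E₀ Q := by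
      have := congrArg (Polynomial.aeval E₀) hPQ
      simpa using this
    rw [h2, Module.End.mul_eq_comp, LinearMap.comp_assoc]
    refine homMul_mono hN (pow_comp_mem_homMul (fun p => ?_) N _)
    refine comp_mem_homMul_jacobson e hn inAdd_self.finsupp_nat (fun i => ?_) p
    rw [MultSpace.map_sub, Module.End.mul_eq_comp, map_comp, hidem, sub_self]
  -- The shift by one reserves block zero for `E`.
  obtain ⟨B, hB⟩ := exists_telescope a (fun j : Fin m => (j : ℕ) + 1)
    (fun j k h => Fin.ext (Nat.succ_injective h)) (fun j => Nat.succ_ne_zero _) hI hII E hEI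
  have hpi : ∀ i, map e i (indexProj R M 0) ∘ₗ map e i (indexIncl R M 0) = LinearMap.id := by
    intro i
    rw [← map_comp]
    have := indexProj_mul_incl R M 0 0
    rw [if_pos rfl] at this
    exact (congrArg (map e i) this).trans (map_id e i)
  set A := indexIncl R M 0 * (E * indexProj R M 0) +
    ∑ j : Fin m, indexIncl R M ((j : ℕ) + 1) * diag ℕ (a j) with hA
  refine ⟨Telescope A, inferInstance, inferInstance, Telescope.inAdd hB inAdd_self.finsupp_nat,
    Telescope.isCountablyGenerated isCountablyGenerated_of_finite.finsupp, fun i hi => ?_,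
    fun i hi => Telescope.dimHom_ne_zero_of_map_ne_zero hB e fun h0 => ?_⟩
  · have hdiag : ∀ j : Fin m, map e i (diag ℕ (a j)) = 0 := fun j =>
      map_eq_zero_of_homMul e (hn i) hi fun p =>
        diag_comp_mem_homMul hI (Submodule.subset_span ⟨j, rfl⟩) p
    have hAi : map e i A = (map e i (indexIncl R M 0) ∘ₗ α i) ∘ₗ
        (β i ∘ₗ map e i (indexProj R M 0)) := by
      rw [hA, MultSpace.map_add, MultSpace.map_sum, Finset.sum_eq_zero, add_zero]
      · simp only [Module.End.mul_eq_comp, map_comp, hEmap, LinearMap.comp_assoc]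
      · intro j _
        rw [Module.End.mul_eq_comp, map_comp, hdiag, LinearMap.comp_zero]
    rw [Telescope.dimHom_of_map_eq hB e (hn i) _ _ ?_ hAi, rank_fun', Fintype.card_fin,
      Cardinal.toENat_nat]
    rw [LinearMap.comp_assoc, ← LinearMap.comp_assoc (α i), hpi, LinearMap.id_comp, hβα]
  · obtain ⟨x, hx, hx0⟩ := hi
    refine hx0 ?_
    clear hx0
    -- Each generator is an entry of a block of `A`, so if `A` acted as zero in component `i`, all
    -- of `I` would vanish there.
    have hj : ∀ j : Fin m, SimpleRow.matrixOf e i (a j) = 0 := by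
      intro j
      have h3 : indexProj R M ((j : ℕ) + 1) * A = diag ℕ (a j) := by
        rw [hA, mul_add, ← mul_assoc, indexProj_mul_incl, if_neg (Nat.succ_ne_zero _).symm,
          zero_mul, zero_add, Finset.mul_sum, Finset.sum_eq_single j]
        · rw [← mul_assoc, indexProj_mul_incl, if_pos rfl, one_mul]
        · intro k _ hk
          rw [← mul_assoc, indexProj_mul_incl,
            if_neg fun h => hk (Fin.ext (Nat.succ_injective h)), zero_mul]
        · simp
      have h4 : a j = Finsupp.lapply 0 ∘ₗ (indexProj R M ((j : ℕ) + 1) * A) ∘ₗ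
          Finsupp.lsingle 0 := by
        rw [h3]
        ext x
        simp [diag_single]
      rw [← map_eq_zero_iff e ⟨0, hn i⟩, h4, map_comp, map_comp, Module.End.mul_eq_comp,
        map_comp, h0]
      simp
    induction hx using Submodule.span_induction with
    | mem x h => obtain ⟨j, rfl⟩ := h; exact hj j
    | zero => exact _root_.map_zero _
    | add x y _ _ hx hy =>
      rw [_root_.map_add, hx, hy, add_zero]
    | smul r x _ hx => rw [Algebra.smul_def, _root_.map_mul, hx, mul_zero]

/-- An idempotent ideal `I` of finite colength is realized by a countably generated object of
`Add(M)` with arbitrary finite dimensions outside the support of `I`, and infinite dimensions on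
the support. -/
theorem exists_inAdd_of_idempotent [IsNoetherianRing R] (hn : ∀ i, 0 < n i)
    {I : Submodule R (Module.End R M)} (hI : IsTwoSidedSubmodule I) (hII : I * I = I)
    [IsArtinian R (Module.End R M ⧸ I)] (c : Fin s → ℕ) :
    ∃ (X : Type v) (_ : AddCommGroup X) (_ : Module R X), InAdd R M X ∧
      IsCountablyGenerated R X ∧ (∀ i, ¬ InSupport e I i → dimHom e X i = c i) ∧
      ∀ i, InSupport e I i → dimHom e X i = ⊤ := by
  obtain ⟨X, _, _, hX, hXc, hX1, -⟩ := exists_inAdd_of_idempotent_aux e hn hI hII c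
  obtain ⟨Y, _, _, hY, hYc, hY1, hY2⟩ := exists_inAdd_of_idempotent_aux e hn hI hII 0
  -- `Y` has zero dimensions off the support and nonzero ones on it; infinitely many copies change
  -- only the supported coordinates, to `∞`.
  refine ⟨X × (ℕ →₀ Y), inferInstance, inferInstance, hX.prod hY.finsupp_nat,
    hXc.prod hYc.finsupp,
    fun i hi => ?_, fun i hi => ?_⟩
  · rw [dimHom_prod, dimHom_finsupp_nat e hn, Pi.add_apply, Pi.smul_apply, hX1 i hi, hY1 i hi]
    simp
  · rw [dimHom_prod, dimHom_finsupp_nat e hn, Pi.add_apply, Pi.smul_apply, smul_eq_mul,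
      ENat.top_mul (hY2 i hi), add_top]

end Construction

/-! ### Splitting idempotents. -/

section IdempotentSplitting

variable {R : Type u} [CommRing R] {M : Type v} [AddCommGroup M] [Module R M]
variable {X : Type v} [AddCommGroup X] [Module R X]
variable {s : ℕ} {n : Fin s → ℕ} {D : Fin s → Type w} [∀ i, DivisionRing (D i)]
variable (e : Module.End R M ⧸ Ring.jacobson (Module.End R M) ≃+*
  ∀ i, Matrix (Fin (n i)) (Fin (n i)) (D i))

theorem rangeRestrict_comp_subtype {ε : Module.End R X} (h : ε * ε = ε) :
    ε.rangeRestrict ∘ₗ (LinearMap.range ε).subtype = LinearMap.id := by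
  ext ⟨_, x, rfl⟩
  exact LinearMap.congr_fun h x

/-- The projection onto the kernel of an idempotent. -/
def toKer {ε : Module.End R X} (h : ε * ε = ε) : X →ₗ[R] LinearMap.ker ε :=
  LinearMap.codRestrict _ (1 - ε) fun x => by
    rw [LinearMap.mem_ker, LinearMap.sub_apply, Module.End.one_apply, map_sub,
      ← Module.End.mul_apply, h, sub_self]

theorem subtype_comp_toKer {ε : Module.End R X} (h : ε * ε = ε) :
    (LinearMap.ker ε).subtype ∘ₗ toKer h = 1 - ε := rfl

theorem toKer_comp_subtype {ε : Module.End R X} (h : ε * ε = ε) :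
    toKer h ∘ₗ (LinearMap.ker ε).subtype = LinearMap.id := by
  ext ⟨x, hx⟩
  change x - ε x = x
  rw [LinearMap.mem_ker.1 hx, sub_zero]

theorem toKer_comp_self {ε : Module.End R X} (h : ε * ε = ε) : toKer h ∘ₗ ε = 0 := by
  ext x
  change ε x - (ε * ε) x = 0
  rw [h, sub_self]

theorem self_comp_ker_subtype (ε : Module.End R X) : ε ∘ₗ (LinearMap.ker ε).subtype = 0 := by
  ext ⟨x, hx⟩
  exact hx

theorem inFinAdd_range {ε : Module.End R X} (h : ε * ε = ε) (hε : ε ∈ finMaps R M X X) :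
    InFinAdd R M (LinearMap.range ε) :=
  inFinAdd_of_retract (rangeRestrict_comp_subtype h) hε

theorem InAdd.ker_idempotent {ε : Module.End R X} (hX : InAdd R M X) (h : ε * ε = ε) :
    InAdd R M (LinearMap.ker ε) := hX.of_retract (toKer_comp_subtype h)

theorem dimHom_eq_range_add_ker {ε : Module.End R X} (h : ε * ε = ε) :
    dimHom e X = dimHom e (LinearMap.range ε) + dimHom e (LinearMap.ker ε) :=
  dimHom_eq_add e (rangeRestrict_comp_subtype h) (toKer_comp_subtype h) (by
    rw [subtype_comp_toKer]
    change ε + (1 - ε) = 1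
    abel)

theorem dimHom_ne_top_of_inFinAdd (hn : ∀ i, 0 < n i) (hX : InFinAdd R M X) (i : Fin s) :
    dimHom e X i ≠ ⊤ := by
  rw [dimHom_ne_top_iff]
  exact finite_multSpace_of_map_eq_id e (inFinAdd_iff_id_mem.1 hX) (hn i) (MultSpace.map_id e i)

/-- Removing finite dimensions cannot affect a vector with entries `0` and `∞`. This lets the
splitting argument be repeated on kernels. -/
theorem dimHom_ker_eq {Y : Type v} [AddCommGroup Y] [Module R Y] (hn : ∀ i, 0 < n i)
    (hd : dimHom e X = (⊤ : ℕ∞) • dimHom e Y) {ε : Module.End R X} (h : ε * ε = ε)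
    (hε : ε ∈ finMaps R M X X) : dimHom e (LinearMap.ker ε) = (⊤ : ℕ∞) • dimHom e Y := by
  ext1 i
  have h1 := dimHom_ne_top_of_inFinAdd e hn (inFinAdd_range h hε) i
  have h2 := congrFun (dimHom_eq_range_add_ker e h) i
  rw [hd, Pi.add_apply, Pi.smul_apply, smul_eq_mul] at h2
  rw [Pi.smul_apply, smul_eq_mul]
  by_cases h0 : dimHom e Y i = 0
  · rw [h0, mul_zero] at h2 ⊢
    exact (add_eq_zero.1 h2.symm).2
  · rw [ENat.top_mul h0] at h2 ⊢
    exact (WithTop.add_eq_top.1 h2.symm).resolve_left h1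

end IdempotentSplitting

/-! ### Capturing a map from `M` in a summand from `add(M)`. -/

section FiniteIdempotents

open MultSpace

variable {R : Type u} [CommRing R] [IsNoetherianRing R] {M : Type v} [AddCommGroup M] [Module R M]
  [Module.Finite R M]
variable {X Y : Type v} [AddCommGroup X] [Module R X] [AddCommGroup Y] [Module R Y]
variable {s : ℕ} {n : Fin s → ℕ} {D : Fin s → Type w} [∀ i, DivisionRing (D i)]
variable (e : Module.End R M ⧸ Ring.jacobson (Module.End R M) ≃+*
  ∀ i, Matrix (Fin (n i)) (Fin (n i)) (D i))

-- A finite map fixing `p` can be inserted, and it splits `q ∘ p` into products of two trace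
-- elements.
omit [IsNoetherianRing R] in
theorem traceIdeal_id_mul_self (hX : InAdd R M X) :
    traceIdeal M (LinearMap.id : X →ₗ[R] X) * traceIdeal M (LinearMap.id : X →ₗ[R] X) =
      traceIdeal M (LinearMap.id : X →ₗ[R] X) := by
  refine le_antisymm (isTwoSidedSubmodule_traceIdeal _).mul_le_left (Submodule.span_le.2 ?_)
  rintro _ ⟨p, q, rfl⟩
  obtain ⟨ψ, hψ, hψp⟩ := hX.exists_finMaps_comp_eq p
  obtain ⟨k, g, f, rfl⟩ := exists_sum_of_mem_finMaps hψ
  have : q ∘ₗ LinearMap.id ∘ₗ p = ∑ j, (q ∘ₗ LinearMap.id ∘ₗ g j : Module.End R M) *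
      (f j ∘ₗ LinearMap.id ∘ₗ p : Module.End R M) := by
    conv_lhs => rw [← hψp]
    ext x
    simp
  rw [this]
  exact Submodule.sum_mem _ fun j _ =>
    Submodule.mul_mem_mul (mem_traceIdeal _ _ _) (mem_traceIdeal _ _ _)

/-- The trace ideal of `X` is idempotent, so by Nakayama comparing supports suffices. -/
theorem traceIdeal_le_of_dimHom (hn : ∀ i, 0 < n i) (hX : InAdd R M X) (hY : InAdd R M Y)
    (h : ∀ i, dimHom e Y i = 0 → dimHom e X i = 0) :
    traceIdeal M (LinearMap.id : X →ₗ[R] X) ≤ traceIdeal M (LinearMap.id : Y →ₗ[R] Y) := by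
  refine IsTwoSidedSubmodule.le_of_le_sup_jacobson (isTwoSidedSubmodule_traceIdeal _)
    (isTwoSidedSubmodule_traceIdeal _) (traceIdeal_id_mul_self hX)
    (le_sup_jacobson_of_inSupport e (isTwoSidedSubmodule_traceIdeal _) fun i => ?_)
  rw [inSupport_traceIdeal e hX (hn i), inSupport_traceIdeal e hY (hn i), Ne, Ne,
    ← dimHom_eq_zero_iff_map_id, ← dimHom_eq_zero_iff_map_id]
  exact mt (h i)

/-- In an object of `Add(M)` whose dimensions are infinite multiples of those of an object of
`add(M)`, every map from `M` lands in a direct summand that belongs to `add(M)`. -/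
theorem exists_idempotent_comp_eq (hn : ∀ i, 0 < n i) (hX : InAdd R M X) (hY : InFinAdd R M Y)
    (hd : dimHom e X = (⊤ : ℕ∞) • dimHom e Y) (x : M →ₗ[R] X) :
    ∃ ε : Module.End R X, ε * ε = ε ∧ ε ∈ finMaps R M X X ∧ ε ∘ₗ x = x := by
  -- `o ε` is the left ideal of all `h ∘ ε ∘ x`; `ε` is chosen to make it maximal, using that
  -- `End_R(M)` is noetherian over `R`.
  let o : Module.End R X → Submodule R (Module.End R M) := fun ε =>
    LinearMap.range (LinearMap.lcomp R M (ε ∘ₗ x))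
  have ho : ∀ ε (h : X →ₗ[R] M), (h ∘ₗ ε ∘ₗ x : Module.End R M) ∈ o ε := fun ε h => ⟨h, rfl⟩
  have ho_left : ∀ ε (a : Module.End R M), ∀ y ∈ o ε, a * y ∈ o ε := by
    rintro ε a _ ⟨h, rfl⟩
    exact ⟨a ∘ₗ h, rfl⟩
  obtain ⟨_, ⟨ε, ⟨hεε, hε⟩, rfl⟩, hmax⟩ := set_has_maximal_iff_noetherian.2
    (inferInstance : IsNoetherian R (Module.End R M))
    (o '' {ε | ε * ε = ε ∧ ε ∈ finMaps R M X X})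
    ⟨_, 0, ⟨mul_zero _, Submodule.zero_mem _⟩, rfl⟩
  obtain ⟨γ₀, δ₀, h₀⟩ := exists_retract_of_dimHom_le e hn hY (hX.ker_idempotent hεε) (by
      rw [dimHom_ker_eq e hn hd hεε hε]
      intro i
      rw [Pi.smul_apply, smul_eq_mul]
      by_cases h0 : dimHom e Y i = 0
      · rw [h0]; exact zero_le
      · rw [ENat.top_mul h0]; exact le_top) (dimHom_ne_top_of_inFinAdd e hn hY)
  set γ : Y →ₗ[R] X := (LinearMap.ker ε).subtype ∘ₗ γ₀ with hγ
  set δ : X →ₗ[R] Y := δ₀ ∘ₗ toKer hεε with hδ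
  have hδγ : δ ∘ₗ γ = LinearMap.id := by
    rw [hδ, hγ, LinearMap.comp_assoc, ← LinearMap.comp_assoc γ₀,
      toKer_comp_subtype, LinearMap.id_comp, h₀]
  have hεγ : ε ∘ₗ γ = 0 := by
    rw [hγ, ← LinearMap.comp_assoc, self_comp_ker_subtype, LinearMap.zero_comp]
  have hδε : δ ∘ₗ ε = 0 := by
    rw [hδ, LinearMap.comp_assoc, toKer_comp_self, LinearMap.comp_zero]
  -- Each retraction `δ'` of `γ` that kills `ε` gives a larger finite idempotent `ε + γ δ'`.
  -- Maximality then forces the new elements `k ∘ δ' ∘ x` into `o ε`.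
  have key : ∀ δ' : X →ₗ[R] Y, δ' ∘ₗ γ = LinearMap.id → δ' ∘ₗ ε = 0 →
      ∀ k : Y →ₗ[R] M, (k ∘ₗ δ' ∘ₗ x : Module.End R M) ∈ o ε := by
    intro δ' h1 h2 k
    have hγδ : γ ∘ₗ δ' ∈ finMaps R M X X := comp_right_mem_finMaps (hY.mem_finMaps γ) δ'
    have h3 : (γ ∘ₗ δ') * ε = 0 := by
      rw [Module.End.mul_eq_comp, LinearMap.comp_assoc, h2, LinearMap.comp_zero]
    have h4 : ε * (γ ∘ₗ δ') = 0 := by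
      rw [Module.End.mul_eq_comp, ← LinearMap.comp_assoc, hεγ, LinearMap.zero_comp]
    have h5 : (γ ∘ₗ δ' : Module.End R X) * (γ ∘ₗ δ') = γ ∘ₗ δ' := by
      rw [Module.End.mul_eq_comp, LinearMap.comp_assoc, ← LinearMap.comp_assoc δ', h1,
        LinearMap.id_comp]
    have h6 : (ε + γ ∘ₗ δ') * (ε + γ ∘ₗ δ') = ε + γ ∘ₗ δ' := by
      rw [mul_add, add_mul, add_mul, hεε, h3, h4, h5, add_zero, zero_add]
    have hle : o ε ≤ o (ε + γ ∘ₗ δ') := by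
      rintro _ ⟨h, rfl⟩
      have := ho (ε + γ ∘ₗ δ') (h ∘ₗ ε)
      have h7 : (h ∘ₗ ε) ∘ₗ (ε + γ ∘ₗ δ') ∘ₗ x = h ∘ₗ (ε * (ε + γ ∘ₗ δ')) ∘ₗ x := rfl
      rw [h7, mul_add, hεε, h4, add_zero] at this
      exact this
    have hEq : o (ε + γ ∘ₗ δ') = o ε := by
      by_contra hne
      exact hmax _ ⟨_, ⟨h6, add_mem hε hγδ⟩, rfl⟩ (lt_of_le_of_ne hle (Ne.symm hne))
    have := ho (ε + γ ∘ₗ δ') ((k ∘ₗ δ) ∘ₗ (γ ∘ₗ δ'))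
    have h7 : ((k ∘ₗ δ) ∘ₗ (γ ∘ₗ δ')) ∘ₗ (ε + γ ∘ₗ δ') ∘ₗ x =
      (k ∘ₗ δ) ∘ₗ ((γ ∘ₗ δ') * (ε + γ ∘ₗ δ')) ∘ₗ x := rfl
    rw [h7, mul_add, h3, h5, zero_add, hEq] at this
    have h8 : (k ∘ₗ δ) ∘ₗ (γ ∘ₗ δ') ∘ₗ x = k ∘ₗ (δ ∘ₗ γ) ∘ₗ δ' ∘ₗ x := rfl
    rwa [h8, hδγ, LinearMap.id_comp] at this
  have hT : ∀ h : X →ₗ[R] M, ∀ t ∈ traceIdeal M (LinearMap.id : Y →ₗ[R] Y),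
      t * (h ∘ₗ (1 - ε) ∘ₗ x : Module.End R M) ∈ o ε := by
    intro h t ht
    have h1 : t * (h ∘ₗ (γ ∘ₗ δ) ∘ₗ x : Module.End R M) ∈ o ε :=
      ho_left _ _ _ (key δ hδγ hδε (h ∘ₗ γ))
    have h2 : t * (h ∘ₗ (1 - ε - γ ∘ₗ δ) ∘ₗ x : Module.End R M) ∈ o ε := by
      clear h1
      induction ht using Submodule.span_induction with
      | mem t ht =>
        obtain ⟨p, q, rfl⟩ := ht
        have hA : (1 - ε - γ ∘ₗ δ) ∘ₗ γ = 0 := by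
          rw [LinearMap.sub_comp, LinearMap.sub_comp, hεγ, LinearMap.comp_assoc, hδγ]
          ext; simp
        have hB : (1 - ε - γ ∘ₗ δ) ∘ₗ ε = 0 := by
          rw [LinearMap.sub_comp, LinearMap.comp_assoc, hδε, LinearMap.comp_zero, sub_zero]
          change (1 - ε) * ε = 0
          rw [sub_mul, one_mul, hεε, sub_self]
        -- Perturbing the retraction by any map through the remaining summand leaves it admissible,
        -- and subtracting the case `δ` isolates the perturbation.
        have h3 := key (δ + p ∘ₗ h ∘ₗ (1 - ε - γ ∘ₗ δ))
          (by rw [LinearMap.add_comp, hδγ, LinearMap.comp_assoc, LinearMap.comp_assoc, hA,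
            LinearMap.comp_zero, LinearMap.comp_zero, add_zero])
          (by rw [LinearMap.add_comp, hδε, LinearMap.comp_assoc, LinearMap.comp_assoc, hB,
            LinearMap.comp_zero, LinearMap.comp_zero, add_zero]) q
        rw [LinearMap.add_comp, LinearMap.comp_add] at h3
        exact (Submodule.add_mem_iff_right _ (key δ hδγ hδε q)).1 h3
      | zero => rw [zero_mul]; exact zero_mem _
      | add a b _ _ ha hb => rw [add_mul]; exact add_mem ha hb
      | smul r a _ ha => rw [smul_mul_assoc]; exact Submodule.smul_mem _ _ ha
    have h3 : (h ∘ₗ (1 - ε) ∘ₗ x : Module.End R M) =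
        h ∘ₗ (γ ∘ₗ δ) ∘ₗ x + h ∘ₗ (1 - ε - γ ∘ₗ δ) ∘ₗ x := by
      rw [← LinearMap.comp_add, ← LinearMap.add_comp, add_sub_cancel]
    rw [h3, mul_add]
    exact add_mem h1 h2
  have hXY := traceIdeal_le_of_dimHom e hn hX hY.inAdd fun i hi => by
    rw [hd, Pi.smul_apply, hi, smul_zero]
  obtain ⟨ψ, hψ, hψx⟩ := hX.exists_finMaps_comp_eq ((1 - ε) ∘ₗ x)
  obtain ⟨m, g, f, rfl⟩ := exists_sum_of_mem_finMaps hψ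
  have h1ε : (1 - ε) * (1 - ε) = 1 - ε := by
    rw [mul_sub, sub_mul, sub_mul, hεε]; simp
  have hf : ∀ h : X →ₗ[R] M, (h ∘ₗ (1 - ε) ∘ₗ x : Module.End R M) ∈ o ε := by
    -- Write `(1 - ε) ∘ x` as a finite sum through `M`. The left coefficients lie in the trace ideal
    -- of `X`, hence in that of `Y`, so `hT` applies.
    intro h
    have : (h ∘ₗ (1 - ε) ∘ₗ x : Module.End R M) =
        ∑ j, ((h ∘ₗ (1 - ε)) ∘ₗ LinearMap.id ∘ₗ g j : Module.End R M) *
          (f j ∘ₗ (1 - ε) ∘ₗ x : Module.End R M) := by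
      conv_lhs => rw [← h1ε, Module.End.mul_eq_comp, LinearMap.comp_assoc, ← hψx]
      ext y
      simp only [LinearMap.comp_apply, LinearMap.sum_apply, _root_.map_sum, Module.End.mul_apply,
        LinearMap.id_apply]
    rw [this]
    exact Submodule.sum_mem _ fun j _ => hT _ _ (hXY (mem_traceIdeal _ _ _))
  choose k hk using fun j => hf (f j)
  -- `τ` recovers the missing part `(1 - ε) ∘ x` from `ε ∘ x`.
  set τ : Module.End R X := ∑ j, g j ∘ₗ k j with hτ
  have hτx : τ ∘ₗ ε ∘ₗ x = (1 - ε) ∘ₗ x := by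
    conv_rhs => rw [← hψx]
    ext y
    simp only [hτ, LinearMap.comp_apply, LinearMap.sum_apply]
    refine Finset.sum_congr rfl fun j _ => ?_
    exact congrArg (g j) (LinearMap.congr_fun (hk j) y)
  have h1 : ε * ((1 - ε) * τ * ε) = 0 := by
    rw [← mul_assoc, ← mul_assoc, mul_sub, mul_one, hεε, sub_self, zero_mul, zero_mul]
  -- Shearing `ε` by `τ` keeps it idempotent and finite and adds exactly the missing part of `x`.
  refine ⟨ε + (1 - ε) * τ * ε, ?_, ?_, ?_⟩
  · rw [mul_add, add_mul, add_mul, hεε, h1, mul_assoc _ ε ε, hεε, mul_assoc _ ε, h1, mul_zero, add_zero, add_zero]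
  · exact add_mem hε (comp_left_mem_finMaps hε _)
  · have h2 : ((1 - ε) * τ * ε) ∘ₗ x = (1 - ε) ∘ₗ (τ ∘ₗ ε ∘ₗ x) := rfl
    rw [LinearMap.add_comp, h2, hτx, ← LinearMap.comp_assoc, ← Module.End.mul_eq_comp, h1ε,
      ← LinearMap.add_comp, add_sub_cancel]
    rfl

end FiniteIdempotents

/-! ### Internal direct sums. -/

section DirectSums

variable {R : Type u} [CommRing R] {M : Type v} [AddCommGroup M] [Module R M]
variable {X : Type v} [AddCommGroup X] [Module R X]

/-- In a compactly generated modular lattice independence is tested on finite subfamilies, where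
iterated independence is available. -/
theorem iSupIndep.sigma {α : Type*} [CompleteLattice α] [IsModularLattice α]
    [IsCompactlyGenerated α] {ι : Type*} {β : ι → Type*} {f : Sigma β → α}
    (h : iSupIndep fun i => ⨆ b, f ⟨i, b⟩) (hf : ∀ i, iSupIndep fun b => f ⟨i, b⟩) :
    iSupIndep f := by
  classical
  rw [iSupIndep_iff_supIndep]
  intro t
  have ht : t ⊆ (t.image Sigma.fst).sigma fun i => t.preimage (Sigma.mk i)
      sigma_mk_injective.injOn := by
    rintro ⟨i, b⟩ hb
    rw [Finset.mem_sigma, Finset.mem_preimage]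
    exact ⟨Finset.mem_image_of_mem _ hb, hb⟩
  refine Finset.SupIndep.subset (Finset.SupIndep.sigma ?_ fun i _ => (hf i).supIndep' _) ht
  exact Finset.SupIndep.antitone_fun
    (fun i _ => Finset.sup_le fun b _ => le_iSup (fun b => f ⟨i, b⟩) b) (h.supIndep' _)

theorem isDirectSumInFinAdd_iff : IsDirectSumInFinAdd R M X ↔
    ∃ (κ : Type v) (N : κ → Submodule R X), iSupIndep N ∧ ⨆ k, N k = ⊤ ∧ ∀ k, InFinAdd R M (N k) :=
  exists_congr fun _ => exists_congr fun N => (and_congr_left' <|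
    DirectSum.isInternal_submodule_iff_iSupIndep_and_iSup_eq_top (dec_ι := Classical.decEq _)
      N).trans and_assoc

theorem isDirectSumOfFinite_iff : IsDirectSumOfFinite R X ↔
    ∃ (κ : Type v) (N : κ → Submodule R X), iSupIndep N ∧ ⨆ k, N k = ⊤ ∧ ∀ k, (N k).FG :=
  exists_congr fun _ => exists_congr fun N => (and_congr_left' <|
    DirectSum.isInternal_submodule_iff_iSupIndep_and_iSup_eq_top (dec_ι := Classical.decEq _)
      N).trans and_assoc

theorem isDirectSumInFinAdd_of_iSupIndep {κ : Type v} {N : κ → Submodule R X}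
    (hi : iSupIndep N) (hs : ⨆ k, N k = ⊤) (h : ∀ k, IsDirectSumInFinAdd R M (N k)) :
    IsDirectSumInFinAdd R M X := by
  simp only [isDirectSumInFinAdd_iff] at h ⊢
  choose l L hL hL' hfin using h
  have hsup : ∀ k, ⨆ j, (L k j).map (N k).subtype = N k := fun k => by
    rw [← Submodule.map_iSup, hL' k, Submodule.map_top,
      Submodule.range_subtype]
  refine ⟨Σ k, l k, fun a => (L a.1 a.2).map (N a.1).subtype,
    iSupIndep.sigma ?_ fun k => ?_, ?_, fun a => ?_⟩
  · simpa only [hsup] using hi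
  · exact LinearMap.iSupIndep_map _ (N k).injective_subtype (hL k)
  · rw [iSup_sigma]
    simpa only [hsup] using hs
  · let E := (L a.1 a.2).equivMapOfInjective _ (N a.1).injective_subtype
    exact (hfin a.1 a.2).of_retract (α := E.symm.toLinearMap) (β := E.toLinearMap)
      (by ext x; simp)

theorem InFinAdd.isDirectSumInFinAdd (h : InFinAdd R M X) : IsDirectSumInFinAdd R M X := by
  refine isDirectSumInFinAdd_iff.2 ⟨PUnit, fun _ => ⊤, iSupIndep_subsingleton _, by simp,
    fun _ => ?_⟩
  exact h.of_retract (α := (⊤ : Submodule R X).subtype)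
    (β := (Submodule.topEquiv (R := R) (M := X)).symm.toLinearMap) (by ext; simp)

theorem isDirectSumInFinAdd_of_idempotent {ε : Module.End R X} (hε : ε * ε = ε)
    (h₁ : IsDirectSumInFinAdd R M (LinearMap.range ε))
    (h₂ : IsDirectSumInFinAdd R M (LinearMap.ker ε)) : IsDirectSumInFinAdd R M X := by
  have hc : IsCompl (LinearMap.range ε) (LinearMap.ker ε) :=
    LinearMap.IsIdempotentElem.isCompl hε
  refine isDirectSumInFinAdd_of_iSupIndep (κ := ULift Bool)
    (N := fun b => if b.down then LinearMap.range ε else LinearMap.ker ε) ?_ ?_ ?_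
  · rw [iSupIndep_pair (i := ⟨true⟩) (j := ⟨false⟩) (by simp) (by rintro ⟨_ | _⟩ <;> simp)]
    exact hc.disjoint
  · refine eq_top_iff.2 (hc.sup_eq_top.symm.le.trans (sup_le ?_ ?_))
    · exact le_iSup (fun b : ULift Bool =>
        if b.down then LinearMap.range ε else LinearMap.ker ε) ⟨true⟩
    · exact le_iSup (fun b : ULift Bool =>
        if b.down then LinearMap.range ε else LinearMap.ker ε) ⟨false⟩
  · rintro ⟨_ | _⟩
    · exact h₂
    · exact h₁

/-- The other ranges lie in the kernel of `d j`, which acts as the identity on its own range. -/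
theorem iSupIndep_range_of_orthogonal {ι : Type*} {d : ι → Module.End R X}
    (h : ∀ j, d j * d j = d j) (h' : ∀ j k, j ≠ k → d j * d k = 0) :
    iSupIndep fun j => LinearMap.range (d j) := by
  intro j
  have hle : ⨆ k, ⨆ (_ : k ≠ j), LinearMap.range (d k) ≤ LinearMap.ker (d j) :=
    iSup₂_le fun k hk => LinearMap.range_le_ker_iff.2 (h' j k hk.symm)
  refine Disjoint.mono_right hle (Submodule.disjoint_def.2 ?_)
  rintro _ ⟨x, rfl⟩ hx
  rw [← h, Module.End.mul_apply]
  exact hx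

/-- A countably generated object of `Add(M)` is the sum of the images of countably many maps
from `M`. -/
theorem InAdd.exists_iSup_range_eq_top (hX : InAdd R M X) (hc : IsCountablyGenerated R X) :
    ∃ p : ℕ → M →ₗ[R] X, ⨆ k, LinearMap.range (p k) = ⊤ := by
  obtain ⟨c, hc, hspan⟩ := hc
  have htop : ⨆ q : M →ₗ[R] X, LinearMap.range q = ⊤ := by
    obtain ⟨ι, f, g, h⟩ := hX
    refine eq_top_iff.2 fun x _ => ?_
    rw [← LinearMap.id_apply (R := R) x, ← h, LinearMap.comp_apply, ← (f x).sum_single,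
      Finsupp.sum, _root_.map_sum]
    exact Submodule.sum_mem _ fun k _ =>
      Submodule.mem_iSup_of_mem (g ∘ₗ Finsupp.lsingle k) ⟨f x k, rfl⟩
  choose t ht using fun x => Submodule.mem_iSup_iff_exists_finset.1
    (htop.symm ▸ Submodule.mem_top : x ∈ ⨆ q : M →ₗ[R] X, LinearMap.range q)
  -- Inserting the zero map makes the countable set nonempty, so that `ℕ` can enumerate it.
  have hT : (insert 0 (⋃ x ∈ c, (t x : Set (M →ₗ[R] X)))).Countable :=
    (hc.biUnion fun x _ => (t x).countable_toSet).insert 0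
  obtain ⟨p, hp⟩ := hT.exists_eq_range (Set.insert_nonempty _ _)
  refine ⟨p, eq_top_iff.2 (hspan.symm.le.trans (Submodule.span_le.2 fun x hx => ?_))⟩
  refine (iSup₂_le fun q hq => ?_ : ⨆ q ∈ t x, LinearMap.range q ≤ _) (ht x)
  have hqp : q ∈ Set.range p := hp ▸ Set.mem_insert_of_mem _ (Set.mem_biUnion hx hq)
  obtain ⟨k, rfl⟩ := hqp
  exact le_iSup (fun k => LinearMap.range (p k)) k

end DirectSums

/-! ### Countably generated modules with vector `∞ · a`. -/

section CountableDecomposition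

variable {R : Type u} [CommRing R] [IsNoetherianRing R] {M : Type v} [AddCommGroup M] [Module R M]
  [Module.Finite R M]
variable {X Y : Type v} [AddCommGroup X] [Module R X] [AddCommGroup Y] [Module R Y]
variable {s : ℕ} {n : Fin s → ℕ} {D : Fin s → Type w} [∀ i, DivisionRing (D i)]
variable (e : Module.End R M ⧸ Ring.jacobson (Module.End R M) ≃+*
  ∀ i, Matrix (Fin (n i)) (Fin (n i)) (D i))

/-- The kernel of `ε` has the same vector as `X`, so the component of `p` there is captured by a
finite idempotent, which is added to `ε`. -/
theorem exists_larger_idempotent (hn : ∀ i, 0 < n i) (hX : InAdd R M X) (hY : InFinAdd R M Y)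
    (hd : dimHom e X = (⊤ : ℕ∞) • dimHom e Y) {ε : Module.End R X} (hε : ε * ε = ε)
    (hfin : ε ∈ finMaps R M X X) (p : M →ₗ[R] X) :
    ∃ ε' : Module.End R X, ε' * ε' = ε' ∧ ε' ∈ finMaps R M X X ∧ ε * ε' = ε ∧ ε' * ε = ε ∧
      ε' ∘ₗ p = p := by
  obtain ⟨d, hdd, hdfin, hdp⟩ := exists_idempotent_comp_eq e hn (hX.ker_idempotent hε) hY
    (dimHom_ker_eq e hn hd hε hfin) (toKer hε ∘ₗ p)
  set d' : Module.End R X := (LinearMap.ker ε).subtype ∘ₗ d ∘ₗ toKer hε with hd'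
  have h1 : ε * d' = 0 := by
    rw [hd', Module.End.mul_eq_comp, ← LinearMap.comp_assoc, self_comp_ker_subtype,
      LinearMap.zero_comp]
  have h2 : d' * ε = 0 := by
    rw [hd', Module.End.mul_eq_comp, LinearMap.comp_assoc, LinearMap.comp_assoc, toKer_comp_self,
      LinearMap.comp_zero, LinearMap.comp_zero]
  have h3 : d' * d' = d' := by
    have : d' * d' = (LinearMap.ker ε).subtype ∘ₗ
      (d ∘ₗ (toKer hε ∘ₗ (LinearMap.ker ε).subtype) ∘ₗ d) ∘ₗ toKer hε := rfl
    rw [this, toKer_comp_subtype, LinearMap.id_comp, ← Module.End.mul_eq_comp, hdd]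
  have h4 : d' ∘ₗ p = (1 - ε) ∘ₗ p := by
    rw [← subtype_comp_toKer hε, LinearMap.comp_assoc _ (toKer hε), ← hdp]
    rfl
  refine ⟨ε + d', ?_, add_mem hfin (comp_left_mem_finMaps (comp_right_mem_finMaps hdfin _) _),
    ?_, ?_, ?_⟩
  · rw [mul_add, add_mul, add_mul, hε, h1, h2, h3, add_zero, zero_add]
  · rw [mul_add, hε, h1, add_zero]
  · rw [add_mul, hε, h2, add_zero]
  · rw [LinearMap.add_comp, h4, ← LinearMap.add_comp, add_sub_cancel]
    rfl

/-- A countably generated object of `Add(M)` whose dimensions are infinite multiples of those of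
an object of `add(M)` is a direct sum of objects of `add(M)`. -/
theorem isDirectSumInFinAdd_of_dimHom (hn : ∀ i, 0 < n i) (hX : InAdd R M X)
    (hc : IsCountablyGenerated R X) (hY : InFinAdd R M Y)
    (hd : dimHom e X = (⊤ : ℕ∞) • dimHom e Y) : IsDirectSumInFinAdd R M X := by
  obtain ⟨p, hp⟩ := hX.exists_iSup_range_eq_top hc
  choose! step hs1 hs2 hs3 hs4 hs5 using
    fun (k : ℕ) (ε : Module.End R X) (h : ε * ε = ε ∧ ε ∈ finMaps R M X X) =>
      exists_larger_idempotent e hn hX hY hd h.1 h.2 (p k)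
  let E : ℕ → Module.End R X := fun k => Nat.rec 0 step k
  have hE : ∀ k, E k * E k = E k ∧ E k ∈ finMaps R M X X := fun k => by
    induction k with
    | zero => exact ⟨mul_zero _, Submodule.zero_mem _⟩
    | succ k ih => exact ⟨hs1 k _ ih, hs2 k _ ih⟩
  have hle : ∀ j k, j ≤ k → E j * E k = E j ∧ E k * E j = E j := fun j k hjk => by
    induction k, hjk using Nat.le_induction with
    | base => exact ⟨(hE j).1, (hE j).1⟩
    | succ k _ ih =>
      have h3 : E k * E (k + 1) = E k := hs3 k _ (hE k)
      have h4 : E (k + 1) * E k = E k := hs4 k _ (hE k)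
      constructor
      · rw [← ih.1, mul_assoc, h3]
      · rw [← ih.2, ← mul_assoc, h4]
  -- The increasing chain `E k` captures `p k` at stage `k + 1`; its successive differences are
  -- orthogonal finite idempotents.
  let d : ℕ → Module.End R X := fun k => E (k + 1) - E k
  have hdd : ∀ k, d k * d k = d k := fun k => by
    simp only [d, mul_sub, sub_mul, (hE _).1, (hle k (k + 1) k.le_succ).1,
      (hle k (k + 1) k.le_succ).2, sub_self, sub_zero]
  have hlt : ∀ j k, j < k → d j * d k = 0 ∧ d k * d j = 0 := fun j k hjk => by
    simp only [d, mul_sub, sub_mul, (hle (j + 1) (k + 1) (by omega)).1,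
      (hle (j + 1) (k + 1) (by omega)).2, (hle j (k + 1) (by omega)).1,
      (hle j (k + 1) (by omega)).2, (hle (j + 1) k (by omega)).1,
      (hle (j + 1) k (by omega)).2, (hle j k hjk.le).1, (hle j k hjk.le).2, sub_self, and_self]
  have hind : iSupIndep fun k => LinearMap.range (d k) :=
    iSupIndep_range_of_orthogonal hdd fun j k hjk =>
      hjk.lt_or_gt.elim (fun h => (hlt j k h).1) fun h => (hlt k j h).2
  have hEd : ∀ k, LinearMap.range (E k) ≤ ⨆ j, LinearMap.range (d j) := fun k => by
    induction k with
    | zero => rintro _ ⟨x, rfl⟩; exact Submodule.zero_mem _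
    | succ k ih =>
      rintro _ ⟨x, rfl⟩
      have : E (k + 1) x = d k x + E k x := by simp [d]
      rw [this]
      exact Submodule.add_mem _ (Submodule.mem_iSup_of_mem k ⟨x, rfl⟩) (ih ⟨x, rfl⟩)
  have htop : ⨆ j, LinearMap.range (d j) = ⊤ := by
    refine eq_top_iff.2 (hp.symm.le.trans (iSup_le fun k => ?_))
    refine le_trans ?_ (hEd (k + 1))
    have h5 : E (k + 1) ∘ₗ p k = p k := hs5 k _ (hE k)
    rw [← h5]
    exact LinearMap.range_comp_le_range _ _
  refine isDirectSumInFinAdd_of_iSupIndep (κ := ULift ℕ) (N := fun k => LinearMap.range (d k.down))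
    (hind.comp ULift.down_injective) ?_ fun k => ?_
  · rw [← htop]
    exact ULift.down_surjective.iSup_comp (fun k => LinearMap.range (d k))
  · exact (inFinAdd_range (hdd _)
      (Submodule.sub_mem _ (hE (k.down + 1)).2 (hE k.down).2)).isDirectSumInFinAdd

end CountableDecomposition

/-! ### Kaplansky's theorem and coordinate projections. -/

section Kaplansky

theorem sSupIndep.insert {α : Type*} [CompleteLattice α] [IsModularLattice α] {t : Set α} {a : α}
    (ht : sSupIndep t) (ha : Disjoint a (sSup t)) : sSupIndep (insert a t) := by
  intro b hb
  by_cases hba : b = a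
  · subst hba
    refine ha.mono_right (sSup_le_sSup fun c hc => hc.1.resolve_left hc.2)
  · have hbt : b ∈ t := hb.resolve_left hba
    rw [Set.insert_sdiff_of_notMem _ (fun h => hba h.symm), sSup_insert, sup_comm]
    refine (ht hbt).disjoint_sup_right_of_disjoint_sup_left (ha.symm.mono_left ?_)
    exact sup_le (le_sSup hbt) (sSup_le_sSup Set.sdiff_subset)

/-- A countable set closed under a relation with finite fibres. -/
theorem exists_countable_closed {ι : Type*} (T : ι → Finset ι) (c : ι) :
    ∃ K : Set ι, K.Countable ∧ c ∈ K ∧ ∀ x ∈ K, (T x : Set ι) ⊆ K := by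
  let L : ℕ → Set ι := fun k => Nat.rec {c} (fun _ L => ⋃ x ∈ L, (T x : Set ι)) k
  have hL : ∀ k, (L k).Countable := fun k => by
    induction k with
    | zero => exact Set.countable_singleton c
    | succ k ih => exact ih.biUnion fun x _ => (T x).countable_toSet
  refine ⟨⋃ k, L k, Set.countable_iUnion hL, Set.mem_iUnion_of_mem 0 rfl, fun x hx y hy => ?_⟩
  obtain ⟨k, hk⟩ := Set.mem_iUnion.1 hx
  exact Set.mem_iUnion_of_mem (k + 1) (Set.mem_biUnion hk hy)

variable {R : Type u} [CommRing R] {M : Type v} [AddCommGroup M] [Module R M]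
variable {X : Type v} [AddCommGroup X] [Module R X]

theorem map_supported_le {ι : Type*} {N : Type*} [AddCommGroup N] [Module R N]
    (φ : (ι →₀ M) →ₗ[R] N) {K : Set ι} {L : Submodule R N}
    (h : ∀ x ∈ K, ∀ m, φ (Finsupp.single x m) ∈ L) :
    (Finsupp.supported M R K).map φ ≤ L := by
  rintro _ ⟨z, hz, rfl⟩
  rw [← z.sum_single, Finsupp.sum, _root_.map_sum]
  exact Submodule.sum_mem _ fun x hx => h x (hz hx) _

theorem exists_finset_single_mem [Module.Finite R M] {ι : Type*}
    (φ : (ι →₀ M) →ₗ[R] (ι →₀ M)) (x : ι) :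
    ∃ t : Finset ι, ∀ m, φ (Finsupp.single x m) ∈ Finsupp.supported M R (t : Set ι) := by
  classical
  obtain ⟨g, hg⟩ := Module.Finite.fg_top (R := R) (M := M)
  refine ⟨g.biUnion fun m => (φ (Finsupp.single x m)).support, fun m => ?_⟩
  have : Submodule.span R (g : Set M) ≤ (Finsupp.supported M R
      ((g.biUnion fun m => (φ (Finsupp.single x m)).support : Finset ι) : Set ι)).comap
      (φ ∘ₗ Finsupp.lsingle x) :=
    Submodule.span_le.2 fun m hm => by
      refine Finset.coe_subset.2 ?_
      exact Finset.subset_biUnion_of_mem (fun m => (φ (Finsupp.single x m)).support) hm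
  exact this (hg ▸ Submodule.mem_top)

theorem isCountablyGenerated_map_supported [Module.Finite R M] {ι : Type*} {N : Type*}
    [AddCommGroup N] [Module R N] (φ : (ι →₀ M) →ₗ[R] N) {K : Set ι} (hK : K.Countable) :
    IsCountablyGenerated R ((Finsupp.supported M R K).map φ) := by
  have := hK.to_subtype
  let E : Finsupp.supported M R K ≃ₗ[R] (K →₀ M) := Finsupp.supportedEquivFinsupp K
  exact (isCountablyGenerated_of_finite.finsupp (ι := K)).of_surjective
    (φ.submoduleMap (Finsupp.supported M R K) ∘ₗ E.symm.toLinearMap)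
    ((φ.submoduleMap_surjective _).comp E.symm.surjective)

/-- Kaplansky's theorem: an object of `Add(M)`, for a finitely generated module `M`, is a direct
sum of countably generated submodules. -/
theorem InAdd.exists_sSupIndep [Module.Finite R M] (hX : InAdd R M X) :
    ∃ 𝒟 : Set (Submodule R X), sSupIndep 𝒟 ∧ sSup 𝒟 = ⊤ ∧
      ∀ C ∈ 𝒟, IsCountablyGenerated R C := by
  classical
  obtain ⟨ι, f, g, hgf⟩ := hX
  choose T hT using exists_finset_single_mem (f ∘ₗ g)
  have hstab : ∀ K : Set ι, (∀ x ∈ K, (T x : Set ι) ⊆ K) → ∀ z ∈ Finsupp.supported M R K,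
      f (g z) ∈ Finsupp.supported M R K := fun K hK z hz =>
    map_supported_le (f ∘ₗ g) (fun x hx m => Finsupp.supported_mono (hK x hx) (hT x m))
      (Submodule.mem_map_of_mem hz)
  -- Zorn's lemma runs over index sets `K` stable under `f ∘ g` together with a decomposition of the
  -- image of `M^(K)`; stability makes that image a summand of `X`.
  let S : Set (Set ι × Set (Submodule R X)) := {p | (∀ x ∈ p.1, (T x : Set ι) ⊆ p.1) ∧
    sSupIndep p.2 ∧ (∀ C ∈ p.2, IsCountablyGenerated R C) ∧
    sSup p.2 = (Finsupp.supported M R p.1).map g}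
  obtain ⟨⟨K, 𝒟⟩, -, ⟨hK, hind, hcg, hsup⟩, hmax⟩ := zorn_le_nonempty₀ S (fun c hcS hc y hy => by
    refine ⟨(⋃ p : c, p.1.1, ⋃ p : c, p.1.2), ⟨?_, ?_, ?_, ?_⟩, fun p hp => ⟨?_, ?_⟩⟩
    · intro x hx
      obtain ⟨p, hp⟩ := Set.mem_iUnion.1 hx
      exact ((hcS p.2).1 x hp).trans (Set.subset_iUnion (fun p : c => p.1.1) p)
    · refine sSupIndep_iUnion_of_directed (fun p q => ?_) fun p => (hcS p.2).2.1
      obtain h | h := hc.total p.2 q.2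
      · exact ⟨q, h.2, le_rfl⟩
      · exact ⟨p, le_rfl, h.2⟩
    · intro C hC
      obtain ⟨p, hp⟩ := Set.mem_iUnion.1 hC
      exact (hcS p.2).2.2.1 C hp
    · rw [sSup_iUnion, Finsupp.supported_iUnion, Submodule.map_iSup]
      exact iSup_congr fun p => (hcS p.2).2.2.2
    · exact Set.subset_iUnion (fun p : c => p.1.1) ⟨p, hp⟩
    · exact Set.subset_iUnion (fun p : c => p.1.2) ⟨p, hp⟩) (∅, ∅)
    ⟨by simp, sSupIndep_empty, by simp, by simp⟩
  refine ⟨𝒟, hind, ?_, hcg⟩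
  suffices h : ∀ c, c ∈ K by
    rw [hsup, Set.eq_univ_of_forall h, Finsupp.supported_univ, Submodule.map_top,
      LinearMap.range_eq_top]
    exact fun x => ⟨f x, LinearMap.congr_fun hgf x⟩
  intro c
  obtain ⟨L, hL, hcL, hLstab⟩ := exists_countable_closed T c
  let ψ : Module.End R X := g ∘ₗ (Finsupp.supported M R K).subtype ∘ₗ
    Finsupp.restrictDom M R K ∘ₗ f
  have hψ : ∀ x ∈ (Finsupp.supported M R K).map g, ψ x = x := by
    rintro _ ⟨z, hz, rfl⟩
    have h1 : Finsupp.restrictDom M R K (f (g z)) = ⟨f (g z), hstab K hK z hz⟩ :=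
      LinearMap.congr_fun (Finsupp.restrictDom_comp_subtype (R := R) (M := M) K)
        ⟨f (g z), hstab K hK z hz⟩
    change g (Finsupp.restrictDom M R K (f (g z)) : ι →₀ M) = g z
    rw [h1]
    exact LinearMap.congr_fun hgf (g z)
  have hψK : ∀ x, ψ x ∈ (Finsupp.supported M R K).map g := fun x =>
    Submodule.mem_map_of_mem (Finsupp.restrictDom M R K (f x)).2
  -- `ψ` projects onto the part already decomposed, so `C` is what the countable stable set `L` adds
  -- modulo that part.
  set C : Submodule R X := (Finsupp.supported M R L).map ((1 - ψ) ∘ₗ g) with hC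
  have hdisj : Disjoint C (sSup 𝒟) := by
    rw [hsup, Submodule.disjoint_def]
    rintro _ ⟨z, -, rfl⟩ hz
    rw [← hψ _ hz]
    change ψ (g z - ψ (g z)) = 0
    rw [map_sub, hψ _ (hψK _), sub_self]
  have hmem : (K ∪ L, insert C 𝒟) ∈ S := by
    refine ⟨?_, hind.insert hdisj, ?_, ?_⟩
    · rintro x (hx | hx)
      · exact (hK x hx).trans Set.subset_union_left
      · exact (hLstab x hx).trans Set.subset_union_right
    · rintro _ (rfl | h)
      · exact isCountablyGenerated_map_supported _ hL
      · exact hcg _ h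
    · rw [sSup_insert, hsup, Finsupp.supported_union, Submodule.map_sup]
      refine le_antisymm (sup_le ?_ le_sup_left) (sup_le le_sup_right ?_)
      · rintro _ ⟨z, hz, rfl⟩
        exact sub_mem (Submodule.mem_sup_right (Submodule.mem_map_of_mem hz))
          (Submodule.mem_sup_left (hψK _))
      · rintro _ ⟨z, hz, rfl⟩
        rw [← sub_add_cancel (g z) (ψ (g z))]
        exact add_mem (Submodule.mem_sup_left ⟨z, hz, rfl⟩) (Submodule.mem_sup_right (hψK _))
  exact (hmax hmem ⟨Set.subset_union_left, Set.subset_insert _ _⟩).1 (Or.inr hcL)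

/-- The coordinate projections of an internal direct sum. -/
theorem exists_projections_of_iSupIndep {κ : Type*} {N : κ → Submodule R X} (h : iSupIndep N)
    (htop : ⨆ k, N k = ⊤) :
    ∃ π : ∀ k, X →ₗ[R] N k, (∀ k, π k ∘ₗ (N k).subtype = LinearMap.id) ∧
      ∀ j k, j ≠ k → π j ∘ₗ (N k).subtype = 0 := by
  have hc : ∀ k, IsCompl (N k) (⨆ j, ⨆ (_ : j ≠ k), N j) := fun k =>
    ⟨h k, codisjoint_iff.2 (eq_top_iff.2 (htop.symm.le.trans (iSup_le fun j => by
      by_cases hj : j = k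
      · rw [hj]; exact le_sup_left
      · exact (le_iSup₂_of_le (f := fun j (_ : j ≠ k) => N j) j hj le_rfl).trans
          le_sup_right)))⟩
  refine ⟨fun k => Submodule.projectionOnto _ _ (hc k), fun k => ?_, fun j k hjk => ?_⟩
  · exact Submodule.projectionOnto_comp_subtype (hc k)
  · ext ⟨x, hx⟩
    have : x ∈ ⨆ i, ⨆ (_ : i ≠ j), N i :=
      (le_iSup₂_of_le (f := fun i (_ : i ≠ j) => N i) k hjk.symm le_rfl) hx
    exact congrArg Subtype.val (Submodule.projectionOnto_apply_of_mem_right (hc j) this)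

theorem exists_finset_sum_of_iSupIndep [Module.Finite R M] {κ : Type*} {N : κ → Submodule R X}
    (htop : ⨆ k, N k = ⊤) {π : ∀ k, X →ₗ[R] N k}
    (hπ : ∀ k, π k ∘ₗ (N k).subtype = LinearMap.id)
    (hπ' : ∀ j k, j ≠ k → π j ∘ₗ (N k).subtype = 0) (p : M →ₗ[R] X) :
    ∃ t : Finset κ, p = ∑ k ∈ t, (N k).subtype ∘ₗ π k ∘ₗ p := by
  classical
  obtain ⟨g, hg⟩ := Module.Finite.fg_top (R := R) (M := M)
  choose t ht using fun m => Submodule.mem_iSup_iff_exists_finset.1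
    (htop.symm ▸ Submodule.mem_top : p m ∈ ⨆ k, N k)
  refine ⟨g.biUnion t, LinearMap.ext_on hg fun m hm => ?_⟩
  have hle : (⨆ k ∈ t m, N k) ≤ LinearMap.eqLocus LinearMap.id
      (∑ k ∈ g.biUnion t, (N k).subtype ∘ₗ π k) := iSup₂_le fun k hk x hx => by
    have hk' : k ∈ g.biUnion t := Finset.mem_biUnion.2 ⟨m, hm, hk⟩
    rw [LinearMap.mem_eqLocus, LinearMap.id_apply, LinearMap.sum_apply,
      Finset.sum_eq_single_of_mem k hk' fun j _ hj => ?_]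
    · exact (congrArg Subtype.val (LinearMap.congr_fun (hπ k) ⟨x, hx⟩)).symm
    · exact congrArg Subtype.val (LinearMap.congr_fun (hπ' j k hj) ⟨x, hx⟩)
  have := hle (ht m)
  rw [LinearMap.mem_eqLocus, LinearMap.id_apply] at this
  simp only [LinearMap.sum_apply, LinearMap.comp_apply] at this ⊢
  exact this

end Kaplansky

/-! ### The monoid of dimension vectors and its order-units. -/

section DimensionMonoid

variable {R : Type u} [CommRing R] {M : Type v} [AddCommGroup M] [Module R M]
variable {s : ℕ} {n : Fin s → ℕ} {D : Fin s → Type w} [∀ i, DivisionRing (D i)]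
variable (e : Module.End R M ⧸ Ring.jacobson (Module.End R M) ≃+*
  ∀ i, Matrix (Fin (n i)) (Fin (n i)) (D i))

/-- The monoid `D_M(V^*(M))`. -/
def dimMonoid : AddSubmonoid (Fin s → ℕ∞) where
  carrier := imageVStar e
  zero_mem' := ⟨PUnit, inferInstance, inferInstance,
    inAdd_self.of_retract (α := 0) (β := 0) (by ext),
    isCountablyGenerated_of_finite, dimHom_zero e⟩
  add_mem' := by
    rintro _ _ ⟨X, _, _, hX, hXc, rfl⟩ ⟨Y, _, _, hY, hYc, rfl⟩
    exact ⟨X × Y, inferInstance, inferInstance, hX.prod hY, hXc.prod hYc, dimHom_prod e⟩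

variable {e}

theorem dimHom_mem_dimMonoid {X : Type v} [AddCommGroup X] [Module R X] (hX : InAdd R M X)
    (hc : IsCountablyGenerated R X) : dimHom e X ∈ dimMonoid e :=
  ⟨X, inferInstance, inferInstance, hX, hc, rfl⟩

theorem top_smul_mem_dimMonoid [Module.Finite R M] (hn : ∀ i, 0 < n i) {b : Fin s → ℕ∞}
    (hb : b ∈ dimMonoid e) : (⊤ : ℕ∞) • b ∈ dimMonoid e := by
  obtain ⟨X, _, _, hX, hXc, rfl⟩ := hb
  rw [← dimHom_finsupp_nat e hn]
  exact dimHom_mem_dimMonoid hX.finsupp_nat hXc.finsupp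

theorem castVec_mem_dimMonoid [Module.Finite R M] (hn : ∀ i, 0 < n i) :
    castVec n ∈ dimMonoid e := by
  rw [← dimHom_self e hn]
  exact dimHom_mem_dimMonoid inAdd_self isCountablyGenerated_of_finite

theorem castVec_apply (x : Fin s → ℕ) (i : Fin s) : castVec x i = x i := rfl

theorem exists_castVec_eq {b : Fin s → ℕ∞} (h : ∀ i, b i ≠ ⊤) : ∃ x, castVec x = b :=
  ⟨fun i => (b i).toNat, funext fun i => ENat.natCast_toNat (h i)⟩

theorem add_left_cancel_of_ne_top {a b c : Fin s → ℕ∞} (ha : ∀ i, a i ≠ ⊤) (h : a + b = a + c) :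
    b = c :=
  funext fun i => WithTop.add_left_cancel (ha i) (congrFun h i)

theorem isOrderUnit_top_dimMonoid [Module.Finite R M] (hn : ∀ i, 0 < n i) :
    IsOrderUnit ℕ∞ (dimMonoid e) (castVec n) := by
  -- All entries of `n` are positive, so `∞ · n` is `∞` everywhere and absorbs every `b`.
  refine ⟨castVec_mem_dimMonoid hn, fun b _ => ⟨⊤, (⊤ : ℕ∞) • castVec n,
    top_smul_mem_dimMonoid hn (castVec_mem_dimMonoid hn), funext fun i => ?_⟩⟩
  have : (n i : ℕ∞) ≠ 0 := by simpa using (hn i).ne'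
  rw [Pi.add_apply, Pi.smul_apply, smul_eq_mul, castVec_apply, ENat.top_mul this, add_top]

section Complements

variable {X Y : Type v} [AddCommGroup X] [Module R X] [AddCommGroup Y] [Module R Y]

theorem exists_idempotent_of_dimHom_le [Module.Finite R M] (hn : ∀ i, 0 < n i) (hX : InFinAdd R M X)
    (hY : InAdd R M Y) (h : dimHom e X ≤ dimHom e Y) :
    ∃ ε : Module.End R Y, ε * ε = ε ∧ ε ∈ finMaps R M Y Y ∧
      dimHom e Y = dimHom e X + dimHom e (LinearMap.ker ε) := by
  obtain ⟨α, β, hβα⟩ := exists_retract_of_dimHom_le e hn hX hY h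
    (dimHom_ne_top_of_inFinAdd e hn hX)
  have hε : (α ∘ₗ β : Module.End R Y) * (α ∘ₗ β) = α ∘ₗ β := by
    rw [Module.End.mul_eq_comp, LinearMap.comp_assoc, ← LinearMap.comp_assoc _ α, hβα,
      LinearMap.id_comp]
  refine ⟨α ∘ₗ β, hε, comp_right_mem_finMaps (hX.mem_finMaps α) β,
    dimHom_eq_add e hβα (toKer_comp_subtype hε) ?_⟩
  rw [subtype_comp_toKer]
  exact add_sub_cancel _ _

theorem IsCountablyGenerated.ker_idempotent {ε : Module.End R X}
    (hX : IsCountablyGenerated R X) (h : ε * ε = ε) :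
    IsCountablyGenerated R (LinearMap.ker ε) :=
  hX.of_surjective (toKer h) fun x => ⟨x, LinearMap.congr_fun (toKer_comp_subtype h) x⟩

end Complements

section DimensionOne

variable [IsDomain R] [IsNoetherianRing R] [Module.Finite R M] [Module.IsTorsionFree R M]

theorem exists_inFinAdd_of_mem (hR : ringKrullDim R = 1) (hn : ∀ i, 0 < n i)
    {b : Fin s → ℕ∞} (hb : b ∈ dimMonoid e) (h : ∀ i, b i ≠ ⊤) :
    ∃ (X : Type v) (_ : AddCommGroup X) (_ : Module R X), InFinAdd R M X ∧ dimHom e X = b := by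
  obtain ⟨X, _, _, hX, -, rfl⟩ := hb
  exact ⟨X, _, _, inFinAdd_of_dimHom_ne_top e hR hn hX h, rfl⟩

/-- A module in `add(M)` with vector `a` splits off from one with vector `b`; the finite entries of
`a` cancel, so the complement has vector `c`. -/
theorem dimMonoid_mem_of_add_mem (hR : ringKrullDim R = 1) (hn : ∀ i, 0 < n i)
    {a b c : Fin s → ℕ∞} (ha : a ∈ dimMonoid e) (hb : b ∈ dimMonoid e) (ha' : ∀ i, a i ≠ ⊤)
    (h : a + c = b) : c ∈ dimMonoid e := by
  obtain ⟨X, _, _, hX, rfl⟩ := exists_inFinAdd_of_mem hR hn ha ha'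
  obtain ⟨Y, _, _, hY, hYc, rfl⟩ := hb
  obtain ⟨ε, hε, -, hd⟩ := exists_idempotent_of_dimHom_le (e := e) hn hX hY
    (h ▸ le_self_add)
  rw [add_left_cancel_of_ne_top ha' (h.trans hd)]
  exact dimHom_mem_dimMonoid (hY.ker_idempotent hε) (hYc.ker_idempotent hε)

theorem imageV_eq (hR : ringKrullDim R = 1) (hn : ∀ i, 0 < n i) :
    imageV e = castVec '' (finitePart (dimMonoid e) : Set (Fin s → ℕ)) := by
  ext b
  constructor
  · rintro ⟨X, _, _, hX, rfl⟩
    obtain ⟨x, hx⟩ := exists_castVec_eq (dimHom_ne_top_of_inFinAdd e hn hX)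
    have := hX.finite
    refine ⟨x, ?_, hx⟩
    change castVec x ∈ dimMonoid e
    rw [hx]
    exact dimHom_mem_dimMonoid hX.inAdd isCountablyGenerated_of_finite
  · rintro ⟨x, hx, rfl⟩
    exact exists_inFinAdd_of_mem hR hn hx fun i => ENat.natCast_ne_top _

theorem isOrderUnit_finitePart_dimMonoid (hR : ringKrullDim R = 1) (hn : ∀ i, 0 < n i) :
    IsOrderUnit ℕ (finitePart (dimMonoid e)) n := by
  have hnA : n ∈ finitePart (dimMonoid e) := castVec_mem_dimMonoid hn
  refine ⟨hnA, fun b hb => ?_⟩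
  -- The sum of all entries bounds each entry, and every `n i` is at least one.
  have hle : b ≤ (∑ i, b i) • n := fun i => by
    rw [Pi.smul_apply, smul_eq_mul]
    exact (Finset.single_le_sum (fun _ _ => Nat.zero_le _) (Finset.mem_univ i)).trans
      (Nat.le_mul_of_pos_right _ (hn i))
  refine ⟨∑ i, b i, (∑ i, b i) • n - b, ?_, add_tsub_cancel_of_le hle⟩
  refine dimMonoid_mem_of_add_mem hR hn (a := castVec b) (b := castVec ((∑ i, b i) • n)) hb
    (nsmul_mem hnA (∑ i, b i)) (fun i => ENat.natCast_ne_top _) ?_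
  rw [← map_add, add_tsub_cancel_of_le hle]

end DimensionOne

end DimensionMonoid

/-! ### The almost-free system of supports. -/

section SupportsOfDimensions

open SystemOfSupports

variable {s : ℕ}

theorem extend_apply_of_mem {H : Set (Fin s)} (x : {i : Fin s // i ∉ H} → ℕ) {i : Fin s}
    (hi : i ∈ H) : extend H x i = ⊤ := dif_pos hi

theorem extend_apply_of_notMem {H : Set (Fin s)} (x : {i : Fin s // i ∉ H} → ℕ) {i : Fin s}
    (hi : i ∉ H) : extend H x i = x ⟨i, hi⟩ := dif_neg hi

theorem extend_eq_top_iff {H : Set (Fin s)} (x : {i : Fin s // i ∉ H} → ℕ) (i : Fin s) :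
    extend H x i = ⊤ ↔ i ∈ H := by
  by_cases hi : i ∈ H
  · simp [extend_apply_of_mem x hi, hi]
  · simp [extend_apply_of_notMem x hi, hi]

theorem extend_add (H : Set (Fin s)) (x y : {i : Fin s // i ∉ H} → ℕ) :
    extend H (x + y) = extend H x + extend H y := by
  ext1 i
  by_cases hi : i ∈ H
  · simp [extend_apply_of_mem _ hi]
  · simp [extend_apply_of_notMem _ hi]

theorem extend_empty (x : Fin s → ℕ) : extend ∅ (fun i => x i.1) = castVec x :=
  funext fun i => extend_apply_of_notMem _ (Set.notMem_empty i)

theorem exists_extend_eq (b : Fin s → ℕ∞) : ∃ x, extend {i | b i = ⊤} x = b := by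
  refine ⟨fun i => (b i.1).toNat, funext fun i => ?_⟩
  by_cases hi : b i = ⊤
  · rw [extend_apply_of_mem _ (show i ∈ {i | b i = ⊤} from hi), hi]
  · rw [extend_apply_of_notMem _ (show i ∉ {i | b i = ⊤} from hi)]
    exact ENat.natCast_toNat hi

theorem extend_add_extend_zero {H K : Set (Fin s)} (h : H ⊆ K) (x : {i : Fin s // i ∉ H} → ℕ) :
    extend H x + extend K 0 =
      extend K fun i : {i : Fin s // i ∉ K} => x ⟨i.1, fun hi => i.2 (h hi)⟩ := by
  ext1 i
  by_cases hi : i ∈ K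
  · simp [extend_apply_of_mem _ hi]
  · simp [extend_apply_of_notMem _ hi, extend_apply_of_notMem x (fun hi' => hi (h hi'))]

variable {R : Type u} [CommRing R] {M : Type v} [AddCommGroup M] [Module R M]
variable {n : Fin s → ℕ} {D : Fin s → Type w} [∀ i, DivisionRing (D i)]
variable {e : Module.End R M ⧸ Ring.jacobson (Module.End R M) ≃+*
  ∀ i, Matrix (Fin (n i)) (Fin (n i)) (D i)}
variable [IsDomain R] [IsNoetherianRing R] [Module.Finite R M] [Module.IsTorsionFree R M]

/-- The infinite coordinate excludes `add(M)`, so the infinite set of `b` is the support of a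
nonzero idempotent ideal, which realizes arbitrary finite entries elsewhere. -/
theorem extend_mem_dimMonoid (hR : ringKrullDim R = 1) (hn : ∀ i, 0 < n i)
    {b : Fin s → ℕ∞} (hb : b ∈ dimMonoid e) {i : Fin s} (hi : b i = ⊤)
    (x : {i : Fin s // i ∉ {i | b i = ⊤}} → ℕ) : extend {i | b i = ⊤} x ∈ dimMonoid e := by
  classical
  obtain ⟨X, _, _, hX, -, rfl⟩ := hb
  obtain h | ⟨I, hI, hII, hI0, hsupp⟩ := inFinAdd_or_exists_idempotent e hR hn hX
  · exact (dimHom_ne_top_of_inFinAdd e hn h i hi).elim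
  obtain ⟨r, hr0, hr⟩ := exists_algebraMap_mem_of_ne_bot hI.1 hI.2 hI0
  have := isArtinian_quotient_of_algebraMap_mem hR hI.1 hr0 hr
  obtain ⟨Y, _, _, hY, hYc, h1, h2⟩ := exists_inAdd_of_idempotent e hn hI hII
    fun j => if h : dimHom e X j = ⊤ then 0 else x ⟨j, h⟩
  convert dimHom_mem_dimMonoid hY hYc using 1
  ext1 j
  by_cases hj : dimHom e X j = ⊤
  · rw [extend_apply_of_mem _ (show j ∈ {j | dimHom e X j = ⊤} from hj), h2 j ((hsupp j).2 hj)]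
  · rw [extend_apply_of_notMem _ (show j ∉ {j | dimHom e X j = ⊤} from hj),
      h1 j (mt (hsupp j).1 hj), dif_neg hj]

theorem extend_mem_dimMonoid_of_nonempty (hR : ringKrullDim R = 1) (hn : ∀ i, 0 < n i)
    {H : Set (Fin s)} (hH : ∃ b ∈ dimMonoid e, {i | b i = ⊤} = H) (h0 : H ≠ ∅)
    (x : {i : Fin s // i ∉ H} → ℕ) : extend H x ∈ dimMonoid e := by
  obtain ⟨b, hb, rfl⟩ := hH
  obtain ⟨i, hi⟩ := Set.nonempty_iff_ne_empty.2 h0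
  exact extend_mem_dimMonoid hR hn hb hi x

theorem extend_zero_mem_dimMonoid (hR : ringKrullDim R = 1) (hn : ∀ i, 0 < n i)
    {H : Set (Fin s)} (hH : ∃ b ∈ dimMonoid e, {i | b i = ⊤} = H) :
    extend H 0 ∈ dimMonoid e := by
  by_cases h0 : H = ∅
  · subst h0
    have : extend ∅ (0 : {i : Fin s // i ∉ (∅ : Set (Fin s))} → ℕ) = 0 :=
      (extend_empty 0).trans (map_zero _)
    rw [this]
    exact zero_mem _
  · exact extend_mem_dimMonoid_of_nonempty hR hn hH h0 0

variable (e) in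
/-- The system of supports that describes `D_M(V^*(M))`. -/
def systemOfSupports (hR : ringKrullDim R = 1) (hn : ∀ i, 0 < n i) : SystemOfSupports n where
  pos := hn
  supports := {H | ∃ b ∈ dimMonoid e, {i | b i = ⊤} = H}
  A H :=
    { carrier := {x | extend H.1 x ∈ dimMonoid e}
      zero_mem' := extend_zero_mem_dimMonoid hR hn H.2
      add_mem' := fun {x y} hx hy => by
        rw [Set.mem_ofPred_eq, extend_add]
        exact add_mem hx hy }
  empty_mem := ⟨0, zero_mem _, by simp⟩
  unit_mem := by
    change extend ∅ (fun i => n i.1) ∈ dimMonoid e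
    rw [extend_empty]
    exact castVec_mem_dimMonoid hn
  union_mem := by
    rintro _ ⟨b, hb, rfl⟩ _ ⟨c, hc, rfl⟩
    exact ⟨b + c, add_mem hb hc, by ext i; simp⟩
  supp_mem H x hx := by
    -- The infinite multiple is `∞` exactly on `H` and on the support of `x`.
    refine ⟨(⊤ : ℕ∞) • extend H.1 x, top_smul_mem_dimMonoid hn hx, ?_⟩
    ext i
    rw [Set.mem_ofPred_eq, Pi.smul_apply, smul_eq_mul]
    by_cases hi : i ∈ H.1
    · simp [extend_apply_of_mem x hi, hi]
    · by_cases h0 : x ⟨i, hi⟩ = 0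
      · simp [extend_apply_of_notMem x hi, hi, h0]
      · simp [extend_apply_of_notMem x hi, hi, h0]
  proj_mem H K h x hx := by
    change extend K.1 _ ∈ dimMonoid e
    -- Projecting to the complement of `K` amounts to adding the vector that is `∞` on `K` and zero
    -- elsewhere.
    rw [← extend_add_extend_zero h]
    exact add_mem hx (extend_zero_mem_dimMonoid hR hn K.2)

theorem carrier_systemOfSupports (hR : ringKrullDim R = 1) (hn : ∀ i, 0 < n i) :
    (dimMonoid e : Set (Fin s → ℕ∞)) = (systemOfSupports e hR hn).carrier := by
  refine Set.Subset.antisymm (fun b hb => ?_) (Set.iUnion_subset fun H => ?_)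
  · obtain ⟨x, hx⟩ := exists_extend_eq b
    refine Set.mem_iUnion.2 ⟨⟨{i | b i = ⊤}, b, hb, rfl⟩, x, ?_, hx⟩
    change extend {i | b i = ⊤} x ∈ dimMonoid e
    rw [hx]
    exact hb
  · rintro _ ⟨x, hx, rfl⟩
    exact hx

theorem isAlmostFree_systemOfSupports (hR : ringKrullDim R = 1) (hn : ∀ i, 0 < n i) :
    (systemOfSupports e hR hn).IsAlmostFree := by
  have htop : ∀ H : (systemOfSupports e hR hn).supports, H.1 ≠ ∅ →
      (systemOfSupports e hR hn).A H = ⊤ := fun H hH =>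
    eq_top_iff.2 fun x _ => extend_mem_dimMonoid_of_nonempty hR hn H.2 hH x
  refine ⟨fun H a ha b hb => ?_, htop⟩
  rintro ⟨c, hc⟩
  refine ⟨c, ?_, hc⟩
  by_cases hH : H.1 = ∅
  · refine dimMonoid_mem_of_add_mem hR hn ha hb (fun i => ?_)
      ((extend_add H.1 a c).symm.trans (congrArg _ hc))
    rw [Ne, extend_eq_top_iff, hH]
    exact Set.notMem_empty i
  · rw [htop H hH]
    exact AddSubmonoid.mem_top c

end SupportsOfDimensions

/-! ### The criterion for direct sum decompositions. -/

section DirectSumCriterion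

variable {s : ℕ}

/-- The two bounds say that `b` behaves as the possibly infinite sum of the `d k`. Only finitely
many `d k` meet the finite coordinates; they form `T`. -/
theorem exists_eq_castVec_add_top_smul {κ : Type*} (d : κ → Fin s → ℕ) (b : Fin s → ℕ∞)
    (h₁ : ∀ i (T : Finset κ), ∑ k ∈ T, (d k i : ℕ∞) ≤ b i)
    (h₂ : ∀ i (T : Finset κ), (∀ k ∉ T, d k i = 0) → b i ≤ ∑ k ∈ T, (d k i : ℕ∞)) :
    ∃ T T' : Finset κ,
      b = castVec (∑ k ∈ T, d k) + (⊤ : ℕ∞) • castVec (∑ k ∈ T', d k) := by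
  classical
  have hfin : ∀ i, b i ≠ ⊤ → {k | d k i ≠ 0}.Finite := fun i hi => by
    by_contra hinf
    obtain ⟨T, hT, hcard⟩ := Set.Infinite.exists_subset_card_eq hinf ((b i).toNat + 1)
    have h3 : (T.card : ℕ∞) ≤ b i := by
      refine le_trans ?_ (h₁ i T)
      rw [← Nat.cast_sum, Nat.cast_le, Finset.card_eq_sum_ones]
      exact Finset.sum_le_sum fun k hk => Nat.one_le_iff_ne_zero.2 (hT hk)
    rw [hcard, ← ENat.natCast_toNat hi, Nat.cast_le] at h3
    simp at h3
  let T : Finset κ := Finset.univ.biUnion fun i =>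
    if h : b i ≠ ⊤ then (hfin i h).toFinset else ∅
  have hT : ∀ i, b i ≠ ⊤ → ∀ k ∉ T, d k i = 0 := fun i hi k hk => by
    by_contra h0
    refine hk (Finset.mem_biUnion.2 ⟨i, Finset.mem_univ i, ?_⟩)
    rw [dif_pos hi]
    exact (hfin i hi).mem_toFinset.2 h0
  have hex : ∀ i, b i = ⊤ → ∃ k ∉ T, d k i ≠ 0 := fun i hi => by
    by_contra! h
    have := h₂ i T h
    rw [hi, ← Nat.cast_sum] at this
    exact ENat.natCast_ne_top _ (top_le_iff.1 this)
  choose k hkT hk using hex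
  -- `T'` takes one index outside `T` for each infinite coordinate. Being outside `T`, these vectors
  -- vanish at the finite coordinates, so their infinite multiple does no harm.
  refine ⟨T, Finset.univ.biUnion fun i => if h : b i = ⊤ then {k i h} else ∅, funext fun i => ?_⟩
  rw [Pi.add_apply, Pi.smul_apply, castVec_apply, castVec_apply, smul_eq_mul, Finset.sum_apply,
    Finset.sum_apply]
  by_cases hi : b i = ⊤
  · rw [ENat.top_mul, add_top, hi]
    rw [Nat.cast_ne_zero]
    refine (Nat.pos_of_ne_zero (hk i hi)).trans_le
      (Finset.single_le_sum (f := fun k => d k i) (fun _ _ => Nat.zero_le _) ?_) |>.ne'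
    refine Finset.mem_biUnion.2 ⟨i, Finset.mem_univ i, ?_⟩
    rw [dif_pos hi]
    exact Finset.mem_singleton_self _
  · have h0 : ∑ j ∈ Finset.univ.biUnion fun i => if h : b i = ⊤ then {k i h} else ∅, d j i = 0 := by
      refine Finset.sum_eq_zero fun j hj => hT i hi j ?_
      obtain ⟨l, -, hl⟩ := Finset.mem_biUnion.1 hj
      by_cases hbl : b l = ⊤
      · rw [dif_pos hbl, Finset.mem_singleton] at hl
        exact hl ▸ hkT l hbl
      · rw [dif_neg hbl] at hl
        exact (Finset.notMem_empty j hl).elim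
    rw [h0, Nat.cast_zero, mul_zero, add_zero, Nat.cast_sum]
    exact le_antisymm (h₂ i T (hT i hi)) (h₁ i T)

variable {R : Type u} [CommRing R] {M : Type v} [AddCommGroup M] [Module R M]
variable {n : Fin s → ℕ} {D : Fin s → Type w} [∀ i, DivisionRing (D i)]
variable {e : Module.End R M ⧸ Ring.jacobson (Module.End R M) ≃+*
  ∀ i, Matrix (Fin (n i)) (Fin (n i)) (D i)}

theorem IsDirectSumInFinAdd.isDirectSumOfFinite [Module.Finite R M] {X : Type v}
    [AddCommGroup X] [Module R X] (h : IsDirectSumInFinAdd R M X) : IsDirectSumOfFinite R X := by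
  obtain ⟨κ, N, hN, hfin⟩ := h
  exact ⟨κ, N, hN, fun k => Module.Finite.iff_fg.1 (hfin k).finite⟩

theorem addInftyMul_subset_dimMonoid [Module.Finite R M] (hn : ∀ i, 0 < n i) :
    addInftyMul (finitePart (dimMonoid e)) ⊆ dimMonoid e := by
  rintro _ ⟨a₁, h₁, a₂, h₂, rfl⟩
  exact add_mem h₁ (top_smul_mem_dimMonoid hn h₂)

theorem dimHom_mem_addInftyMul [Module.Finite R M] (hn : ∀ i, 0 < n i) {X : Type v}
    [AddCommGroup X] [Module R X] (hX : InAdd R M X) (h : IsDirectSumOfFinite R X) :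
    dimHom e X ∈ addInftyMul (finitePart (dimMonoid e)) := by
  obtain ⟨κ, N, hi, htop, hfg⟩ := isDirectSumOfFinite_iff.1 h
  obtain ⟨π, hπ, hπ'⟩ := exists_projections_of_iSupIndep hi htop
  have hN : ∀ k, InAdd R M (N k) := fun k => hX.of_retract (hπ k)
  have hNfin : ∀ k, Module.Finite R (N k) := fun k => Module.Finite.iff_fg.2 (hfg k)
  have hne : ∀ k i, dimHom e (N k) i ≠ ⊤ := fun k =>
    dimHom_ne_top_of_inFinAdd e hn (hN k).inFinAdd
  choose d hd using fun k => exists_castVec_eq (hne k)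
  have hd' : ∀ k i, (d k i : ℕ∞) = dimHom e (N k) i := fun k i => congrFun (hd k) i
  have hdA : ∀ k, d k ∈ finitePart (dimMonoid e) := fun k => by
    change castVec (d k) ∈ dimMonoid e
    rw [hd]
    exact dimHom_mem_dimMonoid (hN k) isCountablyGenerated_of_finite
  obtain ⟨T, T', hT⟩ := exists_eq_castVec_add_top_smul d (dimHom e X)
    (fun i T => by
      simp only [hd']
      exact sum_dimHom_le e (fun k => (N k).subtype) π hπ hπ' (fun k => hne k i) T)
    (fun i T h0 => by
      simp only [hd']
      refine dimHom_le_sum e (fun k => (N k).subtype) π hn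
        (exists_finset_sum_of_iSupIndep htop hπ hπ') (fun k => hne k i) T fun k hk => ?_
      rw [← hd', h0 k hk, Nat.cast_zero])
  exact ⟨_, sum_mem fun k _ => hdA k, _, sum_mem fun k _ => hdA k, hT⟩

/-- After Kaplansky each piece has vector `a₁ + ∞ · a₂`. A summand of vector `a₁` splits off, and
cancellation leaves a complement of vector `∞ · a₂`. -/
theorem isDirectSumInFinAdd_of_dimMonoid_eq [IsDomain R] [IsNoetherianRing R] [Module.Finite R M]
    [Module.IsTorsionFree R M] (hR : ringKrullDim R = 1) (hn : ∀ i, 0 < n i)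
    (h : (dimMonoid e : Set (Fin s → ℕ∞)) = addInftyMul (finitePart (dimMonoid e)))
    {X : Type v} [AddCommGroup X] [Module R X] (hX : InAdd R M X) :
    IsDirectSumInFinAdd R M X := by
  obtain ⟨𝒟, hind, htop, hcg⟩ := hX.exists_sSupIndep
  rw [sSupIndep_iff] at hind
  rw [sSup_eq_iSup'] at htop
  obtain ⟨π, hπ, -⟩ := exists_projections_of_iSupIndep hind htop
  refine isDirectSumInFinAdd_of_iSupIndep hind htop fun C => ?_
  have hC : InAdd R M C.1 := hX.of_retract (hπ C)
  obtain ⟨a₁, h₁, a₂, h₂, hd⟩ := h.le (dimHom_mem_dimMonoid (e := e) hC (hcg C.1 C.2))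
  obtain ⟨Y₁, _, _, hY₁, hd₁⟩ := exists_inFinAdd_of_mem hR hn h₁ fun i => ENat.natCast_ne_top _
  obtain ⟨Y₂, _, _, hY₂, hd₂⟩ := exists_inFinAdd_of_mem hR hn h₂ fun i => ENat.natCast_ne_top _
  rw [← hd₁, ← hd₂] at hd
  obtain ⟨ε, hε, hεfin, hdε⟩ := exists_idempotent_of_dimHom_le (e := e) hn hY₁ hC
    (hd ▸ le_self_add)
  refine isDirectSumInFinAdd_of_idempotent hε (inFinAdd_range hε hεfin).isDirectSumInFinAdd
    (isDirectSumInFinAdd_of_dimHom e hn (hC.ker_idempotent hε)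
      ((hcg C.1 C.2).ker_idempotent hε) hY₂ ?_)
  exact add_left_cancel_of_ne_top (dimHom_ne_top_of_inFinAdd e hn hY₁) (hdε.symm.trans hd)

end DirectSumCriterion

theorem mainTheorem9 {R : Type u} [CommRing R] [IsDomain R] [IsNoetherianRing R]
    (hR : ringKrullDim R = 1)
    {M : Type v} [AddCommGroup M] [Module R M] [Module.Finite R M] [Module.IsTorsionFree R M]
    {s : ℕ} {n : Fin s → ℕ} (hn : ∀ i, 0 < n i)
    {D : Fin s → Type w} [∀ i, DivisionRing (D i)]
    (e : Module.End R M ⧸ Ring.jacobson (Module.End R M) ≃+*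
      ∀ i, Matrix (Fin (n i)) (Fin (n i)) (D i)) :
    ∃ B : AddSubmonoid (Fin s → ℕ∞),
      (B : Set (Fin s → ℕ∞)) = imageVStar e ∧
      dimHom e M = castVec n ∧
      IsOrderUnit ℕ∞ B (castVec n) ∧
      IsOrderUnit ℕ (finitePart B) n ∧
      (∃ 𝒮 : SystemOfSupports n, 𝒮.IsAlmostFree ∧ (B : Set (Fin s → ℕ∞)) = 𝒮.carrier) ∧
      imageV e = castVec '' (finitePart B : Set (Fin s → ℕ)) ∧
      ((∀ (X : Type v) [AddCommGroup X] [Module R X], InAdd R M X → IsDirectSumInFinAdd R M X) ↔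
        (B : Set (Fin s → ℕ∞)) = addInftyMul (finitePart B)) ∧
      ((∀ (X : Type v) [AddCommGroup X] [Module R X], InAdd R M X → IsDirectSumOfFinite R X) ↔
        (B : Set (Fin s → ℕ∞)) = addInftyMul (finitePart B)) := by
  have h₁ : (dimMonoid e : Set (Fin s → ℕ∞)) = addInftyMul (finitePart (dimMonoid e)) →
      ∀ (X : Type v) [AddCommGroup X] [Module R X], InAdd R M X → IsDirectSumInFinAdd R M X :=
    fun h _ _ _ hX => isDirectSumInFinAdd_of_dimMonoid_eq hR hn h hX
  have h₂ : (∀ (X : Type v) [AddCommGroup X] [Module R X], InAdd R M X →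
      IsDirectSumOfFinite R X) →
      (dimMonoid e : Set (Fin s → ℕ∞)) = addInftyMul (finitePart (dimMonoid e)) := fun h => by
    refine Set.Subset.antisymm ?_ (addInftyMul_subset_dimMonoid hn)
    rintro _ ⟨X, _, _, hX, -, rfl⟩
    exact dimHom_mem_addInftyMul hn hX (h X hX)
  -- The three conditions close a cycle: summands in `add(M)` are finitely generated, such
  -- decompositions give `B = A + ∞ · A`, and this gives back summands in `add(M)`.
  exact ⟨dimMonoid e, rfl, dimHom_self e hn, isOrderUnit_top_dimMonoid hn,
    isOrderUnit_finitePart_dimMonoid hR hn,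
    ⟨systemOfSupports e hR hn, isAlmostFree_systemOfSupports hR hn,
      carrier_systemOfSupports hR hn⟩, imageV_eq hR hn,
    ⟨fun h => h₂ fun X _ _ hX => (h X hX).isDirectSumOfFinite, h₁⟩,
    ⟨h₂, fun h X _ _ hX => (h₁ h X hX).isDirectSumOfFinite⟩⟩

end
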